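/- **Setting.** Let $F$ be a 3-CNF formula (every clause has at most three literals and contains no complementary pair) over a finite variable set $V$ whose unique satisfying assignment is $(1,\dots,1)$. A clause is *critical* for $x$ if $x$ is its only positive literal. $\mathrm{TwoCC}$ is the set of variables having at least two distinct critical clauses, where besides the clauses of $F$ also the resolvents (with at most three literals, without a complementary pair) of two clauses of $F$ are counted. Every variable $a$ has a fixed *canonical* critical clause $C_a\in F$. *Trees.* Fix a height $h$. The critical clause tree $T_a$ of $a\in V$ has a root with variable label $a$; the assignment label of a node $v$ is $(1,\dots,1)$ with the variables labelling the path from the root to $v$ (inclusive) set to $0$; the clause label of a node $v$ of depth less than $h$ is a clause of $F$ violated by its assignment label, namely $C_b$ ($b$ the variable label of $v$) if $C_b$ is violated, and an arbitrary violated clause otherwise; $v$ has one child with variable label $w$ for every negative literal $\bar w$ of its clause label. Leaves of depth $h$ are *safe*. A node is *canonical* if no variable label on its path from the root (both ends included) is in $\mathrm{TwoCC}$ and the clause label of each of its proper ancestors is the canonical critical clause of that ancestor's variable label. For a placement $\pi:V\to[0,1]$, $\mathrm{Cut}(T_a)$ is the event that every path from the root to a safe leaf contains a non-root node whose variable label $b$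 has $\pi(b)<\pi(a)$. Let $$\mathrm{LabelDensity}(b,T_a)=\int_0^{1/2}\frac{(1-2r)^2}{(1-r)^3}\sum_{v} r^{\operatorname{depth}(v)+1}\,dr ,$$ the sum being over the canonical nodes $v$ of $T_a$ with variable label $b$. *Graph.* Let $\mathrm{Thr}\in\mathbb R$. $H_{\rm low}$ is a graph on $V$ of maximum degree at most $2$, each of whose connected components has at most $23$ vertices, such that for each edge $\{a,b\}$: $a,b\notin\mathrm{TwoCC}$; the canonical critical clause of some $c\notin\mathrm{TwoCC}$ is $(c\vee\bar a\vee\bar b)$; and $\mathrm{LabelDensity}(b,T_a)\le \mathrm{Thr}$ and $\mathrm{LabelDensity}(a,T_b)\le\mathrm{Thr}$. *Distribution.* Let $\gamma(r)=r(1-2r)^{3/2}$ and $\gamma_2(r)=25r^3(1-2r)^2$ for $r\in[0,\frac12]$, both $0$ for $r>\frac12$, and let $0\le\epsilon\le 0.1$. Under $D$, the placement $\pi\in[0,1]^V$ has density $$\prod_{c}\Bigl(1+\epsilon\sum_{\{u,v\}\in E(c)}\gamma'(\pi(u))\gamma'(\pi(v))\Bigr)\prod_{v\in\mathrm{TwoCC}}\bigl(1+\epsilon\gamma_2'(\pi(v))\bigr),$$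 where $c$ ranges over the connected components of $H_{\rm low}$. *Constants.* $Q_r=(r/(1-r))^2$ for $r<\frac12$, $Q_r=1$ for $r\ge\frac12$, and $s_3=\int_0^1Q_r\,dr$. **Statement.** There is a function $o:\mathbb N\to\mathbb R$ with $o(h)\to0$ as $h\to\infty$ such that, for all data as above: if $x\notin\mathrm{TwoCC}$ has canonical critical clause $(x\vee\bar y\vee\bar z)$ and $\{y,z\}\in H_{\rm low}$, then $$\Pr_D[\mathrm{Cut}(T_x)]\ \ge\ s_3-o(h)-1.0302\,\epsilon\,\mathrm{Thr}+\epsilon\int_0^{1/2}\gamma(r)^2(1-Q_r)^2\,dr .$$ Moreover $$\int_0^{1/2}\gamma(r)^2(1-Q_r)^2\,dr=170\ln2-\frac{707}{6}\ \ge\ 0.00168728 .$$ -/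

import Mathlib

open MeasureTheory Filter Topology

namespace PPSZ

/-! ### Formulas -/

/-- A literal: `(v, true)` is the variable `v`, `(v, false)` is its negation. -/
abbrev Literal (V : Type) := V × Bool

/-- A clause, i.e. a disjunction of literals. -/
abbrev Clause (V : Type) := Finset (Literal V)

section Formulas

variable {V : Type} [DecidableEq V]

/-- `α` satisfies the clause `C`. -/
def Clause.Sat (C : Clause V) (α : V → Bool) : Prop := ∃ l ∈ C, α l.1 = l.2

/-- At most three literals, and no variable occurs both positively and negatively. -/
def Clause.IsProper (C : Clause V) : Prop :=
  C.card ≤ 3 ∧ ∀ v : V, ¬ ((v, true) ∈ C ∧ (v, false) ∈ C)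

/-- `F` is a 3-CNF formula. -/
def IsThreeCNF (F : Finset (Clause V)) : Prop := ∀ C ∈ F, C.IsProper

/-- The all-ones assignment is the unique satisfying assignment of `F`. -/
def OnesUnique (F : Finset (Clause V)) : Prop :=
  ∀ α : V → Bool, (∀ C ∈ F, C.Sat α) ↔ α = fun _ => true

/-- The clause `C` is critical for `x`: the literal `x` is its only positive literal
(its only literal that is true under the all-ones assignment). -/
def Clause.IsCritical (C : Clause V) (x : V) : Prop :=
  (x, true) ∈ C ∧ ∀ l ∈ C, l.2 = true → l.1 = x

/-- `E` is a resolvent of `C` and `C'`. -/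
def IsResolvent (C C' E : Clause V) : Prop :=
  ∃ v : V, (v, true) ∈ C ∧ (v, false) ∈ C' ∧ E = C.erase (v, true) ∪ C'.erase (v, false)

/-- The clauses of `F`, together with the clauses (of at most three literals) derived by
resolving two clauses of `F`. -/
def derivedClauses (F : Finset (Clause V)) : Set (Clause V) :=
  {E | E ∈ F ∨ (E.IsProper ∧ ∃ C ∈ F, ∃ C' ∈ F, IsResolvent C C' E)}

/-- The variables that have at least two critical clauses, derived ones included. -/
def TwoCC (F : Finset (Clause V)) : Set V :=
  {x | ∃ C ∈ derivedClauses F, ∃ C' ∈ derivedClauses F,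
    C ≠ C' ∧ C.IsCritical x ∧ C'.IsCritical x}

/-- `canon` selects for every variable its canonical critical clause in `F`. -/
def IsCanonicalChoice (F : Finset (Clause V)) (canon : V → Clause V) : Prop :=
  ∀ x, canon x ∈ F ∧ (canon x).IsCritical x

/-! ### Critical clause trees

A node of a critical clause tree is represented by the list of the variable labels on the path
from the node up to the root: the head of the list is the variable label of the node itself and
the last entry is the label of the root. (The children of a node carry distinct labels.) -/

/-- The assignment label of a node: all-ones, except that the variables labelling the path from
the root to the node are set to `0`. -/
def assignmentLabel (p : List V) : V → Bool := fun v => decide (v ∉ p)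

/-- `sel` assigns clause labels: the clause label of a node is a clause of `F` that is violated by
its assignment label; it is the canonical critical clause of the variable label whenever that
clause is violated, and an arbitrary violated clause otherwise. -/
def IsClauseLabelling (F : Finset (Clause V)) (canon : V → Clause V)
    (sel : List V → Clause V) : Prop :=
  ∀ (a : V) (q : List V),
    sel (a :: q) ∈ F ∧ ¬ (sel (a :: q)).Sat (assignmentLabel (a :: q)) ∧
      (¬ (canon a).Sat (assignmentLabel (a :: q)) → sel (a :: q) = canon a)

/-- The nodes at depth `d` of the critical clause tree of `x`: the root is labelled `x`, and a
node has one child labelled `y` for every negative literal `¬ y` of its clause label. The tree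
`T_x` of height `h` consists of the nodes of depth at most `h`. -/
def nodesAt (sel : List V → Clause V) (x : V) : ℕ → Finset (List V)
  | 0 => {[x]}
  | d + 1 => (nodesAt sel x d).biUnion fun p =>
      ((sel p).filter fun l => l.2 = false).image fun l => l.1 :: p

/-- The event `Cut(T_x)` for the tree of height `h`: every path from the root to a safe leaf
(a leaf of depth `h`) contains a node other than the root whose label is placed before `x`. -/
def cutEvent (sel : List V → Clause V) (h : ℕ) (x : V) : Set (V → ℝ) :=
  {π | ∀ p ∈ nodesAt sel x h, ∃ v ∈ p.dropLast, π v < π x}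

/-- A node is canonical if no variable on its path to the root (the node and the root included)
is in `TwoCC`, and the clause label of every proper ancestor is the canonical critical clause of
the ancestor's variable label. -/
def IsCanonicalNode (F : Finset (Clause V)) (canon : V → Clause V) (sel : List V → Clause V)
    (p : List V) : Prop :=
  (∀ v ∈ p, v ∉ TwoCC F) ∧
    ∀ (a : V) (q : List V), (a :: q) <:+ p → (a :: q) ≠ p → sel (a :: q) = canon a

open Classical in
/-- `LabelDensity(b, T_a, r)` for the tree `T_a` of height `h`; the sum is over
the canonical nodes of `T_a` that carry the label `b`. -/
noncomputable def labelDensityAt (F : Finset (Clause V)) (canon : V → Clause V)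
    (sel : List V → Clause V) (h : ℕ) (b a : V) (r : ℝ) : ℝ :=
  (1 - 2 * r) ^ 2 / (1 - r) ^ 3 *
    ∑ d ∈ Finset.range (h + 1),
      ∑ _p ∈ (nodesAt sel a d).filter
        (fun p => p.head? = some b ∧ IsCanonicalNode F canon sel p), r ^ (d + 1)

/-- `LabelDensity(b, T_a)`. -/
noncomputable def labelDensity (F : Finset (Clause V)) (canon : V → Clause V)
    (sel : List V → Clause V) (h : ℕ) (b a : V) : ℝ :=
  ∫ r in (0 : ℝ)..(1 / 2), labelDensityAt F canon sel h b a r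

/-! ### The graphs -/

/-- The graph of the pairs `{y, z}` outside `TwoCC` that occur in the canonical critical clause
`(a ∨ ¬ y ∨ ¬ z)` of some variable `a` outside `TwoCC`. -/
def freeGraph (F : Finset (Clause V)) (canon : V → Clause V) : SimpleGraph V where
  Adj y z := y ≠ z ∧ y ∉ TwoCC F ∧ z ∉ TwoCC F ∧
    ∃ a, a ∉ TwoCC F ∧ canon a = {(a, true), (y, false), (z, false)}
  symm := ⟨by
    rintro y z ⟨h1, h2, h3, a, h4, h5⟩
    exact ⟨h1.symm, h3, h2, a, h4, by rw [h5, Finset.pair_comm]⟩⟩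
  loopless := ⟨fun _ h => h.1 rfl⟩

/-- `G` is admissible as the graph `H_low`: it is a subgraph of the free graph, has maximum
degree at most `2`, its components (paths and cycles) are small, and along each of its edges
the label densities (in both directions, since adjacency is symmetric) are at most `Thr`. -/
structure IsLowGraph (F : Finset (Clause V)) (canon : V → Clause V) (sel : List V → Clause V)
    (h : ℕ) (Thr : ℝ) (G : SimpleGraph V) : Prop where
  le_free : G ≤ freeGraph F canon
  degree_le : ∀ v, (G.neighborSet v).ncard ≤ 2
  component_le : ∀ c : G.ConnectedComponent, c.supp.ncard ≤ 23
  density_le : ∀ a b, G.Adj a b → labelDensity F canon sel h b a ≤ Thr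

end Formulas

/-! ### The distribution of the placement -/

/-- `γ(r) = r (1 - 2r)^{3/2}` on `[0, 1/2]`, and `0` beyond. -/
noncomputable def gamma (r : ℝ) : ℝ :=
  if r ≤ 1 / 2 then r * (1 - 2 * r) ^ (3 / 2 : ℝ) else 0

/-- `φ = γ'`. -/
noncomputable def phi : ℝ → ℝ := deriv gamma

/-- `γ_TwoCC(r) = 25 r³ (1 - 2r)²` on `[0, 1/2]`, and `0` beyond. -/
noncomputable def gammaTwoCC (r : ℝ) : ℝ :=
  if r ≤ 1 / 2 then 25 * r ^ 3 * (1 - 2 * r) ^ 2 else 0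

/-- The derivative of `γ_TwoCC`. -/
noncomputable def phiTwoCC : ℝ → ℝ := deriv gammaTwoCC

open Classical in
/-- The density of `D`: the components of `H_low` are independent, a component `c` having the
joint density `1 + ε ∑ φ(π(u)) φ(π(v))`, the sum being over the edges `{u, v}` of `c`; a variable
in `TwoCC` is independent of the others and has density `1 + ε γ_TwoCC'`. (The remaining
variables are thus uniform and independent.) -/
noncomputable def placementDensity {V : Type} [Fintype V] [DecidableEq V]
    (F : Finset (Clause V)) (G : SimpleGraph V) (ε : ℝ) (π : V → ℝ) : ℝ :=
  (∏ c : G.ConnectedComponent,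
      (1 + ε * ∑ e ∈ G.edgeFinset.filter (fun e => ∀ v ∈ e, v ∈ c.supp),
        (e.map fun v => phi (π v)).mul)) *
    ∏ v ∈ Finset.univ.filter (fun v => v ∈ TwoCC F), (1 + ε * phiTwoCC (π v))

/-- The distribution `D` on placements `π : V → [0, 1]`. -/
noncomputable def placementDist {V : Type} [Fintype V] [DecidableEq V]
    (F : Finset (Clause V)) (G : SimpleGraph V) (ε : ℝ) : Measure (V → ℝ) :=
  (Measure.pi fun _ : V => (volume : Measure ℝ).restrict (Set.Icc 0 1)).withDensity
    fun π => ENNReal.ofReal (placementDensity F G ε π)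

/-! ### Constants -/

/-- `Q_r`: the probability that, when every non-root node of the infinite binary tree is
independently deleted with probability `r`, no infinite path from the root survives. -/
noncomputable def Q (r : ℝ) : ℝ := if r < 1 / 2 then (r / (1 - r)) ^ 2 else 1

/-- `s_3 = ∫₀¹ Q_r dr` (which is `2 - 2 ln 2`). -/
noncomputable def s3 : ℝ := ∫ r in (0 : ℝ)..1, Q r

end PPSZ

open PPSZ

/-! Condition on `π x = r` and keep only the bits telling which variables are placed before `x`. For
`r > 1/2` the corrections in the density vanish, and a union bound shows that the tree is cut up to
a term vanishing with the height. For `r < 1/2`, with `t = r / (1 - r)`, the ideal binary tree has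
cut probability `t ^ 2 = Q r`, where `t = 1 - (1 - r) * (1 - t ^ 2)`; the question is how much the
dependencies of `D` change this.

The means of `γ'` over `[0, r]` and `[r, 1]` are `γ(r) / r` and `-γ(r) / (1 - r)`. Hence each edge
term of the conditional density has the form `λ * (kernel - 1)`, where the kernel forces the two
endpoint bits to agree (`meanPhi_mul_eq`). A component is therefore a mixture: with probability `λ`
the endpoints of a given edge are identified, and at most one edge of the component is. Edges at `x`
would get a negative weight when `r < 1/5`; for `r ≤ 1/5` they only help the cut and are dropped
(`mixture_le_condCutProb`).

Identification hurts when a node is a copy of one of its ancestors: on an uncut path the ancestor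
survives, and so does the copy. It helps for the siblings `y`, `z` below the root: if their subtrees
have cut probabilities `a`, `b`, identifying them raises the value by `r * (1 - r) * (1 - a) * (1 -
b)`. Since `r * (1 - r) * λ = ε * γ ^ 2`, the ideal values `a = b = Q r` produce the gain integral.
All other edges may be made independent at the price of a factor `4 / (3 + 2 * r)` in their
probabilities (`ex_le_mix`), and Harris' inequality then permits a product recursion with averaged
deletion probabilities (`cutProb_le_ex`, `le_ex_rootVal`).

The recursion is perturbed around its fixed point. Only losses at canonical nodes reach the root
(`sub_loss_le_cutProb`). A child in `TwoCC` has an increased deletion probability, which pays for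
its whole subtree; a canonical node with a noncanonical clause label has at most one child
(`IsClauseLabelling.card_children_le_one`), so its value is near `t` instead of `t ^ 2`, and this
slack pays.

The remaining loss is a sum over canonical nodes and their ancestors adjacent in the graph. Grouped
by the ancestor `a` (`loss_edgeLoss`), it is controlled by label densities, because the canonical
part below `a` embeds into the tree of `a` itself (`nbrSum_append_le`). Integrating over `r`, with
at most `2 ^ d` nodes at depth `d` and a telescoping series (`IsLowGraph.integral_innerBound_le`),
bounds the loss by `1.0302 * ε * Thr`. -/

namespace PPSZ

/-! ### Expectations over independent bits -/

section Expectation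

variable {ι : Type} [DecidableEq ι]

/-- The expectation of `f` when the coordinates in the list are independently resampled,
the coordinate `i` being `true` with probability `p i`. -/
noncomputable def ex (p : ι → ℝ) : List ι → ((ι → Bool) → ℝ) → (ι → Bool) → ℝ
  | [], f, b => f b
  | i :: L, f, b => p i * ex p L f (Function.update b i true) +
      (1 - p i) * ex p L f (Function.update b i false)

variable {p : ι → ℝ}

theorem ex_append (L L' : List ι) (f : (ι → Bool) → ℝ) (b : ι → Bool) :
    ex p (L ++ L') f b = ex p L (ex p L' f) b := by
  induction L generalizing b with
  | nil => rfl
  | cons i L ih => simp only [List.cons_append, ex, ih]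

theorem ex_add (L : List ι) (f g : (ι → Bool) → ℝ) (b : ι → Bool) :
    ex p L (fun x => f x + g x) b = ex p L f b + ex p L g b := by
  induction L generalizing b with
  | nil => rfl
  | cons i L ih => simp only [ex, ih]; ring

theorem ex_const_mul (L : List ι) (c : ℝ) (f : (ι → Bool) → ℝ) (b : ι → Bool) :
    ex p L (fun x => c * f x) b = c * ex p L f b := by
  induction L generalizing b with
  | nil => rfl
  | cons i L ih => simp only [ex, ih]; ring

theorem ex_const (L : List ι) (c : ℝ) (b : ι → Bool) : ex p L (fun _ => c) b = c := by
  induction L generalizing b with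
  | nil => rfl
  | cons i L ih => simp only [ex, ih]; ring

theorem ex_neg (L : List ι) (f : (ι → Bool) → ℝ) (b : ι → Bool) :
    ex p L (fun x => -f x) b = -ex p L f b := by
  induction L generalizing b with
  | nil => rfl
  | cons i L ih => simp only [ex, ih]; ring

theorem ex_sub (L : List ι) (f g : (ι → Bool) → ℝ) (b : ι → Bool) :
    ex p L (fun x => f x - g x) b = ex p L f b - ex p L g b := by
  induction L generalizing b with
  | nil => rfl
  | cons i L ih => simp only [ex, ih]; ring

theorem ex_one_sub (L : List ι) (f : (ι → Bool) → ℝ) (b : ι → Bool) :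
    ex p L (fun x => 1 - f x) b = 1 - ex p L f b := by
  rw [ex_sub, ex_const]

theorem ex_mono (hp : ∀ i, p i ∈ Set.Icc (0 : ℝ) 1) (L : List ι) {f g : (ι → Bool) → ℝ}
    (h : ∀ x, f x ≤ g x) (b : ι → Bool) : ex p L f b ≤ ex p L g b := by
  induction L generalizing b with
  | nil => exact h b
  | cons i L ih =>
    have h1 := (hp i).1
    have h2 := (hp i).2
    exact add_le_add (mul_le_mul_of_nonneg_left (ih _) h1)
      (mul_le_mul_of_nonneg_left (ih _) (by linarith))

theorem ex_nonneg (hp : ∀ i, p i ∈ Set.Icc (0 : ℝ) 1) (L : List ι) {f : (ι → Bool) → ℝ}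
    (h : ∀ x, 0 ≤ f x) (b : ι → Bool) : 0 ≤ ex p L f b := by
  simpa [ex_const] using ex_mono hp L h b

theorem ex_le_one (hp : ∀ i, p i ∈ Set.Icc (0 : ℝ) 1) (L : List ι) {f : (ι → Bool) → ℝ}
    (h : ∀ x, f x ≤ 1) (b : ι → Bool) : ex p L f b ≤ 1 := by
  simpa [ex_const] using ex_mono hp L h b

theorem monotone_ex (hp : ∀ i, p i ∈ Set.Icc (0 : ℝ) 1) (L : List ι) {f : (ι → Bool) → ℝ}
    (hf : Monotone f) : Monotone (ex p L f) := by
  induction L with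
  | nil => exact hf
  | cons i L ih =>
    intro b b' hb
    have h1 := (hp i).1
    have h2 := (hp i).2
    exact add_le_add
      (mul_le_mul_of_nonneg_left (ih
        (fun j => by by_cases h : j = i <;> simp [Function.update, h, hb j])) h1)
      (mul_le_mul_of_nonneg_left (ih
        (fun j => by by_cases h : j = i <;> simp [Function.update, h, hb j])) (by linarith))

/-- Harris' inequality. -/
theorem ex_mul_le (hp : ∀ i, p i ∈ Set.Icc (0 : ℝ) 1) (L : List ι) {f g : (ι → Bool) → ℝ}
    (hf : Monotone f) (hg : Monotone g) (b : ι → Bool) :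
    ex p L f b * ex p L g b ≤ ex p L (fun x => f x * g x) b := by
  induction L generalizing b with
  | nil => exact le_rfl
  | cons i L ih =>
    have h1 := (hp i).1
    have h2 := (hp i).2
    have hle : Function.update b i false ≤ Function.update b i true := by
      intro j; by_cases h : j = i
      · subst h; simp
      · simp [h]
    have hF := monotone_ex hp L hf hle
    have hG := monotone_ex hp L hg hle
    have e1 := mul_le_mul_of_nonneg_left (ih (Function.update b i true)) h1
    have e2 := mul_le_mul_of_nonneg_left (ih (Function.update b i false)) (sub_nonneg.2 h2)
    -- The covariance over the single coordinate `i` is `p (1 - p) (F₁ - F₀) (G₁ - G₀)`, a product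
    -- of nonnegative factors.
    have e3 := mul_nonneg (mul_nonneg h1 (sub_nonneg.2 h2))
      (mul_nonneg (sub_nonneg.2 hF) (sub_nonneg.2 hG))
    simp only [ex]
    nlinarith [e1, e2, e3]

theorem ex_mul_le_of_antitone (hp : ∀ i, p i ∈ Set.Icc (0 : ℝ) 1) (L : List ι)
    {f g : (ι → Bool) → ℝ} (hf : Antitone f) (hg : Antitone g) (b : ι → Bool) :
    ex p L f b * ex p L g b ≤ ex p L (fun x => f x * g x) b := by
  have := ex_mul_le hp L hf.neg hg.neg b
  simpa [ex_neg] using this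

theorem ex_prod_le (hp : ∀ i, p i ∈ Set.Icc (0 : ℝ) 1) (L : List ι) {κ : Type}
    (s : Finset κ) {f : κ → (ι → Bool) → ℝ} (hf : ∀ k ∈ s, Monotone (f k))
    (h0 : ∀ k ∈ s, ∀ x, 0 ≤ f k x) (b : ι → Bool) :
    ∏ k ∈ s, ex p L (f k) b ≤ ex p L (fun x => ∏ k ∈ s, f k x) b := by
  classical
  induction s using Finset.induction_on with
  | empty => simp [ex_const]
  | insert k s hk ih =>
    simp only [Finset.prod_insert hk]
    have hm : Monotone (fun x => ∏ k ∈ s, f k x) := fun x y hxy =>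
      Finset.prod_le_prod (fun k hk => h0 k (Finset.mem_insert_of_mem hk) x)
        fun k hk => hf k (Finset.mem_insert_of_mem hk) hxy
    refine le_trans ?_ (ex_mul_le hp L (hf k (Finset.mem_insert_self _ _)) hm b)
    exact mul_le_mul_of_nonneg_left
      (ih (fun j hj => hf j (Finset.mem_insert_of_mem hj))
        fun j hj => h0 j (Finset.mem_insert_of_mem hj))
      (ex_nonneg hp L (h0 k (Finset.mem_insert_self _ _)) b)

theorem dependsOn_ex (L : List ι) {f : (ι → Bool) → ℝ} {S : Set ι} (hf : DependsOn f S) :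
    DependsOn (ex p L f) S := by
  induction L with
  | nil => exact hf
  | cons i L ih =>
    intro x y hxy
    have h : ∀ t : Bool, ex p L f (Function.update x i t) = ex p L f (Function.update y i t) := by
      intro t
      refine ih fun j hj => ?_
      by_cases h : j = i
      · subst h; simp
      · simp [h, hxy j hj]
    simp only [ex, h]

/-- Each coordinate is visible to at most one factor; resampling it leaves the mean of the other
factor unchanged, so that mean can be pulled out. -/
theorem ex_mul_of_disjoint (L : List ι) {f g : (ι → Bool) → ℝ} {S T : Set ι}
    (hf : DependsOn f S) (hg : DependsOn g T) (hST : Disjoint S T) (b : ι → Bool) :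
    ex p L (fun x => f x * g x) b = ex p L f b * ex p L g b := by
  induction L generalizing b with
  | nil => rfl
  | cons i L ih =>
    have key : ∀ {F : (ι → Bool) → ℝ} {S : Set ι}, DependsOn F S → i ∉ S →
        ex p L F (Function.update b i true) = ex p L F (Function.update b i false) := by
      intro F S hF hi
      refine dependsOn_ex L hF fun j hj => ?_
      have : j ≠ i := fun h => hi (h ▸ hj)
      simp [this]
    simp only [ex, ih]
    by_cases hi : i ∈ S
    · rw [key hg (Set.disjoint_left.1 hST hi)]; ring
    · rw [key hf hi]; ring

/-- The expectation over all coordinates. -/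
noncomputable def bexp [Fintype ι] (p : ι → ℝ) (f : (ι → Bool) → ℝ) : ℝ :=
  ∑ b : ι → Bool, f b * ∏ i, if b i then p i else 1 - p i

variable [Fintype ι]

theorem bexp_add (f g : (ι → Bool) → ℝ) :
    bexp p (fun b => f b + g b) = bexp p f + bexp p g := by
  simp only [bexp, add_mul, Finset.sum_add_distrib]

theorem bexp_const_mul (c : ℝ) (f : (ι → Bool) → ℝ) :
    bexp p (fun b => c * f b) = c * bexp p f := by
  simp only [bexp, Finset.mul_sum, mul_assoc]

theorem bexp_sum {κ : Type} (s : Finset κ) (f : κ → (ι → Bool) → ℝ) :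
    bexp p (fun b => ∑ k ∈ s, f k b) = ∑ k ∈ s, bexp p (f k) := by
  simp only [bexp, Finset.sum_mul]
  exact Finset.sum_comm

theorem bexp_const (c : ℝ) : bexp p (fun _ => c) = c := by
  have h : ∏ i, ∑ t : Bool, (if t then p i else 1 - p i) = 1 := by simp
  rw [Finset.prod_univ_sum] at h
  simp only [Fintype.piFinset_univ] at h
  rw [bexp, ← Finset.mul_sum, h, mul_one]

theorem bexp_nonneg (hp : ∀ i, p i ∈ Set.Icc (0 : ℝ) 1) {f : (ι → Bool) → ℝ}
    (h : ∀ b, 0 ≤ f b) : 0 ≤ bexp p f :=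
  Finset.sum_nonneg fun b _ => mul_nonneg (h b) <| Finset.prod_nonneg fun i _ => by
    have h1 := (hp i).1
    have h2 := (hp i).2
    split_ifs <;> linarith

/-- Resampling one coordinate. -/
theorem bexp_resample (i : ι) (f : (ι → Bool) → ℝ) :
    bexp p f = bexp p fun b => p i * f (Function.update b i true) +
      (1 - p i) * f (Function.update b i false) := by
  have key : ∀ F : (ι → Bool) → ℝ, bexp p F = ∑ c : {j // j ≠ i} → Bool, ∑ t : Bool,
      F ((Equiv.funSplitAt i Bool).symm (t, c)) * ((if t then p i else 1 - p i) *
        ∏ j : {j // j ≠ i}, if c j then p j else 1 - p j) := by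
    intro F
    rw [bexp, ← Equiv.sum_comp (Equiv.funSplitAt i Bool).symm, Fintype.sum_prod_type_right]
    refine Finset.sum_congr rfl fun c _ => Finset.sum_congr rfl fun t _ => ?_
    congr 1
    rw [Fintype.prod_eq_mul_prod_subtype_ne _ i]
    congr 1
    · simp
    · refine Finset.prod_congr rfl fun j _ => ?_
      simp [j.2]
  rw [key, key]
  refine Finset.sum_congr rfl fun c _ => ?_
  have hu : ∀ s t : Bool, Function.update ((Equiv.funSplitAt i Bool).symm (t, c)) i s =
      (Equiv.funSplitAt i Bool).symm (s, c) := by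
    intro s t
    ext j
    by_cases h : j = i
    · subst h; simp
    · simp [h]
  simp only [Fintype.sum_bool, hu]
  simp only [if_true, Bool.false_eq_true, if_false]
  ring

/-- Resampling preserves the mean, and once all coordinates have been resampled the function no
longer depends on the initial bits: it is the constant equal to its mean. -/
theorem bexp_eq_ex (f : (ι → Bool) → ℝ) (b₀ : ι → Bool) :
    bexp p f = ex p Finset.univ.toList f b₀ := by
  have h1 : ∀ L : List ι, bexp p f = bexp p (ex p L f) := by
    intro L
    induction L with
    | nil => rfl
    | cons i L ih => rw [ih, bexp_resample i]; rfl
  have h2 : ∀ (L : List ι) (S : Set ι), DependsOn f S →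
      DependsOn (ex p L f) (S \ {i | i ∈ L}) := by
    intro L S hS
    induction L with
    | nil => intro x y hxy; exact hS fun j hj => hxy j ⟨hj, by simp⟩
    | cons i L ih =>
      intro x y hxy
      have h : ∀ t : Bool,
          ex p L f (Function.update x i t) = ex p L f (Function.update y i t) := by
        intro t
        refine ih fun j hj => ?_
        by_cases h : j = i
        · subst h; simp
        · simp only [ne_eq, h, not_false_eq_true, Function.update_of_ne]
          exact hxy j ⟨hj.1, by simpa [h] using hj.2⟩
      simp only [ex, h]
  have h3 : ∀ b, ex p Finset.univ.toList f b = ex p Finset.univ.toList f b₀ := fun b =>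
    h2 _ Set.univ (dependsOn_univ f) (by simp)
  rw [h1 Finset.univ.toList, funext h3, bexp_const]

end Expectation

end PPSZ

namespace PPSZ

/-! ### The recursion for the cut probability -/

section CutProb

variable {V : Type}

/-- The probability that a tree of height `n` is cut, when the children of the node `p` are
labelled by `ch p` and the child `w :: p` is deleted with probability `D w p`, independently of
the other nodes. -/
noncomputable def cutProb (ch : List V → Finset V) (D : V → List V → ℝ) : ℕ → List V → ℝ
  | 0, _ => 0
  | n + 1, p => ∏ w ∈ ch p, (1 - (1 - D w p) * (1 - cutProb ch D n (w :: p)))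

theorem one_sub_mul_mem_Icc {a b : ℝ} (ha : a ∈ Set.Icc (0 : ℝ) 1) (hb : b ∈ Set.Icc (0 : ℝ) 1) :
    1 - (1 - a) * (1 - b) ∈ Set.Icc (0 : ℝ) 1 := by
  obtain ⟨h1, h2⟩ := ha
  obtain ⟨h3, h4⟩ := hb
  constructor <;> nlinarith

theorem one_sub_mul_mono {a b a' b' : ℝ} (ha : a ≤ a') (hb : b ≤ b') (ha' : a' ≤ 1) (hb1 : b ≤ 1) :
    1 - (1 - a) * (1 - b) ≤ 1 - (1 - a') * (1 - b') := by
  nlinarith [mul_nonneg (sub_nonneg.2 ha') (sub_nonneg.2 hb),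
    mul_nonneg (sub_nonneg.2 ha) (sub_nonneg.2 hb1)]

variable {ch : List V → Finset V}

theorem cutProb_mem_Icc {D : V → List V → ℝ} (hD : ∀ w p, D w p ∈ Set.Icc (0 : ℝ) 1) (n : ℕ)
    (p : List V) : cutProb ch D n p ∈ Set.Icc (0 : ℝ) 1 := by
  induction n generalizing p with
  | zero => simp [cutProb]
  | succ n ih =>
    have h : ∀ w ∈ ch p, 1 - (1 - D w p) * (1 - cutProb ch D n (w :: p)) ∈ Set.Icc (0 : ℝ) 1 :=
      fun w _ => one_sub_mul_mem_Icc (hD w p) (ih _)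
    exact ⟨Finset.prod_nonneg fun w hw => (h w hw).1,
      Finset.prod_le_one (fun w hw => (h w hw).1) fun w hw => (h w hw).2⟩

theorem cutProb_mono {D D' : V → List V → ℝ} (hD : ∀ w p, D w p ∈ Set.Icc (0 : ℝ) 1)
    (hD' : ∀ w p, D' w p ∈ Set.Icc (0 : ℝ) 1) (R : List V → Prop)
    (hR : ∀ p, R p → ∀ w ∈ ch p, R (w :: p) ∧ D w p ≤ D' w p) (n : ℕ)
    (p : List V) (hp : R p) : cutProb ch D n p ≤ cutProb ch D' n p := by
  induction n generalizing p with
  | zero => exact le_rfl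
  | succ n ih =>
    refine Finset.prod_le_prod
      (fun w _ => (one_sub_mul_mem_Icc (hD w p) (cutProb_mem_Icc hD n _)).1) fun w hw => ?_
    exact one_sub_mul_mono (hR p hp w hw).2 (ih _ (hR p hp w hw).1) (hD' w p).2
      (cutProb_mem_Icc hD n _).2

variable {ι : Type} {D : V → List V → (ι → Bool) → ℝ} {T : List V → Set ι}

theorem monotone_cutProb (hD : ∀ w p b, D w p b ∈ Set.Icc (0 : ℝ) 1)
    (hm : ∀ w p, Monotone (D w p)) (n : ℕ) (p : List V) :
    Monotone fun b => cutProb ch (fun w p => D w p b) n p := fun b b' hb =>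
  cutProb_mono (fun w p => hD w p b) (fun w p => hD w p b') (fun _ => True)
    (fun _ _ _ _ => ⟨trivial, hm _ _ hb⟩) n p trivial

theorem dependsOn_cutProb (hT : ∀ p, ∀ w ∈ ch p, T (w :: p) ⊆ T p)
    (hdep : ∀ p, ∀ w ∈ ch p, DependsOn (D w p) (T p \ T (w :: p))) (n : ℕ) (p : List V) :
    DependsOn (fun b => cutProb ch (fun w p => D w p b) n p) (T p) := by
  induction n generalizing p with
  | zero => intro x y _; rfl
  | succ n ih =>
    intro x y hxy
    refine Finset.prod_congr rfl fun w hw => ?_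
    have h1 := hdep p w hw fun i hi => hxy i hi.1
    have h2 := ih (w :: p) fun i hi => hxy i (hT p w hw hi)
    simp only at h1 h2 ⊢
    rw [h1, h2]

variable [DecidableEq ι] {q : ι → ℝ}

theorem ex_one_sub_mul (L : List ι) {f g : (ι → Bool) → ℝ} {S T : Set ι}
    (hf : DependsOn f S) (hg : DependsOn g T) (hST : Disjoint S T) (b : ι → Bool) :
    ex q L (fun x => 1 - (1 - f x) * (1 - g x)) b =
      1 - (1 - ex q L f b) * (1 - ex q L g b) := by
  have h : (fun x => 1 - (1 - f x) * (1 - g x)) = fun x => f x + (g x - f x * g x) := by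
    ext x; ring
  rw [h, ex_add, ex_sub, ex_mul_of_disjoint L hf hg hST]
  ring

/-- The deletion of a child uses coordinates in `T p \ T (w :: p)`, which its subtree never
consults, so each factor averages exactly. Distinct children may share coordinates, but their
factors are monotone, and Harris' inequality makes the product of the means a lower bound. -/
theorem cutProb_le_ex (hq : ∀ i, q i ∈ Set.Icc (0 : ℝ) 1) (L : List ι)
    (hD : ∀ w p b, D w p b ∈ Set.Icc (0 : ℝ) 1) (hm : ∀ w p, Monotone (D w p))
    (hT : ∀ p, ∀ w ∈ ch p, T (w :: p) ⊆ T p)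
    (hdep : ∀ p, ∀ w ∈ ch p, DependsOn (D w p) (T p \ T (w :: p))) (b : ι → Bool) (n : ℕ)
    (p : List V) :
    cutProb ch (fun w p => ex q L (D w p) b) n p ≤
      ex q L (fun b => cutProb ch (fun w p => D w p b) n p) b := by
  induction n generalizing p with
  | zero => simp [cutProb, ex_const]
  | succ n ih =>
    have hE : ∀ w p, ex q L (D w p) b ∈ Set.Icc (0 : ℝ) 1 := fun w p =>
      ⟨ex_nonneg hq L (fun x => (hD w p x).1) b, ex_le_one hq L (fun x => (hD w p x).2) b⟩
    have hC : ∀ p x, cutProb ch (fun w p => D w p x) n p ∈ Set.Icc (0 : ℝ) 1 := fun p x =>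
      cutProb_mem_Icc (fun w p => hD w p x) n p
    simp only [cutProb]
    refine le_trans ?_ (ex_prod_le hq L (ch p) (fun w _ x y hxy => ?_) (fun w _ x => ?_) b)
    · refine Finset.prod_le_prod
        (fun w _ => (one_sub_mul_mem_Icc (hE w p) (cutProb_mem_Icc hE n _)).1) fun w hw => ?_
      rw [ex_one_sub_mul L (hdep p w hw) (dependsOn_cutProb hT hdep n (w :: p))
        Set.disjoint_sdiff_left]
      exact one_sub_mul_mono le_rfl (ih _) (hE w p).2 (cutProb_mem_Icc hE n _).2
    · exact one_sub_mul_mono (hm w p hxy) (monotone_cutProb hD hm n _ hxy) (hD w p y).2 (hC _ x).2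
    · exact (one_sub_mul_mem_Icc (hD w p x) (hC _ x)).1

end CutProb

/-! ### Cut events and identified labels -/

section Cut

variable {V : Type} [DecidableEq V]

/-- The labels of the children of a node. -/
def children (sel : List V → Clause V) (p : List V) : Finset V :=
  ((sel p).filter fun l => l.2 = false).image Prod.fst

theorem mem_children {sel : List V → Clause V} {p : List V} {w : V} :
    w ∈ children sel p ↔ (w, false) ∈ sel p := by
  simp [children]

theorem nodesAt_succ (sel : List V → Clause V) (x : V) (d : ℕ) :
    nodesAt sel x (d + 1) =
      (nodesAt sel x d).biUnion fun p => (children sel p).image fun w => w :: p := by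
  simp only [nodesAt, children, Finset.image_image]
  rfl

open Classical in
/-- The indicator of the cut event, as a function of the set of deleted variables. -/
noncomputable def cutInd (sel : List V → Clause V) (h : ℕ) (x : V) (b : V → Bool) : ℝ :=
  if ∀ p ∈ nodesAt sel x h, ∃ v ∈ p.dropLast, b v = true then 1 else 0

theorem nodesAt_ne_nil {sel : List V → Clause V} {x : V} {d : ℕ} {p : List V}
    (hp : p ∈ nodesAt sel x d) : p ≠ [] := by
  cases d with
  | zero => simp only [nodesAt, Finset.mem_singleton] at hp; simp [hp]
  | succ d =>
    rw [nodesAt_succ] at hp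
    simp only [Finset.mem_biUnion, Finset.mem_image] at hp
    obtain ⟨q, _, w, _, rfl⟩ := hp
    simp

open Classical in
/-- A node is deleted if its variable is, provided the variable is not identified by `m` with
the variable of an ancestor. -/
noncomputable def delInd (m : V → V) (w : V) (p : List V) (b : V → Bool) : ℝ :=
  if b (m w) = true ∧ ∀ a ∈ p, m a ≠ m w then 1 else 0

theorem delInd_mem_Icc (m : V → V) (w : V) (p : List V) (b : V → Bool) :
    delInd m w p b ∈ Set.Icc (0 : ℝ) 1 := by
  unfold delInd; split_ifs <;> simp

theorem monotone_delInd (m : V → V) (w : V) (p : List V) : Monotone (delInd m w p) := by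
  intro b b' hb
  unfold delInd
  split_ifs with h1 h2
  · exact le_rfl
  · exact absurd ⟨le_antisymm (Bool.le_true _) (h1.1 ▸ hb (m w)), h1.2⟩ h2
  · exact zero_le_one
  · exact le_rfl

/-- The variables that are not identified with a variable on the path `p`. -/
def freshVars (m : V → V) (p : List V) : Set V := {i | ∀ a ∈ p, m a ≠ i}

omit [DecidableEq V] in
theorem freshVars_cons_subset (m : V → V) (w : V) (p : List V) :
    freshVars m (w :: p) ⊆ freshVars m p := fun _ hi a ha => hi a (List.mem_cons_of_mem _ ha)

theorem dependsOn_delInd (m : V → V) (w : V) (p : List V) :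
    DependsOn (delInd m w p) (freshVars m p \ freshVars m (w :: p)) := by
  intro b b' hb
  by_cases h : ∀ a ∈ p, m a ≠ m w
  · have : b (m w) = b' (m w) := hb _ ⟨h, fun hw => hw w List.mem_cons_self rfl⟩
    simp [delInd, this]
  · simp only [delInd, h, and_false]

/-- For zero-one deletions the recursion decides whether the tree is cut, with copies of ancestors
treated as surviving. If some path is uncut, the value `0` at its leaf propagates upwards: each
ancestor has a factor `0` in its product. -/
theorem cutProb_delInd_le_cutInd (sel : List V → Clause V) (h : ℕ) (x : V) (m : V → V)
    (b : V → Bool) :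
    cutProb (children sel) (fun w p => delInd m w p b) h [x] ≤ cutInd sel h x (b ∘ m) := by
  have hle := cutProb_mem_Icc (ch := children sel) (fun w p => delInd_mem_Icc m w p b) h [x]
  unfold cutInd
  split_ifs with hc
  · exact hle.2
  · push Not at hc
    obtain ⟨p, hp, hdel⟩ := hc
    have key : ∀ (d : ℕ) (p : List V), p ∈ nodesAt sel x d →
        (∀ v ∈ p.dropLast, (b ∘ m) v ≠ true) → ∀ n,
        cutProb (children sel) (fun w p => delInd m w p b) n p = 0 →
        cutProb (children sel) (fun w p => delInd m w p b) (n + d) [x] = 0 := by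
      intro d
      induction d with
      | zero =>
        intro p hp _ n h0
        simp only [nodesAt, Finset.mem_singleton] at hp
        rwa [hp] at h0
      | succ d ih =>
        intro p hp hd n h0
        rw [nodesAt_succ] at hp
        simp only [Finset.mem_biUnion, Finset.mem_image] at hp
        obtain ⟨q, hq, w, hw, rfl⟩ := hp
        rw [List.dropLast_cons_of_ne_nil (nodesAt_ne_nil hq)] at hd
        have := ih q hq (fun v hv => hd v (List.mem_cons_of_mem _ hv)) (n + 1)
          (Finset.prod_eq_zero hw (by
            have hb := hd w List.mem_cons_self
            simp only [Function.comp_apply] at hb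
            rw [h0]
            simp [delInd, hb]))
        rwa [add_right_comm, add_assoc] at this
    exact (by simpa using key h p hp hdel 0 rfl : _ = (0 : ℝ)).le

open Classical in
/-- The deletion probabilities of the nodes when the edges `e` with `K e = false` are
identified: a node that is identified with an ancestor is never deleted. -/
noncomputable def keepProb (p : V → ℝ) (K : Sym2 V → Bool) (w : V) (q : List V) : ℝ :=
  if ∀ a ∈ q, K s(w, a) = true then p w else 0

omit [DecidableEq V] in
theorem keepProb_mem_Icc {p : V → ℝ} (hp : ∀ i, p i ∈ Set.Icc (0 : ℝ) 1) (K : Sym2 V → Bool)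
    (w : V) (q : List V) : keepProb p K w q ∈ Set.Icc (0 : ℝ) 1 := by
  unfold keepProb
  split_ifs
  · exact hp w
  · simp

variable [Fintype V]

theorem ex_delInd {p : V → ℝ} (m : V → V) (w : V) (q : List V) (b₀ : V → Bool)
    (hq : ∀ a ∈ q, m a ≠ m w) : ex p Finset.univ.toList (delInd m w q) b₀ = p (m w) := by
  rw [← bexp_eq_ex, bexp_resample (m w)]
  have : (fun b : V → Bool => p (m w) * delInd m w q (Function.update b (m w) true) +
      (1 - p (m w)) * delInd m w q (Function.update b (m w) false)) = fun _ => p (m w) := by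
    ext b
    simp only [delInd, Function.update_self, true_and, Bool.false_eq_true, false_and, if_false]
    rw [if_pos hq]
    ring
  rw [this, bexp_const]

/-- `m` identifies only variables that are joined by an edge `e` with `K e = false`. -/
def IsIdentification (p : V → ℝ) (x : V) (K : Sym2 V → Bool) (m : V → V) : Prop :=
  ∀ (w : V) (q : List V), w ∉ q → x ∈ q → (∀ a ∈ q, K s(w, a) = true) →
    (∀ a ∈ q, m a ≠ m w) ∧ p (m w) = p w

variable {p : V → ℝ} {sel : List V → Clause V} {x : V} {K : Sym2 V → Bool} {m : V → V}

/-- If no pair joining `w` to its path is identified, then `m w` is a fresh variable of probability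
`p w`, so averaging gives exactly `keepProb`; otherwise `keepProb` is `0` and there is nothing to
prove. -/
theorem cutProb_keepProb_le (hp : ∀ i, p i ∈ Set.Icc (0 : ℝ) 1)
    (hch : ∀ q, ∀ w ∈ children sel q, w ∉ q) (hm : IsIdentification p x K m) (b₀ : V → Bool)
    (n : ℕ) (q : List V) (hq : x ∈ q) :
    cutProb (children sel) (keepProb p K) n q ≤
      ex p Finset.univ.toList
        (fun b => cutProb (children sel) (fun w p => delInd m w p b) n q) b₀ := by
  refine le_trans ?_ (cutProb_le_ex (T := freshVars m) hp _ (fun w p b => delInd_mem_Icc m w p b)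
    (monotone_delInd m) (fun p w _ => freshVars_cons_subset m w p)
    (fun p w _ => dependsOn_delInd m w p) b₀ n q)
  refine cutProb_mono (keepProb_mem_Icc hp K) (fun w q => ?_) (fun q => x ∈ q)
    (fun q hq w hw => ⟨List.mem_cons_of_mem _ hq, ?_⟩) n q hq
  · exact ⟨ex_nonneg hp _ (fun b => (delInd_mem_Icc m w q b).1) _,
      ex_le_one hp _ (fun b => (delInd_mem_Icc m w q b).2) _⟩
  · unfold keepProb
    split_ifs with h
    · obtain ⟨h1, h2⟩ := hm w q (hch q w hw) hq h
      rw [ex_delInd m w q b₀ h1, h2]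
    · exact ex_nonneg hp _ (fun b => (delInd_mem_Icc m w q b).1) _

theorem cutProb_le_bexp_cutInd (hp : ∀ i, p i ∈ Set.Icc (0 : ℝ) 1)
    (hch : ∀ q, ∀ w ∈ children sel q, w ∉ q) (hm : IsIdentification p x K m) (h : ℕ) :
    cutProb (children sel) (keepProb p K) h [x] ≤ bexp p fun b => cutInd sel h x (b ∘ m) := by
  rw [bexp_eq_ex _ fun _ => true]
  exact (cutProb_keepProb_le hp hch hm _ h [x] (by simp)).trans
    (ex_mono hp _ (cutProb_delInd_le_cutInd sel h x m) _)

/-- The bound for the case that the two children of the root are identified. -/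
theorem cutProb_le_bexp_cutInd_of_eq (hp : ∀ i, p i ∈ Set.Icc (0 : ℝ) 1)
    (hch : ∀ q, ∀ w ∈ children sel q, w ∉ q) (hm : IsIdentification p x K m) (n : ℕ) {y z : V}
    (hyz : y ≠ z) (hroot : children sel [x] = {y, z}) (hmyz : m y = m z) (hmx : m x ≠ m y) :
    1 - (1 - p (m y)) * (1 - cutProb (children sel) (keepProb p K) n [y, x] *
        cutProb (children sel) (keepProb p K) n [z, x]) ≤
      bexp p fun b => cutInd sel (n + 1) x (b ∘ m) := by
  rw [bexp_eq_ex _ fun _ => true]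
  set A : V → (V → Bool) → ℝ := fun w b =>
    cutProb (children sel) (fun w p => delInd m w p b) n [w, x] with hA
  have hA01 : ∀ w b, A w b ∈ Set.Icc (0 : ℝ) 1 := fun w b =>
    cutProb_mem_Icc (fun w p => delInd_mem_Icc m w p b) n _
  have hmono : ∀ w, Monotone (A w) := fun w =>
    monotone_cutProb (fun w p b => delInd_mem_Icc m w p b) (monotone_delInd m) n _
  have hdep : ∀ w, m w = m y → DependsOn (A w) (freshVars m [y, x]) := by
    intro w hw
    have := dependsOn_cutProb (ch := children sel) (D := delInd m) (T := freshVars m)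
      (fun p w _ => freshVars_cons_subset m w p) (fun p w _ => dependsOn_delInd m w p) n [w, x]
    have e : freshVars m [w, x] = freshVars m [y, x] := by ext i; simp [freshVars, hw]
    rwa [e] at this
  have hAA : DependsOn (fun b => A y b * A z b) (freshVars m [y, x]) := fun b b' hb => by
    simp only [hdep y rfl hb, hdep z hmyz.symm hb]
  refine le_trans ?_ (ex_mono hp _ (cutProb_delInd_le_cutInd sel (n + 1) x m) _)
  -- The two children are now one variable: if it is deleted both factors are `1`, otherwise the
  -- value is the product of the cut values of the two subtrees.
  have hfun : (fun b => cutProb (children sel) (fun w p => delInd m w p b) (n + 1) [x]) =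
      fun b => 1 - (1 - delInd m y [x] b) * (1 - A y b * A z b) := by
    ext b
    have hD : delInd m z [x] b = delInd m y [x] b := by simp [delInd, hmyz]
    have h01 : delInd m y [x] b = 1 ∨ delInd m y [x] b = 0 := by
      unfold delInd; split_ifs <;> simp
    rw [cutProb, hroot, Finset.prod_pair hyz, hD]
    rcases h01 with h | h <;> simp [h, hA]
  rw [hfun, ex_one_sub_mul _ (dependsOn_delInd m y [x]) hAA Set.disjoint_sdiff_left,
    ex_delInd m y [x] _ (by simpa using hmx)]
  have h1 := ex_mul_le hp Finset.univ.toList (hmono y) (hmono z) fun _ => true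
  have hy := cutProb_keepProb_le hp hch hm (fun _ => true) n [y, x] (by simp)
  have hz := cutProb_keepProb_le hp hch hm (fun _ => true) n [z, x] (by simp)
  have h0 := (cutProb_mem_Icc (ch := children sel) (keepProb_mem_Icc hp K) n [z, x]).1
  have h0' := (cutProb_mem_Icc (ch := children sel) (keepProb_mem_Icc hp K) n [y, x]).1
  have := (mul_le_mul hy hz h0 (h0'.trans hy)).trans h1
  have hpy := (hp (m y)).2
  nlinarith [mul_le_mul_of_nonneg_left this (sub_nonneg.2 hpy)]

end Cut

end PPSZ

namespace PPSZ

/-! ### Mixtures over identified edges -/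

section Mixture

variable {V : Type}

open Classical in
/-- The endpoint of `e` that is copied; it is `x` if possible. -/
noncomputable def src (x : V) (e : Sym2 V) : V := if e.out.2 = x then e.out.2 else e.out.1

open Classical in
/-- The endpoint of `e` that becomes a copy of the other one. -/
noncomputable def tgt (x : V) (e : Sym2 V) : V := if e.out.2 = x then e.out.1 else e.out.2

theorem mk_src_tgt (x : V) (e : Sym2 V) : s(src x e, tgt x e) = e := by
  have h : s(e.out.1, e.out.2) = e := Quot.out_eq e
  unfold src tgt
  split_ifs
  · rw [Sym2.eq_swap, h]
  · exact h

theorem src_mem (x : V) (e : Sym2 V) : src x e ∈ e := by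
  have := Sym2.mem_mk_left (src x e) (tgt x e)
  rwa [mk_src_tgt] at this

theorem tgt_mem (x : V) (e : Sym2 V) : tgt x e ∈ e := by
  have := Sym2.mem_mk_right (src x e) (tgt x e)
  rwa [mk_src_tgt] at this

theorem src_ne_tgt (x : V) {e : Sym2 V} (he : ¬ e.IsDiag) : src x e ≠ tgt x e := by
  rw [← mk_src_tgt x e] at he
  exact fun h => he (Sym2.mk_isDiag_iff.2 h)

theorem tgt_ne (x : V) {e : Sym2 V} (he : ¬ e.IsDiag) : tgt x e ≠ x := by
  have h := src_ne_tgt x he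
  unfold src tgt at *
  split_ifs at * with hx
  · rw [hx] at h; exact h.symm
  · exact hx

open Classical in
/-- The map that identifies the endpoints of `e`. -/
noncomputable def copyMap (x : V) (e : Sym2 V) (w : V) : V := if w = tgt x e then src x e else w

theorem copyMap_of_notMem {x : V} {e : Sym2 V} {w : V} (h : w ∉ e) : copyMap x e w = w := by
  unfold copyMap
  rw [if_neg]
  rintro rfl
  exact h (tgt_mem x e)

open Classical in
/-- The density of the distribution in which the endpoints of `e` are identified. -/
noncomputable def copyKernel (p : V → ℝ) (x : V) (e : Sym2 V) (b : V → Bool) : ℝ :=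
  if b (tgt x e) = b (src x e) then (if b (tgt x e) then p (tgt x e) else 1 - p (tgt x e))⁻¹ else 0

/-- The kernel cancels the law of the bit at `tgt x e` and leaves a point mass at the bit of `src x
e`. -/
theorem bexp_copyKernel [Fintype V] [DecidableEq V] {p : V → ℝ} {x : V} {e : Sym2 V}
    (he : ¬ e.IsDiag) (h0 : 0 < p (tgt x e)) (h1 : p (tgt x e) < 1) (H : (V → Bool) → ℝ) :
    bexp p (fun b => copyKernel p x e b * H b) = bexp p fun b => H (b ∘ copyMap x e) := by
  rw [bexp_resample (tgt x e)]
  congr 1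
  ext b
  have hne := src_ne_tgt x he
  have hc : b ∘ copyMap x e = Function.update b (tgt x e) (b (src x e)) := by
    ext w
    by_cases h : w = tgt x e <;> simp [copyMap, h]
  have h2 : 1 - p (tgt x e) ≠ 0 := by linarith
  rw [hc]
  cases hb : b (src x e) <;> simp [copyKernel, hne, hb, h0.ne', h2]

variable {C : Type} [DecidableEq V]

/-- The mixture in which in each component in the list at most one edge is identified, the edge
`e` with probability `lam e`. -/
noncomputable def mix (E : C → Finset (Sym2 V)) (lam : Sym2 V → ℝ) :
    List C → ((Sym2 V → Bool) → ℝ) → (Sym2 V → Bool) → ℝ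
  | [], φ, K => φ K
  | c :: l, φ, K => (1 - ∑ e ∈ E c, lam e) * mix E lam l φ K +
      ∑ e ∈ E c, lam e * mix E lam l φ (Function.update K e false)

/-- The identification `m` has been obtained by identifying the edges `e` with `K e = false`,
which lie in distinct components; the components in `l` are still untouched. -/
structure IsState (p : V → ℝ) (x : V) (comp : V → C) (l : List C) (m : V → V)
    (K : Sym2 V → Bool) : Prop where
  untouched : ∀ v, comp v ∈ l → m v = v
  keep : ∀ e, ∀ v ∈ e, comp v ∈ l → K e = true
  comp_eq : ∀ v, comp (m v) = comp v
  root : m x = x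
  inj : ∀ v w, v ≠ w → m v = m w → K s(v, w) = false
  prob : ∀ v, m v = x ∨ p (m v) = p v
  disj : ∀ e e', K e = false → K e' = false → ∀ v, v ∈ e → v ∈ e' → e = e'
  ident : ∀ v w, K s(v, w) = false → m v = m w

variable {p : V → ℝ} {x : V} {comp : V → C} {l : List C} {m : V → V} {K : Sym2 V → Bool}

omit [DecidableEq V] in
theorem isState_id : IsState p x comp l id fun _ => true :=
  ⟨fun _ _ => rfl, fun _ _ _ _ => rfl, fun _ => rfl, rfl, fun _ _ h h' => absurd h' h,
    fun _ => Or.inr rfl, fun _ _ h => by simp at h, fun _ _ h => by simp at h⟩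

omit [DecidableEq V] in
theorem IsState.isIdentification (h : IsState p x comp l m K) : IsIdentification p x K m := by
  intro w q hw hx hK
  have hne : ∀ a ∈ q, m a ≠ m w := by
    intro a ha e
    have hwa : w ≠ a := fun h => hw (h ▸ ha)
    have := h.inj w a hwa e.symm
    rw [hK a ha] at this
    exact absurd this (by simp)
  refine ⟨hne, (h.prob w).resolve_left fun hwx => hne x hx ?_⟩
  rw [h.root, hwx]

omit [DecidableEq V] in
theorem IsState.tail {c : C} (h : IsState p x comp (c :: l) m K) : IsState p x comp l m K :=
  { h with
    untouched := fun v hv => h.untouched v (List.mem_cons_of_mem _ hv)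
    keep := fun e v hv hl => h.keep e v hv (List.mem_cons_of_mem _ hl) }

/-- Different components share no vertices, so identifying one edge of an untouched component cannot
interact with earlier identifications. Probabilities agree along the edge unless the source is the
root, the exception allowed in `prob`. -/
theorem IsState.step {c : C} (h : IsState p x comp (c :: l) m K) (hc : c ∉ l) {e : Sym2 V}
    (he : ¬ e.IsDiag) (hec : ∀ v ∈ e, comp v = c)
    (hp : src x e = x ∨ p (src x e) = p (tgt x e)) :
    IsState p x comp l (copyMap x e ∘ m) (Function.update K e false) := by
  have hfix : ∀ v, comp v = c → m v = v := fun v hv => h.untouched v (hv ▸ List.mem_cons_self)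
  have hkeep : ∀ e', ∀ v ∈ e', comp v = c → K e' = true := fun e' v hv hvc =>
    h.keep e' v hv (hvc ▸ List.mem_cons_self)
  have htgt := hec _ (tgt_mem x e)
  have hsrc := hec _ (src_mem x e)
  have hcopy : ∀ v, comp (copyMap x e v) = comp v := by
    intro v
    unfold copyMap
    split_ifs with hv
    · rw [hv, hsrc, htgt]
    · rfl
  refine ⟨fun v hv => ?_, fun e' v hv hl => ?_, fun v => ?_, ?_, fun v w hvw hm => ?_,
    fun v => ?_, fun e₁ e₂ h₁ h₂ v hv₁ hv₂ => ?_, fun v w hK => ?_⟩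
  · rw [Function.comp_apply, h.untouched v (List.mem_cons_of_mem _ hv)]
    exact copyMap_of_notMem fun hve => hc (hec v hve ▸ hv)
  · have : e' ≠ e := by
      rintro rfl
      exact hc (hec v hv ▸ hl)
    rw [Function.update_of_ne this]
    exact h.keep e' v hv (List.mem_cons_of_mem _ hl)
  · rw [Function.comp_apply, hcopy, h.comp_eq]
  · rw [Function.comp_apply, h.root]
    simp [copyMap, (tgt_ne x he).symm]
  · by_cases hmm : m v = m w
    · by_cases hs : s(v, w) = e
      · rw [hs, Function.update_self]
      · rw [Function.update_of_ne hs]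
        exact h.inj v w hvw hmm
    · suffices hs : s(v, w) = e by rw [hs, Function.update_self]
      simp only [Function.comp_apply, copyMap] at hm
      have aux : ∀ v, m v = tgt x e → v = tgt x e := fun v hv => by
        rw [← hv, hfix v]
        rw [← h.comp_eq v, hv, htgt]
      have aux' : ∀ v, m v = src x e → v = src x e := fun v hv => by
        rw [← hv, hfix v]
        rw [← h.comp_eq v, hv, hsrc]
      split_ifs at hm with h1 h2 h2
      · exact absurd (h1.trans h2.symm) hmm
      · rw [aux v h1, aux' w hm.symm, Sym2.eq_swap, mk_src_tgt]
      · rw [aux w h2, aux' v hm, mk_src_tgt]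
      · exact absurd hm hmm
  · simp only [Function.comp_apply, copyMap]
    split_ifs with hv
    · rcases hp with hp | hp
      · exact Or.inl hp
      · right
        have : v = m v := by
          rw [hfix v]
          rw [← h.comp_eq v, hv, htgt]
        rw [hp, ← hv, ← this]
    · exact h.prob v
  · by_cases g₁ : e₁ = e
    · by_cases g₂ : e₂ = e
      · rw [g₁, g₂]
      · rw [Function.update_of_ne g₂, hkeep e₂ v hv₂ (hec v (g₁ ▸ hv₁))] at h₂
        exact absurd h₂ (by simp)
    · rw [Function.update_of_ne g₁] at h₁
      by_cases g₂ : e₂ = e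
      · rw [hkeep e₁ v hv₁ (hec v (g₂ ▸ hv₂))] at h₁
        exact absurd h₁ (by simp)
      · rw [Function.update_of_ne g₂] at h₂
        exact h.disj e₁ e₂ h₁ h₂ v hv₁ hv₂
  · by_cases hs : s(v, w) = e
    · have hv : v ∈ e := hs ▸ Sym2.mem_mk_left v w
      have hw : w ∈ e := hs ▸ Sym2.mem_mk_right v w
      rw [Function.comp_apply, Function.comp_apply, hfix v (hec v hv), hfix w (hec w hw)]
      rw [← mk_src_tgt x e, Sym2.eq_iff] at hs
      rcases hs with ⟨h1, h2⟩ | ⟨h1, h2⟩ <;> simp [copyMap, h1, h2]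
    · rw [Function.update_of_ne hs] at hK
      simp only [Function.comp_apply, h.ident v w hK]

variable [Fintype V] {E : C → Finset (Sym2 V)} {lam : Sym2 V → ℝ} {r : ℝ}

/-- Expanding the factor of one component gives a convex combination. The summand of `e` becomes
composition with `copyMap x e`; the factors of the remaining components live on other vertices and
do not notice it. -/
theorem mix_le_bexp (hr0 : 0 < r) (hr1 : r < 1)
    (hdiag : ∀ c, ∀ e ∈ E c, ¬ e.IsDiag) (hcomp : ∀ c, ∀ e ∈ E c, ∀ v ∈ e, comp v = c)
    (hpr : ∀ c, ∀ e ∈ E c, ∀ v ∈ e, v ≠ x → p v = r)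
    (hlam : ∀ c, ∀ e ∈ E c, 0 ≤ lam e) (hsum : ∀ c, ∑ e ∈ E c, lam e ≤ 1)
    (φ : (Sym2 V → Bool) → ℝ) (F : (V → Bool) → ℝ)
    (hbase : ∀ m K, IsState p x comp [] m K → φ K ≤ bexp p fun b => F (b ∘ m))
    (hl : l.Nodup) (hst : IsState p x comp l m K) :
    mix E lam l φ K ≤ bexp p fun b =>
      (l.map fun c => (1 - ∑ e ∈ E c, lam e) + ∑ e ∈ E c, lam e * copyKernel p x e b).prod *
        F (b ∘ m) := by
  induction l generalizing m K with
  | nil => simpa [mix] using hbase m K hst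
  | cons c l ih =>
    rw [List.nodup_cons] at hl
    set G : (V → Bool) → ℝ := fun b =>
      (l.map fun c => (1 - ∑ e ∈ E c, lam e) + ∑ e ∈ E c, lam e * copyKernel p x e b).prod with hG
    have hrw : (fun b => (List.map (fun c => (1 - ∑ e ∈ E c, lam e) +
        ∑ e ∈ E c, lam e * copyKernel p x e b) (c :: l)).prod * F (b ∘ m)) =
        fun b => (1 - ∑ e ∈ E c, lam e) * (G b * F (b ∘ m)) +
          ∑ e ∈ E c, lam e * (copyKernel p x e b * (G b * F (b ∘ m))) := by
      ext b
      simp only [List.map_cons, List.prod_cons]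
      rw [mul_assoc, add_mul, Finset.sum_mul]
      simp only [mul_assoc]
      rfl
    rw [hrw, bexp_add, bexp_const_mul, bexp_sum, mix]
    refine add_le_add (mul_le_mul_of_nonneg_left (ih hl.2 hst.tail) (by linarith [hsum c]))
      (Finset.sum_le_sum fun e he => ?_)
    rw [bexp_const_mul]
    refine mul_le_mul_of_nonneg_left ?_ (hlam c e he)
    have htp := hpr c e he _ (tgt_mem x e) (tgt_ne x (hdiag c e he))
    rw [bexp_copyKernel (hdiag c e he) (by rw [htp]; exact hr0) (by rw [htp]; exact hr1)]
    have hGc : ∀ b : V → Bool, G (b ∘ copyMap x e) = G b := by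
      intro b
      simp only [hG]
      congr 1
      refine List.map_congr_left fun c' hc' => ?_
      have hfix : ∀ e' ∈ E c', ∀ v ∈ e', copyMap x e v = v := fun e' he' v hv =>
        copyMap_of_notMem fun hve => hl.1 ((hcomp c e he v hve ▸ hcomp c' e' he' v hv) ▸ hc')
      congr 1
      refine Finset.sum_congr rfl fun e' he' => ?_
      simp only [copyKernel, Function.comp_apply, hfix e' he' _ (tgt_mem x e'),
        hfix e' he' _ (src_mem x e')]
    simp only [hGc]
    refine ih hl.2 (hst.step hl.1 (hdiag c e he) (hcomp c e he) ?_)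
    by_cases hx : src x e = x
    · exact Or.inl hx
    · exact Or.inr (by rw [htp, hpr c e he _ (src_mem x e) hx])

end Mixture

/-! ### Comparison with independently identified edges -/

section Domination

variable {W : Type} [DecidableEq W]

/-- `φ` does not increase when an edge other than `e₀` is identified. -/
def AntitoneOff (e₀ : W) (φ : (W → Bool) → ℝ) : Prop :=
  ∀ K e, e ≠ e₀ → φ (Function.update K e false) ≤ φ K

variable {e₀ : W} {q lam : W → ℝ}

theorem AntitoneOff.ex (hq : ∀ i, q i ∈ Set.Icc (0 : ℝ) 1) (L : List W) {φ : (W → Bool) → ℝ}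
    (h : AntitoneOff e₀ φ) : AntitoneOff e₀ (ex q L φ) := by
  induction L with
  | nil => exact h
  | cons i L ih =>
    intro K e he
    have key : ∀ t, PPSZ.ex q L φ (Function.update (Function.update K e false) i t) ≤
        PPSZ.ex q L φ (Function.update K i t) := by
      intro t
      by_cases hi : i = e
      · rw [hi, Function.update_idem]
      · rw [Function.update_comm (Ne.symm hi)]
        exact ih _ e he
    exact add_le_add (mul_le_mul_of_nonneg_left (key _) (hq i).1)
      (mul_le_mul_of_nonneg_left (key _) (sub_nonneg.2 (hq i).2))

/-- The list `L` is dominated: at most one of its edges being identified, `e` with probability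
`lam e`, is better than each edge being identified independently with probability `1 - q e`. -/
def Dominated (e₀ : W) (q lam : W → ℝ) (L : List W) : Prop :=
  ∀ φ : (W → Bool) → ℝ, AntitoneOff e₀ φ → ∀ K : W → Bool, (∀ e ∈ L, K e = true) →
    ex q L φ K ≤ (1 - (L.map lam).sum) * φ K +
      (L.map fun e => lam e * φ (Function.update K e false)).sum

theorem dominated_nil : Dominated e₀ q lam [] := fun φ _ K _ => by simp [ex]

theorem dominated_singleton (h : q e₀ = 1 - lam e₀) : Dominated e₀ q lam [e₀] := by
  intro φ _ K hK
  have : Function.update K e₀ true = K := by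
    rw [← hK e₀ (by simp), Function.update_eq_self]
  simp only [ex, this, h, List.map_cons, List.map_nil, List.sum_cons, List.sum_nil]
  linarith

/-- When both `e` and an edge of `L` are identified, undoing `e` can only increase the value. After
that the independent choice puts mass `(1 - q e) * (1 - Σ lam)` on `e` alone; this is at least `lam
e`, and moving the excess to the state without identification is again an increase. -/
theorem Dominated.cons {L : List W} (hL : Dominated e₀ q lam L) {e : W} (he : e ≠ e₀)
    (heL : e ∉ L) (hq : q e ∈ Set.Icc (0 : ℝ) 1) (hlam : ∀ e ∈ L, 0 ≤ lam e)
    (h : lam e ≤ (1 - q e) * (1 - (L.map lam).sum)) : Dominated e₀ q lam (e :: L) := by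
  intro φ hφ K hK
  have hKe : Function.update K e true = K := by
    rw [← hK e (by simp), Function.update_eq_self]
  have h1 := hL φ hφ K fun e' he' => hK e' (List.mem_cons_of_mem _ he')
  have h2 := hL φ hφ (Function.update K e false) fun e' he' => by
    rw [Function.update_of_ne (ne_of_mem_of_not_mem he' heL)]
    exact hK e' (List.mem_cons_of_mem _ he')
  have h3 : (L.map fun e' => lam e' * φ (Function.update (Function.update K e false) e' false)).sum
      ≤ (L.map fun e' => lam e' * φ (Function.update K e' false)).sum := by
    refine List.sum_le_sum fun e' he' => mul_le_mul_of_nonneg_left ?_ (hlam e' he')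
    rw [Function.update_comm (ne_of_mem_of_not_mem he' heL).symm]
    exact hφ _ e he
  simp only [ex, hKe, List.map_cons, List.sum_cons]
  have h4 := mul_le_mul_of_nonneg_left h1 hq.1
  have h5 := mul_le_mul_of_nonneg_left (h2.trans (add_le_add_right h3 _)) (sub_nonneg.2 hq.2)
  nlinarith [mul_nonneg (sub_nonneg.2 h) (sub_nonneg.2 (hφ K e he))]

/-- The edges of a component, `e₀` last. -/
noncomputable def edgeList (e₀ : W) (s : Finset W) : List W :=
  (s.erase e₀).toList ++ if e₀ ∈ s then [e₀] else []

theorem mem_edgeList {s : Finset W} {e : W} : e ∈ edgeList e₀ s ↔ e ∈ s := by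
  unfold edgeList
  by_cases h : e₀ ∈ s <;> by_cases he : e = e₀ <;> simp [h, he]

theorem sum_map_edgeList (s : Finset W) (f : W → ℝ) :
    ((edgeList e₀ s).map f).sum = ∑ e ∈ s, f e := by
  unfold edgeList
  rw [List.map_append, List.sum_append, Finset.sum_map_toList]
  split_ifs with h
  · simp [Finset.sum_erase_add s f h]
  · simp [Finset.erase_eq_of_notMem h]

/-- No monotonicity is available for `e₀`. It stands innermost, where `dominated_singleton` compares
two equal laws, and only the other edges are added by `Dominated.cons`. -/
theorem dominated_edgeList {s : Finset W} (hq : ∀ i, q i ∈ Set.Icc (0 : ℝ) 1)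
    (hlam : ∀ e ∈ s, 0 ≤ lam e) (h0 : q e₀ = 1 - lam e₀)
    (h : ∀ e ∈ s, e ≠ e₀ → lam e ≤ (1 - q e) * (1 - ∑ e ∈ s, lam e)) :
    Dominated e₀ q lam (edgeList e₀ s) := by
  have base : Dominated e₀ q lam (if e₀ ∈ s then [e₀] else []) := by
    split_ifs
    · exact dominated_singleton h0
    · exact dominated_nil
  have key : ∀ L : List W, L.Nodup → (∀ e ∈ L, e ∈ s.erase e₀) →
      Dominated e₀ q lam (L ++ if e₀ ∈ s then [e₀] else []) := by
    intro L
    induction L with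
    | nil => exact fun _ _ => base
    | cons e L ih =>
      intro hnd hmem
      rw [List.nodup_cons] at hnd
      have hL : ∀ e ∈ L, e ∈ s.erase e₀ := fun e he => hmem e (List.mem_cons_of_mem _ he)
      have hes := Finset.mem_erase.1 (hmem e List.mem_cons_self)
      have hsub : ∀ e' ∈ L ++ (if e₀ ∈ s then [e₀] else []), e' ∈ s := by
        intro e' he'
        rcases List.mem_append.1 he' with he' | he'
        · exact Finset.mem_of_mem_erase (hL e' he')
        · split_ifs at he' with h'
          · rw [List.mem_singleton.1 he']; exact h'
          · simp at he'
      have hnd' : (L ++ if e₀ ∈ s then [e₀] else []).Nodup := by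
        refine List.Nodup.append hnd.2 (by split_ifs <;> simp) fun e' he' he'' => ?_
        split_ifs at he''
        · exact (Finset.mem_erase.1 (hL e' he')).1 (List.mem_singleton.1 he'')
        · simp at he''
      refine (ih hnd.2 hL).cons hes.1 ?_ (hq e) (fun e' he' => hlam e' (hsub e' he')) ?_
      · simp only [List.mem_append, not_or]
        refine ⟨hnd.1, ?_⟩
        split_ifs <;> simp [hes.1]
      · refine (h e hes.2 hes.1).trans (mul_le_mul_of_nonneg_left ?_ (by linarith [(hq e).2]))
        have : ((L ++ if e₀ ∈ s then [e₀] else []).map lam).sum =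
            ∑ e ∈ (L ++ if e₀ ∈ s then [e₀] else []).toFinset, lam e := by
          rw [List.sum_toFinset _ hnd']
        rw [this]
        linarith [Finset.sum_le_sum_of_subset_of_nonneg
          (s := (L ++ if e₀ ∈ s then [e₀] else []).toFinset) (t := s) (f := lam)
          (fun e' he' => hsub e' (List.mem_toFinset.1 he')) fun e' he' _ => hlam e' he']
  exact key _ (Finset.nodup_toList _) fun e he => Finset.mem_toList.1 he

end Domination

/-! ### Domination for all components simultaneously -/

section MixDomination

variable {V C : Type} [DecidableEq V] {E : C → Finset (Sym2 V)} {lam q : Sym2 V → ℝ}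
  {e₀ : Sym2 V}

/-- The edges of the components in the list `l`. -/
noncomputable def allEdges (e₀ : Sym2 V) (E : C → Finset (Sym2 V)) (l : List C) : List (Sym2 V) :=
  l.flatMap fun c => edgeList e₀ (E c)

theorem mem_allEdges {l : List C} {e : Sym2 V} : e ∈ allEdges e₀ E l ↔ ∃ c ∈ l, e ∈ E c := by
  simp [allEdges, mem_edgeList]

/-- Averaging over the later components preserves `AntitoneOff`, so domination can be applied to one
component at a time. -/
theorem ex_le_mix (hq : ∀ i, q i ∈ Set.Icc (0 : ℝ) 1) (hlam : ∀ c, ∀ e ∈ E c, 0 ≤ lam e)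
    (hsum : ∀ c, ∑ e ∈ E c, lam e ≤ 1)
    (hdom : ∀ c, Dominated e₀ q lam (edgeList e₀ (E c)))
    (hdisj : ∀ c c', ∀ e ∈ E c, e ∈ E c' → c = c')
    {φ : (Sym2 V → Bool) → ℝ} (hφ : AntitoneOff e₀ φ) {l : List C} (hl : l.Nodup)
    {K : Sym2 V → Bool} (hK : ∀ c ∈ l, ∀ e ∈ E c, K e = true) :
    ex q (allEdges e₀ E l) φ K ≤ mix E lam l φ K := by
  induction l generalizing K with
  | nil => exact le_rfl
  | cons c l ih =>
    rw [List.nodup_cons] at hl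
    have h1 := hdom c (ex q (allEdges e₀ E l) φ) (hφ.ex hq _) K fun e he =>
      hK c List.mem_cons_self e (mem_edgeList.1 he)
    rw [sum_map_edgeList, sum_map_edgeList] at h1
    have h2 : allEdges e₀ E (c :: l) = edgeList e₀ (E c) ++ allEdges e₀ E l := by
      simp [allEdges]
    rw [h2, ex_append]
    refine h1.trans (add_le_add ?_ (Finset.sum_le_sum fun e he => ?_))
    · exact mul_le_mul_of_nonneg_left
        (ih hl.2 fun c' hc' => hK c' (List.mem_cons_of_mem _ hc')) (by linarith [hsum c])
    · refine mul_le_mul_of_nonneg_left (ih hl.2 fun c' hc' e' he' => ?_) (hlam c e he)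
      rw [Function.update_of_ne]
      · exact hK c' (List.mem_cons_of_mem _ hc') e' he'
      · rintro rfl
        exact hl.1 (hdisj c c' _ he he' ▸ hc')

end MixDomination

end PPSZ

namespace PPSZ

/-! ### The value of the root -/

section Miss

variable {W : Type} [DecidableEq W] {q : W → ℝ}

/-- The indicator of the event that the edge `e` is identified. -/
noncomputable def missInd (e : W) (K : W → Bool) : ℝ := if K e = false then 1 else 0

omit [DecidableEq W] in
theorem missInd_mem_Icc (e : W) (K : W → Bool) : missInd e K ∈ Set.Icc (0 : ℝ) 1 := by
  unfold missInd; split_ifs <;> simp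

omit [DecidableEq W] in
theorem antitone_missInd (e : W) : Antitone (missInd e) := by
  intro K K' h
  unfold missInd
  have := h e
  split_ifs with h1 h2 h2
  · exact le_rfl
  · rw [h1] at this; exact absurd (le_antisymm this (Bool.false_le _)) h2
  · exact zero_le_one
  · exact le_rfl

omit [DecidableEq W] in
theorem dependsOn_missInd (e : W) : DependsOn (missInd e) {e} := by
  intro K K' h
  simp only [missInd, h e rfl]

/-- The probability that the edge `e` is identified. -/
noncomputable def missProb (q : W → ℝ) (L : List W) (e : W) : ℝ :=
  if e ∈ L then 1 - q e else 0

theorem ex_missInd (L : List W) (e : W) :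
    ex q L (missInd e) (fun _ => true) = missProb q L e := by
  have key : ∀ K : W → Bool, ex q L (missInd e) K = if e ∈ L then 1 - q e else missInd e K := by
    induction L with
    | nil => intro K; simp [ex]
    | cons i L ih =>
      intro K
      simp only [ex, ih]
      by_cases hL : e ∈ L
      · simp only [hL, if_true, List.mem_cons, or_true]; ring
      · by_cases hi : e = i
        · subst hi; simp [hL, missInd]
        · simp only [hL, if_false, List.mem_cons, hi, or_self, missInd, ne_eq,
            not_false_eq_true, Function.update_of_ne]
          ring
  rw [key]
  simp [missProb, missInd]

theorem missProb_mem_Icc (hq : ∀ i, q i ∈ Set.Icc (0 : ℝ) 1) (L : List W) (e : W) :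
    missProb q L e ∈ Set.Icc (0 : ℝ) 1 := by
  unfold missProb
  split_ifs
  · exact ⟨by linarith [(hq e).2], by linarith [(hq e).1]⟩
  · simp

end Miss

/-! ### The root and the identification of its two children -/

section Root

variable {V : Type} [DecidableEq V]

omit [DecidableEq V] in
theorem monotone_keepProb {p : V → ℝ} (hp : ∀ i, p i ∈ Set.Icc (0 : ℝ) 1) (w : V) (q : List V) :
    Monotone fun K => keepProb p K w q := by
  intro K K' h
  simp only [keepProb]
  split_ifs with h1 h2
  · exact le_rfl
  · exact absurd (fun a ha => le_antisymm (Bool.le_true _) (h1 a ha ▸ h s(w, a))) h2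
  · exact (hp w).1
  · exact le_rfl

/-- The pairs that are not contained in the path `q`. -/
def freshPairs (q : List V) : Set (Sym2 V) := {e | ∃ v ∈ e, v ∉ q}

omit [DecidableEq V] in
theorem freshPairs_cons_subset (w : V) (q : List V) : freshPairs (w :: q) ⊆ freshPairs q :=
  fun _ ⟨v, hv, h⟩ => ⟨v, hv, fun h' => h (List.mem_cons_of_mem _ h')⟩

-- Whether `w` is kept is decided by the pairs joining it to its path. From `w` downwards these
-- pairs lie inside the path and are never consulted again, which is the freshness needed for
-- `cutProb_le_ex`.
omit [DecidableEq V] in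
theorem dependsOn_keepProb (p : V → ℝ) {w : V} {q : List V} (hw : w ∉ q) :
    DependsOn (fun K => keepProb p K w q) (freshPairs q \ freshPairs (w :: q)) := by
  intro K K' h
  have : ∀ a ∈ q, K s(w, a) = K' s(w, a) := by
    intro a ha
    refine h _ ⟨⟨w, Sym2.mem_mk_left _ _, hw⟩, ?_⟩
    rintro ⟨v, hv, hv'⟩
    rcases Sym2.mem_iff.1 hv with rfl | rfl
    · exact hv' List.mem_cons_self
    · exact hv' (List.mem_cons_of_mem _ ha)
  simp only [keepProb]
  congr 1
  exact propext ⟨fun h' a ha => this a ha ▸ h' a ha, fun h' a ha => (this a ha).symm ▸ h' a ha⟩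

variable {p : V → ℝ} {ch : List V → Finset V} {q : Sym2 V → ℝ}

/-- The deletion probabilities when the edges are identified independently. -/
noncomputable def delProb (p : V → ℝ) (q : Sym2 V → ℝ) (L : List (Sym2 V)) (w : V)
    (l : List V) : ℝ := ex q L (fun K => keepProb p K w l) fun _ => true

theorem delProb_mem_Icc (hp : ∀ i, p i ∈ Set.Icc (0 : ℝ) 1) (hq : ∀ i, q i ∈ Set.Icc (0 : ℝ) 1)
    (L : List (Sym2 V)) (w : V) (l : List V) : delProb p q L w l ∈ Set.Icc (0 : ℝ) 1 :=
  ⟨ex_nonneg hq L (fun K => (keepProb_mem_Icc hp K w l).1) _,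
    ex_le_one hq L (fun K => (keepProb_mem_Icc hp K w l).2) _⟩

theorem delProb_le (hp : ∀ i, p i ∈ Set.Icc (0 : ℝ) 1) (hq : ∀ i, q i ∈ Set.Icc (0 : ℝ) 1)
    (L : List (Sym2 V)) (w : V) (l : List V) : delProb p q L w l ≤ p w := by
  have := ex_mono hq L (f := fun K => keepProb p K w l) (g := fun _ => p w) (fun K => by
    simp only [keepProb]; split_ifs
    · exact le_rfl
    · exact (hp w).1) fun _ => true
  rwa [ex_const] at this

/-- A union bound over the pairs joining `w` to its path. -/
theorem le_delProb (hp : ∀ i, p i ∈ Set.Icc (0 : ℝ) 1) (hq : ∀ i, q i ∈ Set.Icc (0 : ℝ) 1)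
    (L : List (Sym2 V)) (w : V) (l : List V) :
    p w * (1 - (l.map fun a => missProb q L s(w, a)).sum) ≤ delProb p q L w l := by
  have h1 : ∀ K, p w * (1 - (l.map fun a => missInd s(w, a) K).sum) ≤ keepProb p K w l := by
    intro K
    have hnn : 0 ≤ (l.map fun a => missInd s(w, a) K).sum := List.sum_nonneg (by
      simp only [List.mem_map]
      rintro _ ⟨a, _, rfl⟩
      exact (missInd_mem_Icc _ K).1)
    simp only [keepProb]
    split_ifs with h
    · nlinarith [(hp w).1]
    · push Not at h
      obtain ⟨a, ha, hK⟩ := h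
      have : missInd s(w, a) K ≤ (l.map fun a => missInd s(w, a) K).sum :=
        List.single_le_sum (by
          simp only [List.mem_map]
          rintro _ ⟨a, _, rfl⟩
          exact (missInd_mem_Icc _ K).1) _ (List.mem_map.2 ⟨a, ha, rfl⟩)
      have h2 : missInd s(w, a) K = 1 := by simp [missInd, Bool.eq_false_of_not_eq_true hK]
      nlinarith [(hp w).1]
  have h2 := ex_mono hq L h1 fun _ => true
  have h3 : ∀ l : List V, ex q L (fun K => (l.map fun a => missInd s(w, a) K).sum)
      (fun _ => true) = (l.map fun a => missProb q L s(w, a)).sum := by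
    intro l
    induction l with
    | nil => simp [ex_const]
    | cons a l ih => simp only [List.map_cons, List.sum_cons, ex_add, ih, ex_missInd]
  rwa [ex_const_mul, ex_one_sub, h3] at h2

/-- The expected cut probability of a subtree. -/
noncomputable def meanCut (p : V → ℝ) (ch : List V → Finset V) (q : Sym2 V → ℝ)
    (L : List (Sym2 V)) (n : ℕ) (l : List V) : ℝ :=
  ex q L (fun K => cutProb ch (keepProb p K) n l) fun _ => true

theorem meanCut_mem_Icc (hp : ∀ i, p i ∈ Set.Icc (0 : ℝ) 1) (hq : ∀ i, q i ∈ Set.Icc (0 : ℝ) 1)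
    (L : List (Sym2 V)) (n : ℕ) (l : List V) : meanCut p ch q L n l ∈ Set.Icc (0 : ℝ) 1 :=
  ⟨ex_nonneg hq L (fun K => (cutProb_mem_Icc (keepProb_mem_Icc hp K) n l).1) _,
    ex_le_one hq L (fun K => (cutProb_mem_Icc (keepProb_mem_Icc hp K) n l).2) _⟩

theorem cutProb_le_meanCut (hp : ∀ i, p i ∈ Set.Icc (0 : ℝ) 1)
    (hq : ∀ i, q i ∈ Set.Icc (0 : ℝ) 1) (hch : ∀ l, ∀ w ∈ ch l, w ∉ l) (L : List (Sym2 V))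
    (n : ℕ) (l : List V) : cutProb ch (delProb p q L) n l ≤ meanCut p ch q L n l :=
  cutProb_le_ex (D := fun w l K => keepProb p K w l) (T := freshPairs) hq L
    (fun w l K => keepProb_mem_Icc hp K w l) (monotone_keepProb hp)
    (fun l w _ => freshPairs_cons_subset w l) (fun l w hw => dependsOn_keepProb p (hch l w hw)) _ n l

/-- The cut probability of the child `w` of the root (the event that `w` itself is deleted
included). -/
noncomputable def childVal (p : V → ℝ) (ch : List V → Finset V) (n : ℕ) (x w : V)
    (K : Sym2 V → Bool) : ℝ :=
  1 - (1 - keepProb p K w [x]) * (1 - cutProb ch (keepProb p K) n [w, x])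

open Classical in
/-- The lower bound for the cut probability of the tree of a root `x` with children `y`, `z`;
it takes into account that `{y, z}` may be identified. -/
noncomputable def rootVal (p : V → ℝ) (ch : List V → Finset V) (n : ℕ) (r : ℝ) (x y z : V)
    (K : Sym2 V → Bool) : ℝ :=
  childVal p ch n x y K * childVal p ch n x z K +
    if K s(y, z) = false ∧ K s(y, x) = true ∧ K s(z, x) = true then
      r * (1 - r) * ((1 - cutProb ch (keepProb p K) n [y, x]) *
        (1 - cutProb ch (keepProb p K) n [z, x])) else 0

variable {r : ℝ} {x y z : V}

omit [DecidableEq V] in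
theorem childVal_mem_Icc (hp : ∀ i, p i ∈ Set.Icc (0 : ℝ) 1) (n : ℕ) (x w : V)
    (K : Sym2 V → Bool) : childVal p ch n x w K ∈ Set.Icc (0 : ℝ) 1 :=
  one_sub_mul_mem_Icc (keepProb_mem_Icc hp K _ _) (cutProb_mem_Icc (keepProb_mem_Icc hp K) n _)

omit [DecidableEq V] in
theorem monotone_cutProb_keepProb (hp : ∀ i, p i ∈ Set.Icc (0 : ℝ) 1) (n : ℕ) (l : List V) :
    Monotone fun K => cutProb ch (keepProb p K) n l :=
  monotone_cutProb (D := fun w l K => keepProb p K w l) (fun w l K => keepProb_mem_Icc hp K w l)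
    (monotone_keepProb hp) n l

omit [DecidableEq V] in
theorem monotone_childVal (hp : ∀ i, p i ∈ Set.Icc (0 : ℝ) 1) (n : ℕ) (x w : V) :
    Monotone (childVal p ch n x w) := fun K K' h =>
  one_sub_mul_mono (monotone_keepProb hp w [x] h) (monotone_cutProb_keepProb hp n [w, x] h)
    (keepProb_mem_Icc hp K' _ _).2 (cutProb_mem_Icc (keepProb_mem_Icc hp K) n _).2

-- With `a`, `b` the cut values below `y`, `z`, the correction `r (1 - r) (1 - a) (1 - b)` is
-- exactly the excess of `1 - (1 - r) (1 - a b)` over the product of the two child values.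
omit [DecidableEq V] in
theorem rootVal_of_pos (hy : p y = r) (hz : p z = r) (n : ℕ) {K : Sym2 V → Bool}
    (h : K s(y, z) = false ∧ K s(y, x) = true ∧ K s(z, x) = true) :
    rootVal p ch n r x y z K = 1 - (1 - r) * (1 - cutProb ch (keepProb p K) n [y, x] *
      cutProb ch (keepProb p K) n [z, x]) := by
  have h1 : keepProb p K y [x] = r := by simp [keepProb, h.2.1, hy]
  have h2 : keepProb p K z [x] = r := by simp [keepProb, h.2.2, hz]
  rw [rootVal, if_pos h, childVal, childVal, h1, h2]
  ring

/-- Identifying an edge other than `s(y, z)` cannot create the correction term. If the term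
persists, the closed form is increasing in both subtree values; if it is absent afterwards, at most
a nonnegative amount has been lost, and the child values decrease as well. -/
theorem antitoneOff_rootVal (hp : ∀ i, p i ∈ Set.Icc (0 : ℝ) 1) (hr : r ∈ Set.Icc (0 : ℝ) 1)
    (hy : p y = r) (hz : p z = r) (n : ℕ) : AntitoneOff s(y, z) (rootVal p ch n r x y z) := by
  intro K e he
  set K' := Function.update K e false with hK'
  have hle : K' ≤ K := by
    intro j
    by_cases h : j = e
    · subst h; simp [hK']
    · simp [hK', h]
  have hC : ∀ K l, cutProb ch (keepProb p K) n l ∈ Set.Icc (0 : ℝ) 1 := fun K l =>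
    cutProb_mem_Icc (keepProb_mem_Icc hp K) n l
  have hm := fun l => monotone_cutProb_keepProb (ch := ch) hp n l hle
  by_cases h : K' s(y, z) = false ∧ K' s(y, x) = true ∧ K' s(z, x) = true
  · have hK : K s(y, z) = false ∧ K s(y, x) = true ∧ K s(z, x) = true := by
      refine ⟨?_, ?_, ?_⟩
      · rw [← h.1, hK', Function.update_of_ne he.symm]
      · exact le_antisymm (Bool.le_true _) (h.2.1 ▸ hle s(y, x))
      · exact le_antisymm (Bool.le_true _) (h.2.2 ▸ hle s(z, x))
    rw [rootVal_of_pos hy hz n h, rootVal_of_pos hy hz n hK]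
    have := mul_le_mul (hm [y, x]) (hm [z, x]) (hC K' _).1 (hC K _).1
    simp only at this
    nlinarith [hr.2]
  · have h1 : rootVal p ch n r x y z K' = childVal p ch n x y K' * childVal p ch n x z K' := by
      rw [rootVal, if_neg h, add_zero]
    rw [h1]
    refine (mul_le_mul (monotone_childVal hp n x y hle) (monotone_childVal hp n x z hle)
      (childVal_mem_Icc hp n x z K').1 (childVal_mem_Icc hp n x y K).1).trans ?_
    rw [rootVal]
    refine le_add_of_nonneg_right ?_
    split_ifs
    · exact mul_nonneg (mul_nonneg hr.1 (by linarith [hr.2]))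
        (mul_nonneg (by linarith [(hC K [y, x]).2]) (by linarith [(hC K [z, x]).2]))
    · exact le_rfl

theorem rootVal_le_bexp [Fintype V] {C : Type} {comp : V → C} {sel : List V → Clause V}
    {m : V → V} {K : Sym2 V → Bool} (hp : ∀ i, p i ∈ Set.Icc (0 : ℝ) 1)
    (hch : ∀ q, ∀ w ∈ children sel q, w ∉ q) (hy : p y = r) (hz : p z = r) (hxy : y ≠ x)
    (hxz : z ≠ x) (hyz : y ≠ z) (hroot : children sel [x] = {y, z}) (n : ℕ)
    (h : IsState p x comp [] m K) :
    rootVal p (children sel) n r x y z K ≤ bexp p fun b => cutInd sel (n + 1) x (b ∘ m) := by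
  by_cases hK : K s(y, z) = false
  -- Identified edges are vertex-disjoint, so once `s(y, z)` is identified neither child can be
  -- identified with the root.
  · have h1 : K s(y, x) = true := by
      by_contra hf
      have := h.disj _ _ hK (Bool.eq_false_of_not_eq_true hf) y (by simp) (by simp)
      simp only [Sym2.eq_iff] at this
      rcases this with ⟨_, h⟩ | ⟨h, _⟩
      · exact hxz h
      · exact hxy h
    have h2 : K s(z, x) = true := by
      by_contra hf
      have := h.disj _ _ hK (Bool.eq_false_of_not_eq_true hf) z (by simp) (by simp)
      simp only [Sym2.eq_iff] at this
      rcases this with ⟨h, _⟩ | ⟨h, _⟩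
      · exact hyz h
      · exact hxy h
    rw [rootVal_of_pos hy hz n ⟨hK, h1, h2⟩]
    have hid := h.isIdentification y [x] (by simpa using hxy) (by simp) (by simpa using h1)
    have := cutProb_le_bexp_cutInd_of_eq hp hch h.isIdentification n hyz hroot (h.ident y z hK)
      (hid.1 x (by simp))
    rwa [hid.2, hy] at this
  · rw [rootVal, if_neg (fun h => hK h.1), add_zero]
    have := cutProb_le_bexp_cutInd hp hch h.isIdentification (n + 1)
    rwa [cutProb, hroot, Finset.prod_pair hyz] at this

/-- Two uses of Harris' inequality: the child values are both monotone, and the identification of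
`s(y, z)` as well as the survival of each subtree are antitone. Excluding the edges from `y`, `z` to
the root costs the products of independent identification probabilities. -/
theorem le_ex_rootVal (hp : ∀ i, p i ∈ Set.Icc (0 : ℝ) 1) (hq : ∀ i, q i ∈ Set.Icc (0 : ℝ) 1)
    (hch : ∀ l, ∀ w ∈ ch l, w ∉ l) (hr : r ∈ Set.Icc (0 : ℝ) 1)
    (hxy : y ≠ x) (hxz : z ≠ x) (hyz : y ≠ z) (L : List (Sym2 V)) (n : ℕ) :
    (1 - (1 - delProb p q L y [x]) * (1 - meanCut p ch q L n [y, x])) *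
        (1 - (1 - delProb p q L z [x]) * (1 - meanCut p ch q L n [z, x])) +
      r * (1 - r) * (missProb q L s(y, z) * ((1 - meanCut p ch q L n [y, x]) *
        (1 - meanCut p ch q L n [z, x]) - missProb q L s(y, x) - missProb q L s(z, x))) ≤
    ex q L (rootVal p ch n r x y z) fun _ => true := by
  set K₁ : Sym2 V → Bool := fun _ => true
  set A : V → (Sym2 V → Bool) → ℝ := fun w K => cutProb ch (keepProb p K) n [w, x] with hA
  have hA01 : ∀ w K, A w K ∈ Set.Icc (0 : ℝ) 1 := fun w K =>
    cutProb_mem_Icc (keepProb_mem_Icc hp K) n _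
  have hAm : ∀ w, Monotone (A w) := fun w => monotone_cutProb_keepProb hp n _
  have hT : ∀ w, w ≠ x → ex q L (childVal p ch n x w) K₁ =
      1 - (1 - delProb p q L w [x]) * (1 - meanCut p ch q L n [w, x]) := fun w hw =>
    ex_one_sub_mul L (dependsOn_keepProb p (by simpa using hw))
      (dependsOn_cutProb (D := fun w l K => keepProb p K w l) (T := freshPairs)
        (fun l w _ => freshPairs_cons_subset w l)
        (fun l w hw => dependsOn_keepProb p (hch l w hw)) n [w, x]) Set.disjoint_sdiff_left _
  have hB : Antitone fun K => (1 - A y K) * (1 - A z K) := fun K K' h =>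
    mul_le_mul (sub_le_sub_left (hAm y h) 1) (sub_le_sub_left (hAm z h) 1)
      (by linarith [(hA01 z K').2]) (by linarith [(hA01 y K).2])
  have h1 : (1 - meanCut p ch q L n [y, x]) * (1 - meanCut p ch q L n [z, x]) ≤
      ex q L (fun K => (1 - A y K) * (1 - A z K)) K₁ := by
    have := ex_mul_le_of_antitone hq L (f := fun K => 1 - A y K) (g := fun K => 1 - A z K)
      (fun K K' h => sub_le_sub_left (hAm y h) 1) (fun K K' h => sub_le_sub_left (hAm z h) 1) K₁
    rwa [ex_one_sub, ex_one_sub] at this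
  have h2 := ex_mul_le_of_antitone hq L (antitone_missInd s(y, z)) hB K₁
  rw [ex_missInd] at h2
  have h3 : ∀ w, s(y, z) ≠ s(w, x) → ex q L (fun K => missInd s(y, z) K * missInd s(w, x) K) K₁ =
      missProb q L s(y, z) * missProb q L s(w, x) := fun w hw => by
    rw [ex_mul_of_disjoint L (dependsOn_missInd _) (dependsOn_missInd _)
      (Set.disjoint_singleton.2 hw), ex_missInd, ex_missInd]
  have h3y := h3 y (by
    simp only [ne_eq, Sym2.eq_iff, not_or, not_and]; exact ⟨fun _ h => hxz h, fun h => absurd h hxy⟩)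
  have h3z := h3 z (by
    simp only [ne_eq, Sym2.eq_iff, not_or, not_and]; exact ⟨fun h => absurd h hyz, fun h => absurd h hxy⟩)
  have h4 := ex_mul_le hq L (monotone_childVal (ch := ch) hp n x y)
    (monotone_childVal (ch := ch) hp n x z) K₁
  rw [hT y hxy, hT z hxz] at h4
  -- The condition that neither child is identified with the root is replaced by a union bound,
  -- using that the survival product is at most `1`.
  have h5 : ∀ K, childVal p ch n x y K * childVal p ch n x z K + r * (1 - r) *
      (missInd s(y, z) K * ((1 - A y K) * (1 - A z K)) -
        missInd s(y, z) K * missInd s(y, x) K - missInd s(y, z) K * missInd s(z, x) K) ≤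
      rootVal p ch n r x y z K := by
    intro K
    rw [rootVal]
    refine add_le_add_right ?_ _
    have hr' : 0 ≤ r * (1 - r) := mul_nonneg hr.1 (by linarith [hr.2])
    have hy := hA01 y K
    have hz := hA01 z K
    have hyz0 := mul_nonneg (sub_nonneg.2 hy.2) (sub_nonneg.2 hz.2)
    have hyz1 : (1 - A y K) * (1 - A z K) ≤ 1 := by nlinarith [hy.1, hz.1, hy.2, hz.2]
    split_ifs with hc
    · simp [missInd, hc.1, hc.2.1, hc.2.2, hA]
    · refine mul_nonpos_of_nonneg_of_nonpos hr' ?_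
      by_cases c1 : K s(y, z) = false
      · by_cases c2 : K s(y, x) = true
        · have c3 : K s(z, x) = false := Bool.eq_false_of_not_eq_true fun h => hc ⟨c1, c2, h⟩
          simp only [missInd, c1, c2, c3, if_true, Bool.true_eq_false, if_false]
          linarith
        · have h0 := (missInd_mem_Icc s(z, x) K).1
          simp only [missInd, c1, Bool.eq_false_of_not_eq_true c2, if_true] at h0 ⊢
          linarith
      · simp [missInd, c1]
  refine le_trans ?_ (ex_mono hq L h5 K₁)
  rw [ex_add, ex_const_mul, ex_sub, ex_sub, h3y, h3z]
  refine add_le_add h4 (mul_le_mul_of_nonneg_left ?_ (mul_nonneg hr.1 (by linarith [hr.2])))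
  have h6 := mul_le_mul_of_nonneg_left h1 (missProb_mem_Icc hq L s(y, z)).1
  linarith

end Root

end PPSZ

namespace PPSZ

/-! ### Structure of the critical clause trees -/

section Trees

variable {V : Type} [DecidableEq V] {F : Finset (Clause V)} {canon : V → Clause V}
  {sel : List V → Clause V}

/-- The list `p` is the path from a node of the tree to the root. -/
def IsTreePath (sel : List V → Clause V) (p : List V) : Prop :=
  ∀ w a q, (w :: a :: q) <:+ p → w ∈ children sel (a :: q)

theorem isTreePath_singleton (x : V) : IsTreePath sel [x] := by
  intro w a q h
  have := h.length_le
  simp at this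

theorem IsTreePath.cons {w : V} {p : List V} (hp : IsTreePath sel p) (hw : w ∈ children sel p) :
    IsTreePath sel (w :: p) := by
  intro w' a q h
  rcases List.suffix_cons_iff.1 h with h | h
  · obtain ⟨rfl, rfl⟩ := List.cons.inj h
    exact hw
  · exact hp w' a q h

theorem isCanonicalNode_cons {w a : V} {q : List V} :
    IsCanonicalNode F canon sel (w :: a :: q) ↔
      IsCanonicalNode F canon sel (a :: q) ∧ w ∉ TwoCC F ∧ sel (a :: q) = canon a := by
  constructor
  · rintro ⟨h1, h2⟩
    refine ⟨⟨fun v hv => h1 v (List.mem_cons_of_mem _ hv), fun b l hbl _ =>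
      h2 b l (hbl.trans (List.suffix_cons _ _)) fun h => ?_⟩, h1 w List.mem_cons_self,
      h2 a q (List.suffix_cons _ _) fun h => ?_⟩
    · have := hbl.length_le
      rw [h] at this
      simp at this
    · have := congrArg List.length h
      simp at this
  · rintro ⟨⟨h1, h2⟩, h3, h4⟩
    refine ⟨fun v hv => ?_, fun b l hbl hne => ?_⟩
    · rcases List.mem_cons.1 hv with rfl | hv
      · exact h3
      · exact h1 v hv
    · rcases List.suffix_cons_iff.1 hbl with h | h
      · exact absurd h hne
      · by_cases hh : b :: l = a :: q
        · rw [hh, h4]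
          rw [(List.cons.inj hh).1]
        · exact h2 b l h hh

theorem isCanonicalNode_singleton {x : V} (hx : x ∉ TwoCC F) : IsCanonicalNode F canon sel [x] := by
  refine ⟨by simpa using hx, fun b l hbl hne => ?_⟩
  rcases List.suffix_cons_iff.1 hbl with h | h
  · exact absurd h hne
  · simp at h

theorem IsClauseLabelling.notMem_of_mem_children (hsel : IsClauseLabelling F canon sel)
    (p : List V) : ∀ w ∈ children sel p, w ∉ p := by
  intro w hw
  cases p with
  | nil => simp
  | cons a q =>
    intro h
    refine (hsel a q).2.1 ⟨(w, false), mem_children.1 hw, ?_⟩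
    simp [assignmentLabel, h]

theorem IsClauseLabelling.mem_of_pos (hsel : IsClauseLabelling F canon sel) {a b : V} {q : List V}
    (hb : (b, true) ∈ sel (a :: q)) : b ∈ a :: q := by
  by_contra h
  exact (hsel a q).2.1 ⟨(b, true), hb, by simp [assignmentLabel] at h ⊢; exact h⟩

omit [DecidableEq V] in
theorem exists_pos_of_mem (hone : OnesUnique F) {C : Clause V} (hC : C ∈ F) :
    ∃ b, (b, true) ∈ C := by
  obtain ⟨⟨b, t⟩, hb, ht⟩ := (hone fun _ => true).2 rfl C hC
  simp only at ht
  exact ⟨b, ht ▸ hb⟩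

theorem card_neg_add_card_pos (C : Clause V) :
    ((C.filter fun l => l.2 = false).image Prod.fst).card +
      (C.filter fun l => l.2 = true).card ≤ C.card := by
  have h1 : ((C.filter fun l => l.2 = false).image Prod.fst).card ≤
    (C.filter fun l => l.2 = false).card := Finset.card_image_le
  have h2 := Finset.card_filter_add_card_filter_not (s := C) (fun l => l.2 = false)
  simp only [Bool.not_eq_false] at h2
  omega

theorem IsClauseLabelling.card_children_le (hF : IsThreeCNF F) (hone : OnesUnique F)
    (hsel : IsClauseLabelling F canon sel) (a : V) (q : List V) :
    (children sel (a :: q)).card ≤ 2 := by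
  obtain ⟨b, hb⟩ := exists_pos_of_mem hone (hsel a q).1
  have h1 := card_neg_add_card_pos (sel (a :: q))
  have h2 := (hF _ (hsel a q).1).1
  have h3 : 0 < ((sel (a :: q)).filter fun l => l.2 = true).card :=
    Finset.card_pos.2 ⟨(b, true), by simp [hb]⟩
  unfold children
  omega

/-- A canonical node whose clause label is not its canonical clause has at most one child. -/
theorem IsClauseLabelling.card_children_le_one (hF : IsThreeCNF F) (hone : OnesUnique F)
    (hcan : IsCanonicalChoice F canon) (hsel : IsClauseLabelling F canon sel) {a : V} {q : List V}
    (hp : IsTreePath sel (a :: q)) (hc : IsCanonicalNode F canon sel (a :: q))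
    (hne : sel (a :: q) ≠ canon a) : (children sel (a :: q)).card ≤ 1 := by
  by_contra hcard
  push Not at hcard
  obtain ⟨b, hb⟩ := exists_pos_of_mem hone (hsel a q).1
  have h1 := card_neg_add_card_pos (sel (a :: q))
  have h2 := (hF _ (hsel a q).1).1
  have h3 : ((sel (a :: q)).filter fun l => l.2 = true).card ≤ 1 := by
    unfold children at hcard
    omega
  -- Two negative literals among at most three leave room for a single positive one.
  have hcrit : (sel (a :: q)).IsCritical b := by
    refine ⟨hb, fun l hl ht => ?_⟩
    have := Finset.card_le_one.1 h3 l (by simp [hl, ht]) (b, true) (by simp [hb])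
    rw [this]
  have hbp := hsel.mem_of_pos hb
  have hbt := hc.1 b hbp
  have heq : sel (a :: q) = canon b := by
    by_contra h
    exact hbt ⟨_, Or.inl (hsel a q).1, _, Or.inl (hcan b).1, h, hcrit, (hcan b).2⟩
  -- So `b` is a proper ancestor whose clause label is this very clause. The next node `w` on the
  -- path arose from a negative literal of it, hence `w` would be both on the path and a child of
  -- the current node, although that clause is violated here.
  have hba : b ≠ a := fun h => hne (by rw [heq, h])
  obtain ⟨s, l, hs⟩ := List.append_of_mem hbp
  rcases List.eq_nil_or_concat s with rfl | ⟨s, w, rfl⟩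
  · exact hba (List.cons.inj hs).1.symm
  · have hs1 : (w :: b :: l) <:+ (a :: q) := ⟨s, by simp [hs]⟩
    have hs2 : (b :: l) <:+ (a :: q) := ⟨s ++ [w], by simp [hs]⟩
    have hs3 : b :: l ≠ a :: q := fun h => hba (List.cons.inj h).1
    have hw := mem_children.1 (hp w b l hs1)
    rw [hc.2 b l hs2 hs3, ← heq] at hw
    exact hsel.notMem_of_mem_children _ w (mem_children.2 hw) (hs1.subset List.mem_cons_self)

end Trees

/-! ### Lower bounds for the recursion -/

/-- If both `t - S` and `t - T` are nonnegative, multiply and discard `S T`; otherwise the left side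
is nonpositive. -/
theorem sq_sub_le_mul {t f g S T : ℝ} (ht0 : 0 ≤ t) (hf0 : 0 ≤ f) (hg0 : 0 ≤ g) (hS : 0 ≤ S)
    (hT : 0 ≤ T) (hf : t - S ≤ f) (hg : t - T ≤ g) : t ^ 2 - t * (S + T) ≤ f * g := by
  rcases le_total 0 (t - S) with h | h
  · rcases le_total 0 (t - T) with h' | h'
    · nlinarith [mul_le_mul hf hg h' hf0, mul_nonneg hS hT]
    · nlinarith [mul_nonneg hf0 hg0, mul_nonneg ht0 hS]
  · nlinarith [mul_nonneg hf0 hg0, mul_nonneg ht0 hT]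

/-- Fewer than two factors only help, since `t ≤ 1`. -/
theorem sq_sub_le_prod {κ : Type} {s : Finset κ} (hs : s.card ≤ 2) {f T : κ → ℝ} {t : ℝ}
    (ht0 : 0 ≤ t) (ht1 : t ≤ 1) (h0 : ∀ k ∈ s, 0 ≤ f k) (hT : ∀ k ∈ s, 0 ≤ T k)
    (hf : ∀ k ∈ s, t - T k ≤ f k) : t ^ 2 - t * ∑ k ∈ s, T k ≤ ∏ k ∈ s, f k := by
  classical
  have hc : s.card = 0 ∨ s.card = 1 ∨ s.card = 2 := by omega
  rcases hc with hc | hc | hc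
  · rw [Finset.card_eq_zero.1 hc]
    simp only [Finset.sum_empty, Finset.prod_empty]
    nlinarith
  · obtain ⟨a, rfl⟩ := Finset.card_eq_one.1 hc
    simp only [Finset.mem_singleton, forall_eq, Finset.sum_singleton,
      Finset.prod_singleton] at *
    rcases le_total 0 (t - T a) with h | h <;> nlinarith
  · obtain ⟨a, b, hab, rfl⟩ := Finset.card_eq_two.1 hc
    simp only [Finset.mem_insert, Finset.mem_singleton, forall_eq_or_imp, forall_eq,
      Finset.sum_pair hab, Finset.prod_pair hab] at *
    exact sq_sub_le_mul ht0 h0.1 h0.2 hT.1 hT.2 hf.1 hf.2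

/-- The numerical conditions under which the recursion is estimated. Here `t ^ 2` is the cut
probability of the ideal tree, `η` and `ϑ` bound the decrease of the deletion probabilities,
`δ + k Δ` bounds the resulting decrease of the cut probabilities, `β ^ n` is the error for trees of
height `n`, and `bonus` is the increase of the deletion probability of the other variables. -/
structure LossParams (r t κ η ϑ δ Δ β bonus : ℝ) : Prop where
  r_pos : 0 < r
  r_lt : r < 1 / 2
  t_mul : t * (1 - r) = r
  η_nonneg : 0 ≤ η
  ϑ_nonneg : 0 ≤ ϑ
  δ_nonneg : 0 ≤ δ
  Δ_nonneg : 0 ≤ Δ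
  β_nonneg : 0 ≤ β
  bonus_nonneg : 0 ≤ bonus
  hδ : 2 * t * η * (κ * (1 - t ^ 2)) ≤ (1 - 2 * r) * δ
  hΔ : 2 * t * ϑ * (κ * (1 - t ^ 2)) ≤ Δ
  hκ : 1 - t ^ 2 + δ + 2 * Δ ≤ κ * (1 - t ^ 2)
  hβ : 2 * t * (1 - r + η + ϑ) ≤ β
  hbonus : (1 - r) * (δ + 2 * Δ) ≤ bonus * (1 - t ^ 2)
  hone₁ : 2 * ((η + ϑ) * (κ * (1 - t ^ 2)) + (1 - r) * (δ + 2 * Δ)) ≤ t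
  hone₂ : (η + ϑ) * (κ * (1 - t ^ 2)) + (1 - r) * (δ + 2 * Δ) ≤ t - t ^ 2

namespace LossParams

variable {r t κ η ϑ δ Δ β bonus : ℝ}

theorem t_pos (h : LossParams r t κ η ϑ δ Δ β bonus) : 0 < t := by
  have h1 := h.t_mul
  have h2 := h.r_pos
  have h3 := h.r_lt
  by_contra hc
  push Not at hc
  nlinarith

theorem t_lt (h : LossParams r t κ η ϑ δ Δ β bonus) : t < 1 := by
  have h1 := h.t_mul
  have h3 := h.r_lt
  by_contra hc
  push Not at hc
  nlinarith

/-- The unperturbed value is the fixed point `t = 1 - (1 - r) (1 - t ^ 2)`. A loss `l` of cut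
probability is damped by `1 - r`, and a loss `η'` of deletion probability costs `η'` times the
survival probability of the subtree. -/
theorem step (h : LossParams r t κ η ϑ δ Δ β bonus) {D a l η' : ℝ} (hD1 : D ≤ 1)
    (hη' : 0 ≤ η') (hD : r - η' ≤ D) (ha : a ≤ 1) (hal : t ^ 2 - l ≤ a) {e κ' : ℝ}
    (hκ' : 1 - a ≤ κ' + e) :
    t - ((1 - r) * l + η' * κ' + η' * e) ≤ 1 - (1 - D) * (1 - a) := by
  have h1 := h.t_mul
  have h3 := h.r_lt
  have e1 : (1 - r) * (1 - t ^ 2) = 1 - t := by nlinarith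
  have e2 : (1 - D) * (1 - a) ≤ (1 - r + η') * (1 - a) :=
    mul_le_mul_of_nonneg_right (by linarith) (by linarith)
  have e3 : (1 - r) * (1 - a) ≤ (1 - r) * (1 - t ^ 2 + l) :=
    mul_le_mul_of_nonneg_left (by linarith) (by linarith)
  have e4 := mul_le_mul_of_nonneg_left hκ' hη'
  nlinarith

end LossParams

section Universal

variable {V : Type} [DecidableEq V] {ch : List V → Finset V} {D : V → List V → ℝ}
  {r t κ η ϑ δ Δ β bonus : ℝ}

/-- The bound that holds for all nodes. -/
theorem LossParams.universal (h : LossParams r t κ η ϑ δ Δ β bonus)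
    (hD : ∀ w p, D w p ∈ Set.Icc (0 : ℝ) 1) (N : Finset V) (hN : N.card ≤ 2)
    (R : List V → Prop) (hR : ∀ p, R p → (ch p).card ≤ 2 ∧ ∀ w ∈ ch p, R (w :: p) ∧ w ∉ p ∧
      r - (η + if w ∈ N then ϑ else 0) ≤ D w p) (n : ℕ) (p : List V) (hp : R p) :
    t ^ 2 - (δ + (N \ p.toFinset).card * Δ) - β ^ n ≤ cutProb ch D n p := by
  have ht0 := h.t_pos
  have ht1 := h.t_lt
  have hr0 := h.r_pos
  have hr1 := h.r_lt
  have hδ0 := h.δ_nonneg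
  have hΔ0 := h.Δ_nonneg
  have hη0 := h.η_nonneg
  have hϑ0 := h.ϑ_nonneg
  induction n generalizing p with
  | zero =>
    have : (0 : ℝ) ≤ (N \ p.toFinset).card * Δ := by positivity
    simp only [cutProb, pow_zero]
    nlinarith
  | succ n ih =>
    obtain ⟨hcard, hch⟩ := hR p hp
    set k : ℝ := ((N \ p.toFinset).card : ℝ) with hk
    set e : ℝ := β ^ n with he
    have he0 : 0 ≤ e := pow_nonneg h.β_nonneg n
    have hk0 : 0 ≤ k := Nat.cast_nonneg _
    have hk2 : k ≤ 2 := by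
      have := (Finset.card_le_card (Finset.sdiff_subset (s := N) (t := p.toFinset))).trans hN
      rw [hk]
      exact_mod_cast this
    have hC : ∀ p, cutProb ch D n p ∈ Set.Icc (0 : ℝ) 1 := cutProb_mem_Icc hD n
    have hkΔ : k * Δ ≤ 2 * Δ := mul_le_mul_of_nonneg_right hk2 hΔ0
    have hkΔ0 : 0 ≤ k * Δ := mul_nonneg hk0 hΔ0
    -- Two children losing `T` each cost `2 t T` in the product; `T` is the largest loss per child
    -- compatible with the claim.
    set T : ℝ := (δ + k * Δ + β * e) / (2 * t) with hT
    have hTt : 2 * t * T = δ + k * Δ + β * e := by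
      rw [hT]; field_simp
    have hT0 : 0 ≤ T := div_nonneg (by nlinarith [mul_nonneg h.β_nonneg he0]) (by linarith)
    have key : ∀ w ∈ ch p, t - T ≤ 1 - (1 - D w p) * (1 - cutProb ch D n (w :: p)) := by
      intro w hw
      obtain ⟨hRw, hwp, hDw⟩ := hch w hw
      have hih := ih (w :: p) hRw
      have hβ := mul_le_mul_of_nonneg_right h.hβ he0
      have hrt := h.t_mul
      -- A child in `N` pays the extra `ϑ`, but it then belongs to the path, so `k` drops by one and
      -- the released `Δ` covers the cost. This can happen at most `N.card` times along a path.
      by_cases hwN : w ∈ N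
      · rw [if_pos hwN] at hDw
        have hk' : ((N \ (w :: p).toFinset).card : ℝ) = k - 1 := by
          have h1 : N \ (w :: p).toFinset = (N \ p.toFinset).erase w := by
            ext v
            simp only [List.toFinset_cons, Finset.mem_sdiff, Finset.mem_insert, Finset.mem_erase,
              not_or]
            tauto
          have h2 : w ∈ N \ p.toFinset := by simp [hwN, hwp]
          rw [h1, Finset.card_erase_of_mem h2, hk, Nat.cast_sub (Finset.card_pos.2 ⟨w, h2⟩)]
          simp
        rw [hk'] at hih
        have hs := h.step (hD w p).2 (by linarith) hDw (hC (w :: p)).2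
          (l := δ + (k - 1) * Δ + e) (by linarith) (e := e) (κ' := κ * (1 - t ^ 2))
          (by linarith [h.hκ])
        refine le_trans ?_ hs
        refine sub_le_sub_left (le_of_mul_le_mul_left ?_ (by linarith : 0 < 2 * t)) t
        rw [hTt]
        have a1 := h.hδ
        have a2 := h.hΔ
        have hk1 : 1 ≤ k := by
          have : (0:ℝ) ≤ ((N \ (w :: p).toFinset).card : ℝ) := Nat.cast_nonneg _
          linarith
        have a3 : 2 * t * ((1 - r) * (δ + (k - 1) * Δ + e) + (η + ϑ) * (κ * (1 - t ^ 2)) +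
            (η + ϑ) * e) = 2 * r * (δ + (k - 1) * Δ) + 2 * t * η * (κ * (1 - t ^ 2)) +
            2 * t * ϑ * (κ * (1 - t ^ 2)) + 2 * t * (1 - r + η + ϑ) * e := by
          linear_combination (2 * (δ + (k - 1) * Δ)) * hrt
        rw [a3]
        have a4 : 0 ≤ (1 - 2 * r) * ((k - 1) * Δ) :=
          mul_nonneg (by linarith) (mul_nonneg (by linarith) hΔ0)
        linarith
      · rw [if_neg hwN, add_zero] at hDw
        have hk' : ((N \ (w :: p).toFinset).card : ℝ) * Δ ≤ k * Δ := by
          refine mul_le_mul_of_nonneg_right ?_ hΔ0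
          rw [hk]
          exact_mod_cast Finset.card_le_card
            (Finset.sdiff_subset_sdiff le_rfl (by simp))
        have hs := h.step (hD w p).2 hη0 hDw (hC (w :: p)).2
          (l := δ + k * Δ + e) (by linarith) (e := e) (κ' := κ * (1 - t ^ 2))
          (by linarith [h.hκ])
        refine le_trans ?_ hs
        refine sub_le_sub_left (le_of_mul_le_mul_left ?_ (by linarith : 0 < 2 * t)) t
        rw [hTt]
        have a1 := h.hδ
        have a3 : 2 * t * ((1 - r) * (δ + k * Δ + e) + η * (κ * (1 - t ^ 2)) +
            η * e) = 2 * r * (δ + k * Δ) + 2 * t * η * (κ * (1 - t ^ 2)) +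
            2 * t * (1 - r + η) * e := by
          linear_combination (2 * (δ + k * Δ)) * hrt
        rw [a3]
        have a4 : 0 ≤ (1 - 2 * r) * (k * Δ) := mul_nonneg (by linarith) hkΔ0
        have a5 : 0 ≤ 2 * t * ϑ * e := by positivity
        linarith
    have hprod := sq_sub_le_prod hcard ht0.le ht1.le (T := fun _ => T)
      (fun w _ => (one_sub_mul_mem_Icc (hD w p) (hC (w :: p))).1) (fun _ _ => hT0) key
    rw [Finset.sum_const, nsmul_eq_mul] at hprod
    have hcard' : ((ch p).card : ℝ) ≤ 2 := by exact_mod_cast hcard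
    have := mul_le_mul_of_nonneg_right hcard' (mul_nonneg ht0.le hT0)
    rw [pow_succ β]
    simp only [cutProb]
    nlinarith

end Universal

end PPSZ

namespace PPSZ

/-! ### Losses along canonical nodes, and the resulting bound at the root -/

section Canonical

variable {V : Type} [DecidableEq V] {F : Finset (Clause V)} {canon : V → Clause V}
  {sel : List V → Clause V} {D η' : V → List V → ℝ} {r t κ η ϑ δ Δ β bonus : ℝ}

open Classical in
/-- The loss of a subtree of height `n`: the sum of the contributions `g * η'` of the canonical
nodes, weighted by powers of `r`. -/
noncomputable def loss (F : Finset (Clause V)) (canon : V → Clause V) (sel : List V → Clause V)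
    (r g : ℝ) (η' : V → List V → ℝ) : ℕ → List V → ℝ
  | 0, _ => 0
  | n + 1, p => ∑ w ∈ (children sel p).filter fun w => IsCanonicalNode F canon sel (w :: p),
      (r * loss F canon sel r g η' n (w :: p) + g * η' w p)

/-- The assumptions on the deletion probabilities `D` of the nodes that satisfy `R`. -/
structure IsDeletion (F : Finset (Clause V)) (canon : V → Clause V) (sel : List V → Clause V)
    (D η' : V → List V → ℝ) (r η ϑ bonus : ℝ) (N : Finset V) (R : List V → Prop) : Prop where
  mem_Icc : ∀ w p, D w p ∈ Set.Icc (0 : ℝ) 1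
  card_le : N.card ≤ 2
  path : ∀ p, R p → p ≠ [] ∧ IsTreePath sel p
  cons : ∀ p, R p → ∀ w ∈ children sel p, R (w :: p)
  lower : ∀ p, R p → ∀ w ∈ children sel p, r - (η + if w ∈ N then ϑ else 0) ≤ D w p
  lower_of_notMem : ∀ p, R p → ∀ w ∈ children sel p, w ∉ TwoCC F →
    r * (1 - η' w p) ≤ D w p ∧ r * η' w p ≤ η + ϑ
  lower_of_mem : ∀ p, R p → ∀ w ∈ children sel p, w ∈ TwoCC F → r + bonus ≤ D w p
  η'_nonneg : ∀ w p, 0 ≤ η' w p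

/-- A single child gives a value near `t`. If `2 t ≥ 1`, the slack `t - t ^ 2` absorbs `τ`; if `2 t
≤ 1`, then `f ≥ 2 t f`, and `2 τ ≤ t` leaves `t ^ 2` in the main term. -/
theorem sq_sub_le_of_single {t f τ B : ℝ} (ht0 : 0 < t) (ht1 : t < 1) (hf : 0 ≤ f) (hB : 0 ≤ B)
    (h1 : 2 * τ ≤ t) (h2 : τ ≤ t - t ^ 2) (h : t - τ - B ≤ f) : t ^ 2 - 2 * t * B ≤ f := by
  rcases le_total 1 (2 * t) with h2t | h2t
  · nlinarith
  · have h3 := mul_le_mul_of_nonneg_left h (by linarith : 0 ≤ 2 * t)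
    nlinarith [mul_le_mul_of_nonneg_left h1 ht0.le, mul_le_mul_of_nonneg_right h2t hf]

theorem loss_nonneg {g : ℝ} (hr : 0 ≤ r) (hg : 0 ≤ g) (hη : ∀ w p, 0 ≤ η' w p) (n : ℕ)
    (p : List V) : 0 ≤ loss F canon sel r g η' n p := by
  induction n generalizing p with
  | zero => exact le_rfl
  | succ n ih =>
    exact Finset.sum_nonneg fun w _ => add_nonneg (mul_nonneg hr (ih _)) (mul_nonneg hg (hη w p))

variable {N : Finset V} {R : List V → Prop}

theorem one_sub_cutProb_le (h : LossParams r t κ η ϑ δ Δ β bonus) (hF : IsThreeCNF F)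
    (hone : OnesUnique F) (hsel : IsClauseLabelling F canon sel)
    (hD : IsDeletion F canon sel D η' r η ϑ bonus N R) (n : ℕ) (p : List V) (hp : R p) :
    t ^ 2 - (δ + 2 * Δ) - β ^ n ≤ cutProb (children sel) D n p := by
  refine le_trans ?_ (h.universal hD.mem_Icc N hD.card_le R (fun p hp => ⟨?_, fun w hw =>
    ⟨hD.cons p hp w hw, hsel.notMem_of_mem_children p w hw, hD.lower p hp w hw⟩⟩) n p hp)
  · have : ((N \ p.toFinset).card : ℝ) ≤ 2 := by
      exact_mod_cast (Finset.card_le_card Finset.sdiff_subset).trans hD.card_le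
    nlinarith [mul_le_mul_of_nonneg_right this h.Δ_nonneg]
  · cases p with
    | nil => exact absurd rfl (hD.path _ hp).1
    | cons a q => exact hsel.card_children_le hF hone a q

/-- The bound for canonical nodes. -/
theorem sub_loss_le_cutProb (h : LossParams r t κ η ϑ δ Δ β bonus) (hF : IsThreeCNF F)
    (hone : OnesUnique F) (hcan : IsCanonicalChoice F canon) (hsel : IsClauseLabelling F canon sel)
    (hD : IsDeletion F canon sel D η' r η ϑ bonus N R) (n : ℕ) (p : List V) (hp : R p)
    (hc : IsCanonicalNode F canon sel p) :
    t ^ 2 - loss F canon sel r (r * (t * (κ * (1 - t ^ 2)))) η' n p - β ^ n ≤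
      cutProb (children sel) D n p := by
  classical
  have ht0 := h.t_pos
  have ht1 := h.t_lt
  have hr0 := h.r_pos
  have hr1 := h.r_lt
  have hδ0 := h.δ_nonneg
  have hΔ0 := h.Δ_nonneg
  have hη0 := h.η_nonneg
  have hϑ0 := h.ϑ_nonneg
  have hb0 := h.bonus_nonneg
  set G : ℝ := κ * (1 - t ^ 2) with hG
  have hG0 : 0 ≤ G := by have := h.hκ; nlinarith
  induction n generalizing p with
  | zero =>
    simp only [cutProb, loss, pow_zero]
    nlinarith
  | succ n ih =>
    obtain ⟨hpne, hpath⟩ := hD.path p hp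
    obtain ⟨a, q, rfl⟩ := List.exists_cons_of_ne_nil hpne
    set p := a :: q with hpdef
    set e : ℝ := β ^ n with he
    have he0 : 0 ≤ e := pow_nonneg h.β_nonneg n
    have hC : ∀ p, cutProb (children sel) D n p ∈ Set.Icc (0 : ℝ) 1 := cutProb_mem_Icc hD.mem_Icc n
    have hun : ∀ w ∈ children sel p,
        t ^ 2 - (δ + 2 * Δ) - e ≤ cutProb (children sel) D n (w :: p) := fun w hw =>
      one_sub_cutProb_le h hF hone hsel hD n _ (hD.cons p hp w hw)
    have hκ := h.hκ
    have hrt := h.t_mul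
    set B : ℝ := β * e / (2 * t) with hB
    have hBt : 2 * t * B = β * e := by rw [hB]; field_simp
    have hB0 : 0 ≤ B := div_nonneg (mul_nonneg h.β_nonneg he0) (by linarith)
    have hβ : (1 - r + η + ϑ) * e ≤ B := by
      have := mul_le_mul_of_nonneg_right h.hβ he0
      refine le_of_mul_le_mul_left ?_ (by linarith : 0 < 2 * t)
      rw [hBt]
      linarith
    -- With a canonical clause label, the children outside `TwoCC` are canonical and fall under
    -- induction. With any other label no child is canonical, so `loss` vanishes; there is at most
    -- one child, and the universal bound suffices for it.
    by_cases hs : sel p = canon a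
    · have hcanon : ∀ w, IsCanonicalNode F canon sel (w :: p) ↔ w ∉ TwoCC F := fun w => by
        rw [hpdef, isCanonicalNode_cons]
        exact ⟨fun h => h.2.1, fun h => ⟨hc, h, hs⟩⟩
      set T : V → ℝ := fun w => (if IsCanonicalNode F canon sel (w :: p) then
        (1 - r) * loss F canon sel r (r * (t * G)) η' n (w :: p) + r * η' w p * G else 0) + B
      have hl0 : ∀ p, 0 ≤ loss F canon sel r (r * (t * G)) η' n p := loss_nonneg hr0.le
        (by positivity) hD.η'_nonneg n
      have key : ∀ w ∈ children sel p,
          t - T w ≤ 1 - (1 - D w p) * (1 - cutProb (children sel) D n (w :: p)) := by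
        intro w hw
        have hunw := hun w hw
        by_cases hw2 : w ∈ TwoCC F
        · simp only [T, if_neg (fun h => (hcanon w).1 h hw2)]
          -- The bonus in the deletion probability outweighs the universal loss `δ + 2 Δ` of the
          -- whole subtree, by `hbonus`; only the height error remains.
          have hDw := hD.lower_of_mem p hp w hw hw2
          have e1 : (1 - D w p) * (1 - cutProb (children sel) D n (w :: p)) ≤
              (1 - D w p) * (1 - t ^ 2 + (δ + 2 * Δ) + e) :=
            mul_le_mul_of_nonneg_left (by linarith) (by linarith [(hD.mem_Icc w p).2])
          have e2 : (1 - D w p) * (1 - t ^ 2 + (δ + 2 * Δ) + e) ≤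
              (1 - (r + bonus)) * (1 - t ^ 2 + (δ + 2 * Δ) + e) :=
            mul_le_mul_of_nonneg_right (by linarith) (by nlinarith)
          have e3 := h.hbonus
          have e4 : 0 ≤ bonus * (δ + 2 * Δ) := by positivity
          have e5 : 0 ≤ bonus * e := by positivity
          have e6 : (1 - r) * (1 - t ^ 2) = 1 - t := by nlinarith
          nlinarith [mul_nonneg hη0 he0, mul_nonneg hϑ0 he0]
        · have hcw := (hcanon w).2 hw2
          simp only [T, if_pos hcw]
          obtain ⟨d1, d2⟩ := hD.lower_of_notMem p hp w hw hw2
          have hih := ih (w :: p) (hD.cons p hp w hw) hcw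
          have hs := h.step (hD.mem_Icc w p).2 (η' := r * η' w p)
            (mul_nonneg hr0.le (hD.η'_nonneg w p)) (by linarith) (hC (w :: p)).2
            (l := loss F canon sel r (r * (t * G)) η' n (w :: p) + e) (by linarith)
            (e := e) (κ' := G) (by linarith)
          refine le_trans ?_ hs
          have := mul_le_mul_of_nonneg_right d2 he0
          linarith
      have hprod := sq_sub_le_prod (hsel.card_children_le hF hone a q) ht0.le ht1.le
        (fun w _ => (one_sub_mul_mem_Icc (hD.mem_Icc w p) (hC (w :: p))).1)
        (fun w _ => by
          simp only [T]
          refine add_nonneg ?_ hB0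
          split_ifs
          · exact add_nonneg (mul_nonneg (by linarith) (hl0 _))
              (mul_nonneg (mul_nonneg hr0.le (hD.η'_nonneg w p)) hG0)
          · exact le_rfl) key
      refine le_trans ?_ hprod
      simp only [T]
      rw [Finset.sum_add_distrib, ← Finset.sum_filter, Finset.sum_const, nsmul_eq_mul, loss,
        mul_add, Finset.mul_sum, pow_succ β]
      have h1 : ∑ w ∈ (children sel p).filter (fun w => IsCanonicalNode F canon sel (w :: p)),
          (r * loss F canon sel r (r * (t * G)) η' n (w :: p) + r * (t * G) * η' w p) =
          ∑ w ∈ (children sel p).filter (fun w => IsCanonicalNode F canon sel (w :: p)),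
          t * ((1 - r) * loss F canon sel r (r * (t * G)) η' n (w :: p) + r * η' w p * G) := by
        refine Finset.sum_congr rfl fun w _ => ?_
        linear_combination (-loss F canon sel r (r * (t * G)) η' n (w :: p)) * hrt
      rw [h1]
      have h2 : ((children sel p).card : ℝ) ≤ 2 := by
        exact_mod_cast hsel.card_children_le hF hone a q
      have h3 := mul_le_mul_of_nonneg_right h2 (mul_nonneg ht0.le hB0)
      linarith
    · have hle : (children sel p).card ≤ 1 :=
        hsel.card_children_le_one hF hone hcan hpath hc hs
      have hloss : loss F canon sel r (r * (t * G)) η' (n + 1) p = 0 := by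
        rw [loss]
        refine Finset.sum_eq_zero fun w hw => absurd ?_ hs
        have := (Finset.mem_filter.1 hw).2
        rw [hpdef, isCanonicalNode_cons] at this
        exact this.2.2
      rw [hloss, sub_zero, cutProb, pow_succ β, ← he]
      have hβe : 0 ≤ e * β := mul_nonneg he0 h.β_nonneg
      have hcc : (children sel p).card = 0 ∨ (children sel p).card = 1 := by omega
      rcases hcc with hw | hw
      · rw [Finset.card_eq_zero.1 hw, Finset.prod_empty]
        have := mul_pos ht0 ht0
        have := mul_lt_mul ht1 ht1.le ht0 zero_le_one
        linarith
      · obtain ⟨w, hw⟩ := Finset.card_eq_one.1 hw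
        rw [hw, Finset.prod_singleton]
        have hwm : w ∈ children sel p := by rw [hw]; exact Finset.mem_singleton_self w
        have hunw := hun w hwm
        have hDw : r - (η + ϑ) ≤ D w p := by
          have := hD.lower p hp w hwm
          split_ifs at this <;> linarith
        have hs := h.step (hD.mem_Icc w p).2 (η' := η + ϑ) (by linarith) hDw (hC (w :: p)).2
          (l := δ + 2 * Δ + e) (by linarith) (e := e) (κ' := G) (by linarith)
        have h0 := (one_sub_mul_mem_Icc (hD.mem_Icc w p) (hC (w :: p))).1
        rw [mul_comm e β, ← hBt]
        exact sq_sub_le_of_single ht0 ht1 h0 hB0 h.hone₁ h.hone₂ (by linarith)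

end Canonical

/-- The correction decreases in `a`, but the total does not: the slope is `(1 - d) τ - r (1 - r) l
s`, where `τ ≥ d' ≥ r (1 - ηz) ≥ r l` and `d ≤ r`. -/
theorem root_mono {r l d d' a b a' s ηz : ℝ} (hr0 : 0 ≤ r) (hr1 : r ≤ 1) (hd : d ≤ r)
    (hd' : r * (1 - ηz) ≤ d') (hd'1 : d' ≤ 1) (hb0 : 0 ≤ b) (hl0 : 0 ≤ l)
    (hl : l + ηz ≤ 1) (hs1 : s ≤ 1) (haa : a ≤ a') :
    (1 - (1 - d) * (1 - a)) * (1 - (1 - d') * (1 - b)) + r * (1 - r) * l * ((1 - a) * s) ≤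
      (1 - (1 - d) * (1 - a')) * (1 - (1 - d') * (1 - b)) + r * (1 - r) * l * ((1 - a') * s) := by
  set τ := 1 - (1 - d') * (1 - b)
  have h1 : d' ≤ τ := by nlinarith [mul_nonneg (sub_nonneg.2 hd'1) hb0]
  have h2 : r * l ≤ τ := by nlinarith
  have h3 : (1 - r) * (r * l) ≤ (1 - d) * τ :=
    mul_le_mul (by linarith) h2 (mul_nonneg hr0 hl0) (by linarith)
  have h4 : r * (1 - r) * l * s ≤ r * (1 - r) * l :=
    mul_le_of_le_one_right (mul_nonneg (mul_nonneg hr0 (by linarith)) hl0) hs1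
  nlinarith [mul_nonneg (sub_nonneg.2 haa) (sub_nonneg.2 (h4.trans (le_trans (by linarith) h3)))]

/-- The bound at the root; `l` is the probability that the two children are identified. -/
theorem LossParams.root {r t κ η ϑ δ Δ β bonus : ℝ} (h : LossParams r t κ η ϑ δ Δ β bonus)
    {e l dy dz αy αz ηy ηz ly lz : ℝ} (he : 0 ≤ e) (hl0 : 0 ≤ l) (hly : l + ηy ≤ 1)
    (hlz : l + ηz ≤ 1) (hdy : dy ≤ r) (hdz : dz ≤ r) (hdy' : r * (1 - ηy) ≤ dy)
    (hdz' : r * (1 - ηz) ≤ dz) (hdy0 : 0 ≤ dy) (hdz0 : 0 ≤ dz) (hηy : 0 ≤ ηy) (hηz : 0 ≤ ηz)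
    (hηy' : r * ηy ≤ η + ϑ) (hηz' : r * ηz ≤ η + ϑ)
    (hαy : αy ∈ Set.Icc (0 : ℝ) 1) (hαz : αz ∈ Set.Icc (0 : ℝ) 1) (hly0 : 0 ≤ ly) (hlz0 : 0 ≤ lz)
    (hy : t ^ 2 - ly - e ≤ αy) (hz : t ^ 2 - lz - e ≤ αz)
    (hy' : t ^ 2 - (δ + 2 * Δ) - e ≤ αy) (hz' : t ^ 2 - (δ + 2 * Δ) - e ≤ αz) :
    t ^ 2 - (r * ly + r * (t * (κ * (1 - t ^ 2))) * ηy) -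
        (r * lz + r * (t * (κ * (1 - t ^ 2))) * ηz) - β * e +
        r * (1 - r) * l * (1 - t ^ 2) ^ 2 ≤
      (1 - (1 - dy) * (1 - αy)) * (1 - (1 - dz) * (1 - αz)) +
        r * (1 - r) * l * ((1 - αy) * (1 - αz)) := by
  have ht0 := h.t_pos
  have ht1 := h.t_lt
  have hr0 := h.r_pos
  have hr1 := h.r_lt
  have hδ0 := h.δ_nonneg
  have hΔ0 := h.Δ_nonneg
  have hrt := h.t_mul
  have hκ := h.hκ
  set G : ℝ := κ * (1 - t ^ 2) with hG
  have hQ1 : t ^ 2 < 1 := by nlinarith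
  have hG0 : 0 ≤ G := by linarith
  have hQ0 : 0 ≤ t ^ 2 := sq_nonneg t
  -- Truncation at the ideal value only lowers the expression, by two applications of `root_mono`,
  -- and it makes the correction at least its ideal size `(1 - t ^ 2) ^ 2`.
  set a := min αy (t ^ 2)
  set b := min αz (t ^ 2)
  have ha0 : 0 ≤ a := le_min hαy.1 hQ0
  have hb0 : 0 ≤ b := le_min hαz.1 hQ0
  have haQ : a ≤ t ^ 2 := min_le_right _ _
  have hbQ : b ≤ t ^ 2 := min_le_right _ _
  have s1 := root_mono (s := 1 - αz) (b := αz) hr0.le (by linarith) hdy hdz' (by linarith) hαz.1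
    hl0 hlz (by linarith [hαz.1]) (min_le_left αy (t ^ 2))
  have s2 := root_mono (s := 1 - a) (b := a) hr0.le (by linarith) hdz hdy' (by linarith) ha0
    hl0 hly (by linarith) (min_le_left αz (t ^ 2))
  have hgain : r * (1 - r) * l * (1 - t ^ 2) ^ 2 ≤ r * (1 - r) * l * ((1 - a) * (1 - b)) := by
    refine mul_le_mul_of_nonneg_left ?_
      (mul_nonneg (mul_nonneg hr0.le (by linarith)) hl0)
    rw [sq]
    exact mul_le_mul (by linarith) (by linarith) (by linarith) (by linarith)
  set B : ℝ := β * e / (2 * t) with hB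
  have hBt : 2 * t * B = β * e := by rw [hB]; field_simp
  have hB0 : 0 ≤ B := div_nonneg (mul_nonneg h.β_nonneg he) (by linarith)
  have hβ : (1 - r + η + ϑ) * e ≤ B := by
    have := mul_le_mul_of_nonneg_right h.hβ he
    refine le_of_mul_le_mul_left ?_ (by linarith : 0 < 2 * t)
    rw [hBt]
    linarith
  have key : ∀ {d α ηw lw : ℝ}, d ≤ r → r * (1 - ηw) ≤ d → 0 ≤ ηw → r * ηw ≤ η + ϑ →
      0 ≤ lw → t ^ 2 - lw - e ≤ α → t ^ 2 - (δ + 2 * Δ) - e ≤ α →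
      t - ((1 - r) * lw + r * ηw * G + B) ≤ 1 - (1 - d) * (1 - min α (t ^ 2)) := by
    intro d α ηw lw h1 h2 h3 h4 h5 h6 h7
    have m1 : t ^ 2 - lw - e ≤ min α (t ^ 2) := le_min h6 (by linarith)
    have m2 : t ^ 2 - (δ + 2 * Δ) - e ≤ min α (t ^ 2) := le_min h7 (by linarith)
    have m3 : min α (t ^ 2) ≤ 1 := (min_le_right _ _).trans hQ1.le
    have hs := h.step (D := d) (by linarith) (η' := r * ηw) (mul_nonneg hr0.le h3) (by linarith) m3
      (l := lw + e) (by linarith) (e := e) (κ' := G) (by linarith)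
    refine le_trans ?_ hs
    have := mul_le_mul_of_nonneg_right h4 he
    linarith
  have ky := key hdy hdy' hηy hηy' hly0 hy hy'
  have kz := key hdz hdz' hηz hηz' hlz0 hz hz'
  set fy := 1 - (1 - dy) * (1 - a) with hfy
  set fz := 1 - (1 - dz) * (1 - b) with hfz
  have hfy0 : 0 ≤ fy := (one_sub_mul_mem_Icc ⟨hdy0, by linarith⟩ ⟨ha0, by linarith⟩).1
  have hfz0 : 0 ≤ fz := (one_sub_mul_mem_Icc ⟨hdz0, by linarith⟩ ⟨hb0, by linarith⟩).1
  have hr' : 0 ≤ 1 - r := by linarith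
  have c1 : 0 ≤ (1 - r) * ly + r * ηy * G + B :=
    add_nonneg (add_nonneg (mul_nonneg hr' hly0) (mul_nonneg (mul_nonneg hr0.le hηy) hG0)) hB0
  have c2 : 0 ≤ (1 - r) * lz + r * ηz * G + B :=
    add_nonneg (add_nonneg (mul_nonneg hr' hlz0) (mul_nonneg (mul_nonneg hr0.le hηz) hG0)) hB0
  have hp := sq_sub_le_mul ht0.le hfy0 hfz0 c1 c2 ky kz
  have e1 : t * ((1 - r) * ly + r * ηy * G + B + ((1 - r) * lz + r * ηz * G + B)) =
      (r * ly + r * (t * G) * ηy) + (r * lz + r * (t * G) * ηz) + β * e := by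
    linear_combination (ly + lz) * hrt + hBt
  rw [e1] at hp
  linarith

end PPSZ

namespace PPSZ

/-! ### The densities -/

/-- For negative `x` the real power carries the factor `cos (3π/2) = 0`, just as `√x = 0`. Thus one
formula describes `γ` on both sides of `1/2`. -/
theorem rpow_three_halves (x : ℝ) : x ^ (3 / 2 : ℝ) = x * √x := by
  rcases lt_or_ge x 0 with h | h
  · rw [Real.rpow_def_of_neg h, Real.sqrt_eq_zero_of_nonpos h.le,
      show (3 / 2 : ℝ) * Real.pi = Real.pi / 2 + Real.pi by ring, Real.cos_add_pi,
      Real.cos_pi_div_two]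
    simp
  · rw [show (3 / 2 : ℝ) = 1 + 1 / 2 by norm_num, Real.rpow_add_of_nonneg h (by norm_num)
      (by norm_num), Real.rpow_one, Real.sqrt_eq_rpow]

theorem gamma_eq (r : ℝ) : PPSZ.gamma r = r * ((1 - 2 * r) * √(1 - 2 * r)) := by
  unfold PPSZ.gamma
  split_ifs with h
  · rw [rpow_three_halves]
  · rw [Real.sqrt_eq_zero_of_nonpos (by linarith)]
    simp

theorem hasDerivAt_gamma (r : ℝ) : HasDerivAt PPSZ.gamma (√(1 - 2 * r) * (1 - 5 * r)) r := by
  have h1 : HasDerivAt (fun r : ℝ => 1 - 2 * r) (-2) r := by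
    simpa using ((hasDerivAt_id r).const_mul 2).const_sub 1
  have h2 := (Real.hasDerivAt_rpow_const (x := 1 - 2 * r) (p := 3 / 2) (Or.inr (by norm_num))).comp
    r h1
  have h3 := (hasDerivAt_id r).mul h2
  have h4 : PPSZ.gamma = id * ((fun x : ℝ => x ^ (3 / 2 : ℝ)) ∘ fun r => 1 - 2 * r) := by
    funext r
    simp [gamma_eq, rpow_three_halves]
  rw [h4]
  refine h3.congr_deriv ?_
  rw [show (3 / 2 - 1 : ℝ) = 1 / 2 by norm_num, ← Real.sqrt_eq_rpow]
  simp only [Function.comp, rpow_three_halves, id]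
  ring

theorem phi_eq (r : ℝ) : phi r = √(1 - 2 * r) * (1 - 5 * r) := (hasDerivAt_gamma r).deriv

theorem continuous_phi : Continuous phi := by
  rw [show phi = fun r => √(1 - 2 * r) * (1 - 5 * r) from funext phi_eq]
  fun_prop

theorem gamma_of_half_le {r : ℝ} (h : 1 / 2 ≤ r) : PPSZ.gamma r = 0 := by
  rw [gamma_eq, Real.sqrt_eq_zero_of_nonpos (by linarith)]
  simp

theorem phi_of_half_le {r : ℝ} (h : 1 / 2 ≤ r) : phi r = 0 := by
  rw [phi_eq, Real.sqrt_eq_zero_of_nonpos (by linarith)]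
  simp

theorem integral_phi (a b : ℝ) : ∫ t in a..b, phi t = PPSZ.gamma b - PPSZ.gamma a :=
  intervalIntegral.integral_eq_sub_of_hasDerivAt
    (fun t _ => by rw [phi_eq]; exact hasDerivAt_gamma t)
    (continuous_phi.intervalIntegrable _ _)

/-- At the kink the derivative is obtained from the continuity of the function and of the candidate
derivative. -/
theorem hasDerivAt_max_zero_sq (x : ℝ) :
    HasDerivAt (fun x : ℝ => max x 0 ^ 2) (2 * max x 0) x := by
  have key : ∀ y : ℝ, y ≠ 0 → HasDerivAt (fun x : ℝ => max x 0 ^ 2) (2 * max y 0) y := by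
    intro y hy
    rcases lt_or_gt_of_ne hy with h | h
    · rw [max_eq_right h.le, mul_zero]
      refine (hasDerivAt_const y (0 : ℝ)).congr_of_eventuallyEq ?_
      filter_upwards [gt_mem_nhds h] with z hz
      rw [max_eq_right hz.le]
      norm_num
    · rw [max_eq_left h.le]
      have := (hasDerivAt_pow 2 y).congr_of_eventuallyEq (f₁ := fun x : ℝ => max x 0 ^ 2) (by
        filter_upwards [lt_mem_nhds h] with z hz
        rw [max_eq_left hz.le])
      simpa using this
  rcases eq_or_ne x 0 with rfl | hx
  · exact hasDerivAt_of_hasDerivAt_of_ne' (x := 0) (g := fun x => 2 * max x 0) key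
      (by fun_prop) (by fun_prop) 0
  · exact key x hx

theorem gammaTwoCC_eq (r : ℝ) : gammaTwoCC r = 25 * r ^ 3 * max (1 - 2 * r) 0 ^ 2 := by
  unfold gammaTwoCC
  split_ifs with h
  · rw [max_eq_left (by linarith)]
  · rw [max_eq_right (by linarith)]
    simp

theorem hasDerivAt_gammaTwoCC (r : ℝ) : HasDerivAt gammaTwoCC
    (25 * r ^ 2 * max (1 - 2 * r) 0 * (3 * max (1 - 2 * r) 0 - 4 * r)) r := by
  have h1 : HasDerivAt (fun r : ℝ => 1 - 2 * r) (-2) r := by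
    simpa using ((hasDerivAt_id r).const_mul 2).const_sub 1
  have h2 := (hasDerivAt_max_zero_sq (1 - 2 * r)).comp r h1
  have h3 := ((hasDerivAt_pow 3 r).const_mul 25).mul h2
  rw [show gammaTwoCC = _ from funext gammaTwoCC_eq]
  refine h3.congr_deriv ?_
  simp only [Function.comp]
  push_cast
  ring

theorem phiTwoCC_eq (r : ℝ) : phiTwoCC r =
    25 * r ^ 2 * max (1 - 2 * r) 0 * (3 * max (1 - 2 * r) 0 - 4 * r) :=
  (hasDerivAt_gammaTwoCC r).deriv

theorem continuous_phiTwoCC : Continuous phiTwoCC := by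
  rw [show phiTwoCC = _ from funext phiTwoCC_eq]
  fun_prop

theorem integral_phiTwoCC (a b : ℝ) : ∫ t in a..b, phiTwoCC t = gammaTwoCC b - gammaTwoCC a :=
  intervalIntegral.integral_eq_sub_of_hasDerivAt
    (fun t _ => by rw [phiTwoCC_eq]; exact hasDerivAt_gammaTwoCC t)
    (continuous_phiTwoCC.intervalIntegrable _ _)

/-! ### Disintegration along one coordinate -/

/-- Redrawing one coordinate from its own law does not change the product measure. This makes the
position of the root variable an outer integration variable. -/
theorem measurePreserving_update {V : Type} [Fintype V] [DecidableEq V] (x : V) (μ : Measure ℝ)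
    [IsProbabilityMeasure μ] :
    MeasurePreserving (fun q : ℝ × (V → ℝ) => Function.update q.2 x q.1)
      (μ.prod (Measure.pi fun _ => μ)) (Measure.pi fun _ => μ) := by
  have hm : Measurable fun q : ℝ × (V → ℝ) => Function.update q.2 x q.1 := by
    refine measurable_pi_iff.2 fun v => ?_
    rcases eq_or_ne v x with rfl | h
    · simpa using measurable_fst
    · simp only [Function.update_of_ne h]
      exact (measurable_pi_apply v).comp measurable_snd
  refine ⟨hm, (Measure.pi_eq fun s hs => ?_).symm⟩
  rw [Measure.map_apply hm (MeasurableSet.univ_pi hs)]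
  have : (fun q : ℝ × (V → ℝ) => Function.update q.2 x q.1) ⁻¹' Set.univ.pi s =
      s x ×ˢ Set.univ.pi (Function.update s x Set.univ) := by
    ext q
    simp only [Set.mem_preimage, Set.mem_univ_pi, Set.mem_prod]
    constructor
    · intro h
      refine ⟨by simpa using h x, fun v => ?_⟩
      rcases eq_or_ne v x with rfl | hv
      · simp
      · simpa [Function.update_of_ne hv] using h v
    · rintro ⟨h1, h2⟩ v
      rcases eq_or_ne v x with rfl | hv
      · simpa using h1
      · simpa [Function.update_of_ne hv] using h2 v
  rw [this, Measure.prod_prod, Measure.pi_pi, ← Finset.mul_prod_erase _ _ (Finset.mem_univ x),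
    ← Finset.mul_prod_erase (a := x) _ (fun i => μ (s i)) (Finset.mem_univ x)]
  simp only [Function.update_self, measure_univ, one_mul]
  congr 1
  exact Finset.prod_congr rfl fun v hv => by rw [Function.update_of_ne (Finset.ne_of_mem_erase hv)]

/-- A product of functions of the single coordinates, times a function of the set of the
coordinates that are smaller than `r`. -/
theorem integral_prod_mul_comp_decide {V : Type} [Fintype V] [DecidableEq V] (x : V) (μ : Measure ℝ)
    [IsProbabilityMeasure μ] (k : V → ℝ → ℝ) (hk : ∀ v, Integrable (k v) μ) (r : ℝ)
    (f : (V → Bool) → ℝ) :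
    Integrable (fun π : V → ℝ => (∏ v, k v (Function.update π x r v)) *
      f fun v => decide (Function.update π x r v < r)) (Measure.pi fun _ => μ) ∧
    ∫ π, (∏ v, k v (Function.update π x r v)) * f (fun v => decide (Function.update π x r v < r))
      ∂(Measure.pi fun _ : V => μ) =
    ∑ b, f b * ∏ v, if v = x then (if b v then 0 else k x r) else
      ∫ t, (if decide (t < r) = b v then k v t else 0) ∂μ := by
  -- Sum over all bit patterns: only the actual comparison pattern contributes, and each summand is
  -- a product of functions of single coordinates.
  have e1 : ∀ π : V → ℝ, (∏ v, k v (Function.update π x r v)) *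
      f (fun v => decide (Function.update π x r v < r)) =
      ∑ b, f b * ∏ v, (fun t => if v = x then (if b v then 0 else k x r) else
        (if decide (t < r) = b v then k v t else 0)) (π v) := by
    intro π
    rw [Finset.sum_eq_single fun v => decide (Function.update π x r v < r)]
    · rw [mul_comm]
      congr 1
      refine Finset.prod_congr rfl fun v _ => ?_
      rcases eq_or_ne v x with rfl | hv
      · simp
      · simp [hv]
    · intro b _ hb
      obtain ⟨v, hv⟩ : ∃ v, b v ≠ decide (Function.update π x r v < r) := by
        by_contra h
        push Not at h
        exact hb (funext h)
      rw [Finset.prod_eq_zero (Finset.mem_univ v), mul_zero]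
      rcases eq_or_ne v x with rfl | hvx
      · simp at hv
        simp [hv]
      · rw [Function.update_of_ne hvx] at hv
        simp [hvx, Ne.symm hv]
    · simp
  have hi : ∀ (b : V → Bool) (v : V), Integrable (fun t => if v = x then (if b v then 0 else k x r)
      else (if decide (t < r) = b v then k v t else 0)) μ := by
    intro b v
    by_cases hv : v = x
    · simp only [hv, if_true]
      exact integrable_const _
    · simp only [hv, if_false]
      have hs : MeasurableSet {t : ℝ | decide (t < r) = b v} := by
        cases b v
        · convert measurableSet_Ici (a := r) using 1
          ext t
          simp
        · convert measurableSet_Iio (a := r) using 1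
          ext t
          simp
      exact (integrable_indicator_iff hs).2 (hk v).integrableOn |>.congr (by
        refine Eventually.of_forall fun t => ?_
        simp [Set.indicator_apply])
  simp only [e1]
  refine ⟨integrable_finsetSum _ fun b _ => (Integrable.fintype_prod (hi b)).const_mul _, ?_⟩
  rw [integral_finsetSum _ fun b _ => (Integrable.fintype_prod (hi b)).const_mul _]
  refine Finset.sum_congr rfl fun b _ => ?_
  rw [integral_const_mul, integral_fintype_prod_eq_prod fun v t => if v = x then
    (if b v then 0 else k x r) else (if decide (t < r) = b v then k v t else 0)]
  congr 1
  refine Finset.prod_congr rfl fun v _ => ?_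
  by_cases hv : v = x
  · simp [hv]
  · simp [hv]

/-! ### Expansion of the product over the components -/

theorem map_mul_eq_prod {V : Type} [DecidableEq V] {e : Sym2 V} (he : ¬ e.IsDiag) {s : Finset V}
    (hs : ∀ v ∈ e, v ∈ s) (g : V → ℝ) :
    (e.map g).mul = ∏ v ∈ s, if v ∈ e then g v else 1 := by
  induction e with
  | _ u v =>
    have hne : u ≠ v := fun h => he (by simpa using h)
    rw [Sym2.map_mk, Sym2.mul_mk, ← Finset.prod_filter]
    have : s.filter (· ∈ s(u, v)) = {u, v} := by
      ext w
      simp only [Finset.mem_filter, Sym2.mem_iff, Finset.mem_insert, Finset.mem_singleton]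
      refine ⟨fun h => h.2, fun h => ⟨hs w (by simpa using h), h⟩⟩
    rw [this, Finset.prod_pair hne]

-- Here `o` selects nothing or one edge in each component. After this expansion every summand is a
-- product over the coordinates, so Fubini applies.
open Classical in
theorem prod_one_add_sum_map_mul {V C : Type} [Fintype V] [Fintype C]
    (comp : V → C) (E : C → Finset (Sym2 V)) (hdiag : ∀ c, ∀ e ∈ E c, ¬ e.IsDiag)
    (hcomp : ∀ c, ∀ e ∈ E c, ∀ v ∈ e, comp v = c) (ε : ℝ) (g : V → ℝ) :
    ∏ c, (1 + ε * ∑ e ∈ E c, (e.map g).mul) =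
      ∑ o ∈ Fintype.piFinset fun c => (E c).insertNone,
        (∏ c, (o c).elim 1 fun _ => ε) *
          ∏ v, if ∃ e, o (comp v) = some e ∧ v ∈ e then g v else 1 := by
  have h1 : ∀ c, 1 + ε * ∑ e ∈ E c, (e.map g).mul =
      ∑ o ∈ (E c).insertNone, (o.elim 1 fun _ => ε) * o.elim 1 fun e => (e.map g).mul := by
    intro c
    rw [Finset.sum_insertNone]
    simp [Finset.mul_sum]
  simp only [h1]
  rw [Finset.prod_univ_sum]
  refine Finset.sum_congr rfl fun o ho => ?_
  rw [Finset.prod_mul_distrib]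
  congr 1
  rw [← Finset.prod_fiberwise Finset.univ comp]
  refine Finset.prod_congr rfl fun c _ => ?_
  have hoc := Fintype.mem_piFinset.1 ho c
  have h2 : ∏ v with comp v = c, (if ∃ e, o (comp v) = some e ∧ v ∈ e then g v else 1) =
      ∏ v with comp v = c, (if ∃ e, o c = some e ∧ v ∈ e then g v else 1) :=
    Finset.prod_congr rfl fun v hv => by rw [(Finset.mem_filter.1 hv).2]
  rw [h2]
  cases h : o c with
  | none => simp
  | some e =>
    have he : e ∈ E c := by simpa [h] using hoc
    rw [Option.elim_some, map_mul_eq_prod (hdiag c e he)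
      (s := Finset.univ.filter fun v => comp v = c) (fun v hv => by simpa using hcomp c e he v hv)]
    simp

end PPSZ

namespace PPSZ

/-! ### The cut probability as an integral over the position of the root variable -/

instance isProbabilityMeasure_restrict_Icc :
    IsProbabilityMeasure ((volume : Measure ℝ).restrict (Set.Icc 0 1)) :=
  ⟨by simp⟩

theorem integral_ite_decide_lt {k : ℝ → ℝ} {r : ℝ} (hr : r ∈ Set.Icc (0 : ℝ) 1)
    (β : Bool) :
    ∫ t in Set.Icc (0 : ℝ) 1, (if decide (t < r) = β then k t else 0) =
      if β then ∫ t in (0 : ℝ)..r, k t else ∫ t in r..1, k t := by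
  cases β
  · have : (fun t => if decide (t < r) = false then k t else 0) = (Set.Ici r).indicator k := by
      funext t
      rcases lt_or_ge t r with h | h <;> simp [h, h.not_gt]
    rw [this, setIntegral_indicator measurableSet_Ici]
    have h2 : Set.Icc (0 : ℝ) 1 ∩ Set.Ici r = Set.Icc r 1 := by
      ext t
      simp only [Set.mem_inter_iff, Set.mem_Icc, Set.mem_Ici]
      exact ⟨fun h => ⟨h.2, h.1.2⟩, fun h => ⟨⟨hr.1.trans h.1, h.2⟩, h.1⟩⟩
    rw [h2, integral_Icc_eq_integral_Ioc, ← intervalIntegral.integral_of_le hr.2]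
    simp
  · have : (fun t => if decide (t < r) = true then k t else 0) = (Set.Iio r).indicator k := by
      funext t
      by_cases h : t < r <;> simp [h]
    rw [this, setIntegral_indicator measurableSet_Iio]
    have h2 : Set.Icc (0 : ℝ) 1 ∩ Set.Iio r = Set.Ico 0 r := by
      ext t
      simp only [Set.mem_inter_iff, Set.mem_Icc, Set.mem_Iio, Set.mem_Ico]
      exact ⟨fun h => ⟨h.1.1, h.2⟩, fun h => ⟨⟨h.1, h.2.le.trans hr.2⟩, h.2⟩⟩
    rw [h2, integral_Ico_eq_integral_Ioc, ← intervalIntegral.integral_of_le hr.1]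
    simp

section

variable {V : Type} [Fintype V] [DecidableEq V]

open Classical in
/-- The edges of the component `c`. -/
noncomputable def compEdges (G : SimpleGraph V) (c : G.ConnectedComponent) : Finset (Sym2 V) :=
  G.edgeFinset.filter fun e => ∀ v ∈ e, v ∈ c.supp

theorem mem_compEdges {G : SimpleGraph V} {c : G.ConnectedComponent} {e : Sym2 V} :
    e ∈ compEdges G c ↔ e ∈ G.edgeSet ∧ ∀ v ∈ e, G.connectedComponentMk v = c := by
  simp [compEdges]

theorem not_isDiag_of_mem_compEdges {G : SimpleGraph V} {c : G.ConnectedComponent} {e : Sym2 V}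
    (h : e ∈ compEdges G c) : ¬ e.IsDiag := G.not_isDiag_of_mem_edgeSet (mem_compEdges.1 h).1

open Classical in
/-- The probability that `v` is placed before `x`, given that `x` is placed at `r`. -/
noncomputable def placedBefore (F : Finset (Clause V)) (ε : ℝ) (x : V) (r : ℝ) (v : V) : ℝ :=
  if v = x then 0 else if v ∈ TwoCC F then r + ε * gammaTwoCC r else r

/-- The conditional expectation of `φ (π v)`, given that `x` is placed at `r` and that `v` is
placed before or after `x`, as told by `b`. -/
noncomputable def meanPhi (x : V) (r : ℝ) (b : V → Bool) (v : V) : ℝ :=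
  if v = x then phi r else if b v then PPSZ.gamma r / r else -(PPSZ.gamma r / (1 - r))

open Classical in
/-- The probability of the cut event, given that `x` is placed at `r`. -/
noncomputable def condCutProb (F : Finset (Clause V)) (sel : List V → Clause V)
    (G : SimpleGraph V) (ε : ℝ) (h : ℕ) (x : V) (r : ℝ) : ℝ :=
  bexp (placedBefore F ε x r) fun b => cutInd sel h x b *
    ∏ c : G.ConnectedComponent, (1 + ε * ∑ e ∈ compEdges G c, (e.map (meanPhi x r b)).mul)

omit [Fintype V] in
theorem measurableSet_cutEvent (sel : List V → Clause V) (h : ℕ) (x : V) :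
    MeasurableSet (cutEvent sel h x) := by
  have : cutEvent sel h x =
      ⋂ p ∈ nodesAt sel x h, ⋃ v ∈ {v | v ∈ p.dropLast}, {π : V → ℝ | π v < π x} := by
    ext π
    simp [cutEvent]
  rw [this]
  refine Finset.measurableSet_biInter _ fun p _ => ?_
  refine MeasurableSet.biUnion (List.finite_toSet _).countable fun v _ => ?_
  exact measurableSet_lt (measurable_pi_apply v) (measurable_pi_apply x)

omit [Fintype V] in
theorem cutInd_decide (sel : List V → Clause V) (h : ℕ) (x : V) (π : V → ℝ) :
    cutInd sel h x (fun v => decide (π v < π x)) = (cutEvent sel h x).indicator 1 π := by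
  simp only [cutInd, Set.indicator_apply, cutEvent, Set.mem_ofPred_eq, decide_eq_true_eq,
    Pi.one_apply]

open Classical in
/-- The factor of the coordinate `v` in the summand `o` of the expanded density. -/
noncomputable def densityFactor (F : Finset (Clause V)) (G : SimpleGraph V) (ε : ℝ)
    (o : G.ConnectedComponent → Option (Sym2 V)) (v : V) (t : ℝ) : ℝ :=
  if v ∈ TwoCC F then 1 + ε * phiTwoCC t
  else if ∃ e, o (G.connectedComponentMk v) = some e ∧ v ∈ e then phi t else 1

omit [Fintype V] in
theorem continuous_densityFactor (F : Finset (Clause V)) (G : SimpleGraph V) (ε : ℝ)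
    (o : G.ConnectedComponent → Option (Sym2 V)) (v : V) :
    Continuous (densityFactor F G ε o v) := by
  unfold densityFactor
  split_ifs
  · exact continuous_const.add (continuous_const.mul continuous_phiTwoCC)
  · exact continuous_phi
  · exact continuous_const

variable {F : Finset (Clause V)} {G : SimpleGraph V}

/-- The index set of the expanded density. -/
noncomputable def densityIndex (G : SimpleGraph V) :
    Finset (G.ConnectedComponent → Option (Sym2 V)) :=
  open Classical in Fintype.piFinset fun c => (compEdges G c).insertNone

theorem notMem_twoCC_of_mem_densityIndex (hG : ∀ a b, G.Adj a b → a ∉ TwoCC F)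
    {o : G.ConnectedComponent → Option (Sym2 V)} (ho : o ∈ densityIndex G) {v : V} {e : Sym2 V}
    (h : o (G.connectedComponentMk v) = some e) (hv : v ∈ e) : v ∉ TwoCC F := by
  classical
  have h1 := Fintype.mem_piFinset.1 ho (G.connectedComponentMk v)
  rw [h] at h1
  have h2 := (mem_compEdges.1 (Finset.some_mem_insertNone.1 h1)).1
  obtain ⟨w, rfl⟩ := Sym2.mem_iff_exists.1 hv
  exact hG v w h2

open Classical in
theorem placementDensity_eq_sum (hG : ∀ a b, G.Adj a b → a ∉ TwoCC F) (ε : ℝ) (π : V → ℝ) :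
    placementDensity F G ε π = ∑ o ∈ densityIndex G, (∏ c, (o c).elim 1 fun _ => ε) *
      ∏ v, densityFactor F G ε o v (π v) := by
  have h1 := prod_one_add_sum_map_mul G.connectedComponentMk (compEdges G)
    (fun c e he => not_isDiag_of_mem_compEdges he) (fun c e he => (mem_compEdges.1 he).2) ε
    fun v => phi (π v)
  unfold placementDensity
  simp only [compEdges] at h1
  rw [h1, Finset.sum_mul]
  refine Finset.sum_congr rfl fun o ho => ?_
  rw [mul_assoc, Finset.prod_filter, ← Finset.prod_mul_distrib]
  congr 1
  refine Finset.prod_congr rfl fun v _ => ?_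
  unfold densityFactor
  by_cases hv : v ∈ TwoCC F
  · rw [if_neg fun ⟨e, he, hve⟩ => notMem_twoCC_of_mem_densityIndex hG ho he hve hv]
    simp [hv]
  · simp [hv]

open Classical in
theorem condCutProb_eq_sum (sel : List V → Clause V) (h : ℕ) (x : V) (r : ℝ) (ε : ℝ) :
    condCutProb F sel G ε h x r = ∑ o ∈ densityIndex G, (∏ c, (o c).elim 1 fun _ => ε) *
      ∑ b, cutInd sel h x b * ∏ v,
        (if ∃ e, o (G.connectedComponentMk v) = some e ∧ v ∈ e then meanPhi x r b v else 1) *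
          (if b v then placedBefore F ε x r v else 1 - placedBefore F ε x r v) := by
  have h1 := fun b => prod_one_add_sum_map_mul G.connectedComponentMk (compEdges G)
    (fun c e he => not_isDiag_of_mem_compEdges he) (fun c e he => (mem_compEdges.1 he).2) ε
    (meanPhi x r b)
  unfold condCutProb bexp
  simp only [h1]
  simp only [Finset.mul_sum, Finset.sum_mul]
  rw [Finset.sum_comm]
  refine Finset.sum_congr rfl fun o ho => Finset.sum_congr rfl fun b _ => ?_
  rw [Finset.prod_mul_distrib]
  ring_nf

/-- Since `γ` vanishes at `0` and at `1`, the integrals of `γ'` over `[0, r]` and `[r, 1]` are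
`γ(r)` and `-γ(r)`, which is probability times conditional mean. For `TwoCC` variables the same
computation yields the shifted probability. -/
theorem integral_densityFactor (hG : ∀ a b, G.Adj a b → a ∉ TwoCC F) {ε : ℝ}
    {o : G.ConnectedComponent → Option (Sym2 V)} (ho : o ∈ densityIndex G) {x : V}
    (hx : x ∉ TwoCC F) {r : ℝ} (hr : r ∈ Set.Icc (0 : ℝ) 1) (b : V → Bool) (v : V) :
    (if v = x then (if b v then 0 else densityFactor F G ε o x r) else
      ∫ t in Set.Icc (0 : ℝ) 1, (if decide (t < r) = b v then densityFactor F G ε o v t else 0)) =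
    open Classical in
    (if ∃ e, o (G.connectedComponentMk v) = some e ∧ v ∈ e then meanPhi x r b v else 1) *
      (if b v then placedBefore F ε x r v else 1 - placedBefore F ε x r v) := by
  classical
  by_cases hv : v = x
  · subst hv
    cases hb : b v <;> simp [densityFactor, hx, meanPhi, placedBefore]
  rw [if_neg hv, integral_ite_decide_lt hr]
  by_cases h2 : v ∈ TwoCC F
  · have hn : ¬ ∃ e, o (G.connectedComponentMk v) = some e ∧ v ∈ e :=
      fun ⟨e, he, hve⟩ => notMem_twoCC_of_mem_densityIndex hG ho he hve h2
    rw [if_neg hn, one_mul]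
    have e1 : ∀ a b : ℝ, ∫ t in a..b, densityFactor F G ε o v t =
        b - a + ε * (gammaTwoCC b - gammaTwoCC a) := by
      intro a b
      simp only [densityFactor, h2, if_true]
      rw [intervalIntegral.integral_add intervalIntegrable_const
        ((continuous_phiTwoCC.intervalIntegrable a b).const_mul ε),
        intervalIntegral.integral_const_mul, integral_phiTwoCC]
      simp
    rw [e1, e1]
    have e2 : gammaTwoCC 0 = 0 := by simp [gammaTwoCC]
    have e3 : gammaTwoCC 1 = 0 := by norm_num [gammaTwoCC]
    rw [e2, e3]
    cases hb : b v
    · simp [placedBefore, hv, h2]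
      ring
    · simp [placedBefore, hv, h2]
  by_cases h3 : ∃ e, o (G.connectedComponentMk v) = some e ∧ v ∈ e
  · rw [if_pos h3]
    have e1 : ∀ a b : ℝ, ∫ t in a..b, densityFactor F G ε o v t =
        PPSZ.gamma b - PPSZ.gamma a := by
      intro a b
      simp only [densityFactor, h2, h3, if_true, if_false]
      exact integral_phi a b
    rw [e1, e1]
    have e2 : PPSZ.gamma 0 = 0 := by simp [PPSZ.gamma]
    have e3 : PPSZ.gamma 1 = 0 := gamma_of_half_le (by norm_num)
    rw [e2, e3]
    cases hb : b v
    · simp only [placedBefore, hv, h2, meanPhi, hb, if_false, Bool.false_eq_true]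
      -- At `r = 1`, and at `r = 0` below, the conditional mean involves a division by zero; both
      -- sides vanish there because `γ` does.
      rcases eq_or_ne (1 - r) 0 with h | h
      · have : r = 1 := by linarith
        subst this
        simp [e3]
      · field_simp
        ring
    · simp only [placedBefore, hv, h2, meanPhi, hb, if_false, if_true]
      rcases eq_or_ne r 0 with h | h
      · subst h
        simp [e2]
      · field_simp
        ring
  · rw [if_neg h3]
    have e1 : ∀ a b : ℝ, ∫ t in a..b, densityFactor F G ε o v t = b - a := by
      intro a b
      simp only [densityFactor, h2, h3, if_false]
      simp
    rw [e1, e1]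
    cases hb : b v <;> simp [placedBefore, hv, h2]

theorem integrable_prod_densityFactor (o : G.ConnectedComponent → Option (Sym2 V)) (ε : ℝ) :
    Integrable (fun π : V → ℝ => ∏ v, densityFactor F G ε o v (π v))
      (Measure.pi fun _ : V => (volume : Measure ℝ).restrict (Set.Icc 0 1)) :=
  Integrable.fintype_prod fun v =>
    (continuous_densityFactor F G ε o v).continuousOn.integrableOn_compact isCompact_Icc

theorem integrable_placementDensity (hG : ∀ a b, G.Adj a b → a ∉ TwoCC F) (ε : ℝ) :
    Integrable (placementDensity F G ε)
      (Measure.pi fun _ : V => (volume : Measure ℝ).restrict (Set.Icc 0 1)) := by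
  classical
  rw [show placementDensity F G ε = _ from funext (placementDensity_eq_sum hG ε)]
  exact integrable_finsetSum _ fun o _ => (integrable_prod_densityFactor o ε).const_mul _

theorem integral_update_placementDensity (hG : ∀ a b, G.Adj a b → a ∉ TwoCC F) (ε : ℝ)
    (sel : List V → Clause V) (h : ℕ) {x : V} (hx : x ∉ TwoCC F) {r : ℝ}
    (hr : r ∈ Set.Icc (0 : ℝ) 1) :
    ∫ π, (cutEvent sel h x).indicator (placementDensity F G ε) (Function.update π x r)
      ∂(Measure.pi fun _ : V => (volume : Measure ℝ).restrict (Set.Icc 0 1)) =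
    condCutProb F sel G ε h x r := by
  classical
  have e1 : ∀ π : V → ℝ, (cutEvent sel h x).indicator (placementDensity F G ε)
      (Function.update π x r) = ∑ o ∈ densityIndex G, (∏ c, (o c).elim 1 fun _ => ε) *
        ((∏ v, densityFactor F G ε o v (Function.update π x r v)) *
          cutInd sel h x fun v => decide (Function.update π x r v < r)) := by
    intro π
    have := cutInd_decide sel h x (Function.update π x r)
    rw [Function.update_self] at this
    rw [this]
    simp only [← mul_assoc]
    rw [← Finset.sum_mul, ← placementDensity_eq_sum hG]
    by_cases hc : Function.update π x r ∈ cutEvent sel h x <;> simp [hc]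
  have key := fun o => integral_prod_mul_comp_decide x
    ((volume : Measure ℝ).restrict (Set.Icc 0 1)) (densityFactor F G ε o)
    (fun v => (continuous_densityFactor F G ε o v).continuousOn.integrableOn_compact
      isCompact_Icc) r (cutInd sel h x)
  simp only [e1]
  rw [integral_finsetSum _ fun o _ => (key o).1.const_mul _, condCutProb_eq_sum]
  refine Finset.sum_congr rfl fun o ho => ?_
  rw [integral_const_mul, (key o).2]
  congr 1
  refine Finset.sum_congr rfl fun b _ => ?_
  congr 1
  exact Finset.prod_congr rfl fun v _ => integral_densityFactor hG ho hx hr b v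

theorem integral_condCutProb_le (hG : ∀ a b, G.Adj a b → a ∉ TwoCC F) (ε : ℝ)
    (sel : List V → Clause V) (h : ℕ) {x : V} (hx : x ∉ TwoCC F) :
    IntegrableOn (condCutProb F sel G ε h x) (Set.Icc 0 1) ∧
    ∫ r in Set.Icc (0 : ℝ) 1, condCutProb F sel G ε h x r ≤
      (placementDist F G ε).real (cutEvent sel h x) := by
  have hms := measurableSet_cutEvent sel h x
  have hint := (integrable_placementDensity hG ε).indicator hms
  have mp := measurePreserving_update x ((volume : Measure ℝ).restrict (Set.Icc 0 1))
  have hint2 := mp.integrable_comp_of_integrable hint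
  have ae : ∀ᵐ r ∂(volume : Measure ℝ).restrict (Set.Icc 0 1),
      ∫ π, (cutEvent sel h x).indicator (placementDensity F G ε) (Function.update π x r)
        ∂(Measure.pi fun _ : V => (volume : Measure ℝ).restrict (Set.Icc 0 1)) =
      condCutProb F sel G ε h x r :=
    (ae_restrict_mem measurableSet_Icc).mono fun r hr =>
      integral_update_placementDensity hG ε sel h hx hr
  refine ⟨hint2.integral_prod_left.congr ae, ?_⟩
  rw [← integral_congr_ae ae]
  have e1 := integral_prod _ hint2
  simp only [Function.comp] at e1
  rw [← e1]
  have e2 := integral_map (μ := ((volume : Measure ℝ).restrict (Set.Icc 0 1)).prod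
    (Measure.pi fun _ : V => (volume : Measure ℝ).restrict (Set.Icc 0 1))) mp.measurable.aemeasurable
    (f := (cutEvent sel h x).indicator (placementDensity F G ε))
    (by rw [mp.map_eq]; exact hint.aestronglyMeasurable)
  rw [← e2, mp.map_eq, integral_indicator hms]
  unfold placementDist Measure.real
  -- `ENNReal.ofReal` keeps the positive part of the density, so the measure of the event is at
  -- least the signed integral, and the sign of the density need not be known.
  rw [withDensity_apply _ hms,
    integral_eq_lintegral_pos_part_sub_lintegral_neg_part (integrable_placementDensity hG ε).integrableOn]
  exact sub_le_self _ ENNReal.toReal_nonneg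

end

end PPSZ

namespace PPSZ

/-! ### The conditional cut probability as a mixture -/

/-- The probability that an edge not containing the root variable is identified. -/
noncomputable def idWeight (ε r : ℝ) : ℝ := ε * r * (1 - 2 * r) ^ 3 / (1 - r)

/-- The probability that an edge containing the root variable is identified. -/
noncomputable def rootWeight (ε r : ℝ) : ℝ := ε * (1 - 2 * r) ^ 2 * max (5 * r - 1) 0

open Classical in
/-- The probability that the edge `e` is identified. -/
noncomputable def edgeWeight {V : Type} (ε : ℝ) (x : V) (r : ℝ) (e : Sym2 V) : ℝ :=
  if x ∈ e then rootWeight ε r else idWeight ε r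

theorem idWeight_nonneg {ε r : ℝ} (hε : 0 ≤ ε) (hr0 : 0 ≤ r) (hr1 : r ≤ 1 / 2) :
    0 ≤ idWeight ε r :=
  div_nonneg (mul_nonneg (mul_nonneg hε hr0) (pow_nonneg (by linarith) 3)) (by linarith)

theorem rootWeight_nonneg {ε r : ℝ} (hε : 0 ≤ ε) : 0 ≤ rootWeight ε r :=
  mul_nonneg (mul_nonneg hε (sq_nonneg _)) (le_max_right _ _)

theorem edgeWeight_nonneg {V : Type} {ε r : ℝ} (hε : 0 ≤ ε) (hr0 : 0 ≤ r) (hr1 : r ≤ 1 / 2) (x : V)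
    (e : Sym2 V) : 0 ≤ edgeWeight ε x r e := by
  unfold edgeWeight
  split_ifs
  · exact rootWeight_nonneg hε
  · exact idWeight_nonneg hε hr0 hr1

theorem gamma_sq {r : ℝ} (h : r ≤ 1 / 2) : PPSZ.gamma r ^ 2 = r ^ 2 * (1 - 2 * r) ^ 3 := by
  have := Real.sq_sqrt (show 0 ≤ 1 - 2 * r by linarith)
  rw [gamma_eq]
  linear_combination r ^ 2 * (1 - 2 * r) ^ 2 * this

theorem phi_mul_gamma {r : ℝ} (h : r ≤ 1 / 2) :
    phi r * PPSZ.gamma r = r * (1 - 2 * r) ^ 2 * (1 - 5 * r) := by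
  have := Real.sq_sqrt (show 0 ≤ 1 - 2 * r by linarith)
  rw [gamma_eq, phi_eq]
  linear_combination r * (1 - 2 * r) * (1 - 5 * r) * this

theorem copyKernel_nonneg {V : Type} {p : V → ℝ} (hp : ∀ i, p i ∈ Set.Icc (0 : ℝ) 1) (x : V)
    (e : Sym2 V) (b : V → Bool) : 0 ≤ copyKernel p x e b := by
  unfold copyKernel
  have h1 := (hp (tgt x e)).1
  have h2 := (hp (tgt x e)).2
  split_ifs
  · exact inv_nonneg.2 h1
  · exact inv_nonneg.2 (by linarith)
  · exact le_rfl

theorem src_eq_of_mem {V : Type} {x : V} {e : Sym2 V} (he : ¬ e.IsDiag) (h : x ∈ e) :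
    src x e = x := by
  rw [← mk_src_tgt x e, Sym2.mem_iff] at h
  exact (h.resolve_right fun h => tgt_ne x he h.symm).symm

/-- Away from the root, the four products of `γ / r` and `-γ / (1 - r)` match the kernel with weight
`ε γ ^ 2 / (r (1 - r))`. At the root the bit is always `false` and the weight is `-ε φ γ / r`,
positive for `1/5 < r < 1/2`. -/
theorem meanPhi_mul_eq {V : Type} [DecidableEq V] {p : V → ℝ} {x : V} {r ε : ℝ} (hr0 : 0 < r)
    (hr1 : r < 1 / 2) {e : Sym2 V} (he : ¬ e.IsDiag) (hp : ∀ v ∈ e, v ≠ x → p v = r) (b : V → Bool)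
    (hx : x ∈ e → 1 / 5 < r ∧ b x = false) :
    ε * (e.map (meanPhi x r b)).mul = edgeWeight ε x r e * (copyKernel p x e b - 1) := by
  have ht := tgt_ne x he
  have hpt := hp _ (tgt_mem x e) ht
  have hmul : (e.map (meanPhi x r b)).mul =
      meanPhi x r b (src x e) * meanPhi x r b (tgt x e) := by
    conv_lhs => rw [← mk_src_tgt x e]
    rfl
  have h1 : (1 - r) ≠ 0 := by linarith
  rw [hmul, copyKernel, hpt, edgeWeight]
  by_cases hxe : x ∈ e
  · obtain ⟨h5, hb⟩ := hx hxe
    have hg := phi_mul_gamma hr1.le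
    rw [if_pos hxe, src_eq_of_mem he hxe, hb, rootWeight, max_eq_left (by linarith)]
    cases hbt : b (tgt x e)
    · simp only [meanPhi, if_true, ht, hbt, if_false, Bool.false_eq_true]
      field_simp
      linear_combination (-ε) * hg
    · simp only [meanPhi, if_true, ht, hbt, if_false, Bool.true_eq_false]
      field_simp
      linear_combination ε * hg
  · have hs : src x e ≠ x := fun h => hxe (h ▸ src_mem x e)
    have hg := gamma_sq hr1.le
    rw [if_neg hxe, idWeight]
    cases hbt : b (tgt x e) <;> cases hbs : b (src x e)
    · simp only [meanPhi, if_true, ht, hs, hbt, hbs, if_false, Bool.false_eq_true]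
      field_simp
      linear_combination ε * hg
    · simp only [meanPhi, if_true, ht, hs, hbt, hbs, if_false, Bool.false_eq_true]
      field_simp
      linear_combination (-ε) * hg
    · simp only [meanPhi, if_true, ht, hs, hbt, hbs, if_false, Bool.true_eq_false,
        Bool.false_eq_true]
      field_simp
      linear_combination (-ε) * hg
    · simp only [meanPhi, if_true, ht, hs, hbt, hbs, if_false]
      field_simp
      linear_combination ε * hg

theorem monotone_cutInd {V : Type} [DecidableEq V] (sel : List V → Clause V) (h : ℕ) (x : V) :
    Monotone (cutInd sel h x) := by
  intro b b' hb
  unfold cutInd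
  split_ifs with h1 h2
  · exact le_rfl
  · exact absurd (fun p hp => (h1 p hp).imp fun v hv => ⟨hv.1, le_antisymm (Bool.le_true _) (hv.2 ▸ hb v)⟩) h2
  · exact zero_le_one
  · exact le_rfl

section

variable {V : Type} [Fintype V] [DecidableEq V]

theorem bexp_congr_root {p : V → ℝ} {x : V} (hx : p x = 0) {f g : (V → Bool) → ℝ}
    (h : ∀ b, b x = false → f b = g b) : bexp p f = bexp p g := by
  refine Finset.sum_congr rfl fun b _ => ?_
  cases hb : b x
  · rw [h b hb]
  · rw [Finset.prod_eq_zero (Finset.mem_univ x) (by simp [hb, hx]), mul_zero, mul_zero]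

open Classical in
/-- The edges of the component `c` that may be identified. -/
noncomputable def keptEdges (G : SimpleGraph V) (x : V) (r : ℝ) (c : G.ConnectedComponent) :
    Finset (Sym2 V) := (compEdges G c).filter fun e => x ∈ e → 1 / 5 < r

theorem mem_keptEdges {G : SimpleGraph V} {x : V} {r : ℝ} {c : G.ConnectedComponent} {e : Sym2 V} :
    e ∈ keptEdges G x r c ↔ e ∈ compEdges G c ∧ (x ∈ e → 1 / 5 < r) := by
  simp [keptEdges]

/-- The density of a component, written as a mixture. -/
noncomputable def mixFactor (p : V → ℝ) (G : SimpleGraph V) (ε : ℝ) (x : V) (r : ℝ)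
    (c : G.ConnectedComponent) (b : V → Bool) : ℝ :=
  (1 - ∑ e ∈ keptEdges G x r c, edgeWeight ε x r e) +
    ∑ e ∈ keptEdges G x r c, edgeWeight ε x r e * copyKernel p x e b

variable {F : Finset (Clause V)} {G : SimpleGraph V} {ε r : ℝ} {x : V}

theorem placedBefore_eq (hG : ∀ a b, G.Adj a b → a ∉ TwoCC F) {c : G.ConnectedComponent}
    {e : Sym2 V} (he : e ∈ compEdges G c) {v : V} (hv : v ∈ e) (hx : v ≠ x) :
    placedBefore F ε x r v = r := by
  obtain ⟨w, rfl⟩ := Sym2.mem_iff_exists.1 hv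
  simp [placedBefore, hx, hG v w (mem_compEdges.1 he).1]

theorem one_add_sum_keptEdges (hG : ∀ a b, G.Adj a b → a ∉ TwoCC F) (hr0 : 0 < r)
    (hr1 : r < 1 / 2) (c : G.ConnectedComponent) (b : V → Bool)
    (hb : G.connectedComponentMk x = c → b x = false) :
    1 + ε * ∑ e ∈ keptEdges G x r c, (e.map (meanPhi x r b)).mul =
      mixFactor (placedBefore F ε x r) G ε x r c b := by
  rw [mixFactor, sub_add, ← Finset.sum_sub_distrib, Finset.mul_sum, sub_eq_add_neg,
    ← Finset.sum_neg_distrib]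
  congr 1
  refine Finset.sum_congr rfl fun e he => ?_
  obtain ⟨he, hx⟩ := mem_keptEdges.1 he
  rw [meanPhi_mul_eq hr0 hr1 (not_isDiag_of_mem_compEdges he)
    (fun v hv hvx => placedBefore_eq (ε := ε) hG he hv hvx) b
    fun hxe => ⟨hx hxe, hb ((mem_compEdges.1 he).2 x hxe)⟩]
  ring

theorem mixFactor_nonneg {p : V → ℝ} (hp : ∀ i, p i ∈ Set.Icc (0 : ℝ) 1) (hε : 0 ≤ ε)
    (hr0 : 0 ≤ r) (hr1 : r ≤ 1 / 2) {c : G.ConnectedComponent}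
    (hsum : ∑ e ∈ keptEdges G x r c, edgeWeight ε x r e ≤ 1) (b : V → Bool) :
    0 ≤ mixFactor p G ε x r c b :=
  add_nonneg (by linarith) (Finset.sum_nonneg fun e _ =>
    mul_nonneg (edgeWeight_nonneg hε hr0 hr1 x e) (copyKernel_nonneg hp x e b))

/-- An edge at the root variable does not decrease the cut probability if `φ (r) ≥ 0`. -/
theorem bexp_rootEdge_nonneg {p : V → ℝ} (hp : ∀ i, p i ∈ Set.Icc (0 : ℝ) 1) {v : V} (hvx : v ≠ x)
    (hpv : p v = r) (hr0 : 0 < r) (hr1 : r ≤ 1 / 5) {f M : (V → Bool) → ℝ} (hf : Monotone f)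
    (hM : ∀ b, 0 ≤ M b) (hMv : ∀ b s, M (Function.update b v s) = M b) :
    0 ≤ bexp p fun b => f b * ((s(x, v)).map (meanPhi x r b)).mul * M b := by
  rw [bexp_resample v]
  refine bexp_nonneg hp fun b => ?_
  simp only [Sym2.map_mk, Sym2.mul_mk, hMv, meanPhi, if_true, hvx, if_false, Function.update_self,
    hpv, Bool.false_eq_true]
  have h1 : (1 - r) ≠ 0 := by linarith
  have hm : f (Function.update b v false) ≤ f (Function.update b v true) := hf (by
    intro w
    by_cases hw : w = v
    · subst hw; simp
    · simp [hw])
  have hg := phi_mul_gamma (show r ≤ 1 / 2 by linarith)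
  have e1 : r * (f (Function.update b v true) * (phi r * (PPSZ.gamma r / r)) * M b) +
      (1 - r) * (f (Function.update b v false) * (phi r * -(PPSZ.gamma r / (1 - r))) * M b) =
      (r * (1 - 2 * r) ^ 2 * (1 - 5 * r)) * M b *
        (f (Function.update b v true) - f (Function.update b v false)) := by
    rw [← hg]
    field_simp
    ring
  rw [e1]
  exact mul_nonneg (mul_nonneg (mul_nonneg (mul_nonneg hr0.le (sq_nonneg _)) (by linarith)) (hM b))
    (by linarith)

/-- For `r > 1/5` this is an identity. For `r ≤ 1/5` the edges at the root are split off: each of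
them favours early placement of the other endpoint, so it contributes nonnegatively to the mean of
the monotone indicator. -/
theorem mixture_le_condCutProb (hG : ∀ a b, G.Adj a b → a ∉ TwoCC F)
    (hp : ∀ i, placedBefore F ε x r i ∈ Set.Icc (0 : ℝ) 1) (hε : 0 ≤ ε) (hr0 : 0 < r)
    (hr1 : r < 1 / 2) (hsum : ∀ c, ∑ e ∈ keptEdges G x r c, edgeWeight ε x r e ≤ 1)
    (sel : List V → Clause V) (h : ℕ) :
    open Classical in
    bexp (placedBefore F ε x r) (fun b => (∏ c, mixFactor (placedBefore F ε x r) G ε x r c b) *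
      cutInd sel h x b) ≤ condCutProb F sel G ε h x r := by
  classical
  have hpx : placedBefore F ε x r x = 0 := by simp [placedBefore]
  have h1 : bexp (placedBefore F ε x r) (fun b =>
      (∏ c, mixFactor (placedBefore F ε x r) G ε x r c b) * cutInd sel h x b) =
      bexp (placedBefore F ε x r) fun b => cutInd sel h x b * ∏ c : G.ConnectedComponent,
        (1 + ε * ∑ e ∈ keptEdges G x r c, (e.map (meanPhi x r b)).mul) :=
    bexp_congr_root hpx fun b hb => by
      rw [mul_comm]
      congr 1
      exact Finset.prod_congr rfl fun c _ =>
        (one_add_sum_keptEdges hG hr0 hr1 c b fun _ => hb).symm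
  rw [h1, condCutProb]
  rcases lt_or_ge (1 / 5) r with h5 | h5
  · refine le_of_eq (congrArg _ (funext fun b => ?_))
    congr 1
    refine Finset.prod_congr rfl fun c _ => ?_
    rw [show keptEdges G x r c = compEdges G c from Finset.filter_true_of_mem fun _ _ _ => h5]
  · set c₀ := G.connectedComponentMk x with hc₀
    set A : G.ConnectedComponent → (V → Bool) → ℝ := fun c b =>
      1 + ε * ∑ e ∈ keptEdges G x r c, (e.map (meanPhi x r b)).mul with hA
    set M : (V → Bool) → ℝ := fun b => ∏ c ∈ Finset.univ.erase c₀, A c b with hM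
    have hkept : ∀ c, c ≠ c₀ → keptEdges G x r c = compEdges G c := fun c hc =>
      Finset.filter_true_of_mem fun e he hx => absurd ((mem_compEdges.1 he).2 x hx).symm hc
    have hM0 : ∀ b, 0 ≤ M b := fun b => Finset.prod_nonneg fun c hc => by
      rw [hA]
      simp only
      rw [one_add_sum_keptEdges hG hr0 hr1 c b
        fun hxc => absurd hxc.symm (Finset.ne_of_mem_erase hc)]
      exact mixFactor_nonneg hp hε hr0.le hr1.le (hsum c) b
    have hsplit : ∀ b, cutInd sel h x b * ∏ c : G.ConnectedComponent,
        (1 + ε * ∑ e ∈ compEdges G c, (e.map (meanPhi x r b)).mul) =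
        cutInd sel h x b * ∏ c, A c b +
          ∑ e ∈ (compEdges G c₀).filter (x ∈ ·),
            ε * (cutInd sel h x b * (e.map (meanPhi x r b)).mul * M b) := by
      intro b
      rw [← Finset.mul_prod_erase _ _ (Finset.mem_univ c₀),
        ← Finset.mul_prod_erase _ (fun c => A c b) (Finset.mem_univ c₀)]
      have e1 : ∏ c ∈ Finset.univ.erase c₀,
          (1 + ε * ∑ e ∈ compEdges G c, (e.map (meanPhi x r b)).mul) = M b :=
        Finset.prod_congr rfl fun c hc => by
          simp only [hA, hkept c (Finset.ne_of_mem_erase hc)]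
      have e2 : keptEdges G x r c₀ = (compEdges G c₀).filter fun e => ¬ x ∈ e := by
        ext e
        simp only [mem_keptEdges, Finset.mem_filter, h5.not_gt, imp_false]
      rw [e1, ← Finset.mul_sum, ← Finset.sum_mul, ← Finset.mul_sum]
      simp only [hA, e2]
      rw [← Finset.sum_filter_add_sum_filter_not (compEdges G c₀) (x ∈ ·)]
      ring
    simp only [hsplit]
    rw [bexp_add, bexp_sum]
    refine le_add_of_nonneg_right (Finset.sum_nonneg fun e he => ?_)
    obtain ⟨he, hxe⟩ := Finset.mem_filter.1 he
    rw [bexp_const_mul]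
    refine mul_nonneg hε ?_
    have hd := not_isDiag_of_mem_compEdges he
    have hte := tgt_ne x hd
    have hs := mk_src_tgt x e
    rw [src_eq_of_mem hd hxe] at hs
    have htc := (mem_compEdges.1 he).2 _ (tgt_mem x e)
    rw [← hs]
    refine bexp_rootEdge_nonneg hp hte
      (placedBefore_eq (ε := ε) hG he (tgt_mem x e) hte) hr0 h5 (monotone_cutInd sel h x) hM0 ?_
    intro b s
    refine Finset.prod_congr rfl fun c hc => ?_
    simp only [hA]
    congr 2
    refine Finset.sum_congr rfl fun e' he' => ?_
    have hv : tgt x e ∉ e' := fun hv =>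
      (Finset.ne_of_mem_erase hc) (((mem_compEdges.1 (mem_keptEdges.1 he').1).2 _ hv).symm.trans htc)
    congr 1
    refine Sym2.map_congr fun w hw => ?_
    have hwt : w ≠ tgt x e := fun h => hv (h ▸ hw)
    simp only [meanPhi, Function.update_of_ne hwt]

end

end PPSZ

namespace PPSZ

/-! ### The parameters -/

/-- Reduces the structure to two size estimates: `2/15` for `η + ϑ` and `7/25` for `δ + 2 Δ`. As `r
(1 - 2 r) ≤ 1/8` and `t < 1`, the second gives `δ + 2 Δ ≤ (1 - t ^ 2) / 20`, which fits `κ = 21/20`.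
-/
theorem lossParams_of {r t η ϑ δ Δ bonus : ℝ} (hr0 : 0 < r) (hr1 : r < 1 / 2)
    (htm : t * (1 - r) = r) (hη0 : 0 ≤ η) (hϑ0 : 0 ≤ ϑ) (hb0 : 0 ≤ bonus)
    (hS : η + ϑ ≤ 2 / 15 * (r * (1 - 2 * r)))
    (hδ0 : 0 ≤ δ) (hΔ0 : 0 ≤ Δ)
    (hδ : 2 * t * η * (21 / 20 * (1 - t ^ 2)) ≤ (1 - 2 * r) * δ)
    (hΔ : 2 * t * ϑ * (21 / 20 * (1 - t ^ 2)) ≤ Δ)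
    (hW : δ + 2 * Δ ≤ 7 / 25 * (t * (r * (1 - 2 * r))) * (1 - t ^ 2))
    (hb : (1 - r) * (δ + 2 * Δ) ≤ bonus * (1 - t ^ 2)) :
    LossParams r t (21 / 20) η ϑ δ Δ (1 / 2 + r) bonus := by
  have hv : 0 < 1 - r := by linarith
  have ht0 : 0 < t := by
    by_contra h
    nlinarith
  have ht1 : t < 1 := by
    by_contra h
    nlinarith
  have hrt : r ≤ t := by
    by_contra h
    nlinarith
  have hQ : 1 - t ^ 2 = (1 - t) * (1 + t) := by ring
  have hQ0 : 0 < 1 - t ^ 2 := by rw [hQ]; exact mul_pos (by linarith) (by linarith)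
  have hQ2 : 1 - t ^ 2 ≤ 2 * (1 - t) := by
    rw [hQ, mul_comm]
    exact mul_le_mul_of_nonneg_right (by linarith) (by linarith)
  have hru : r * (1 - 2 * r) ≤ 1 / 8 := by nlinarith [sq_nonneg (4 * r - 1)]
  have hru0 : 0 < r * (1 - 2 * r) := mul_pos hr0 (by linarith)
  have hru1 : r * (1 - 2 * r) ≤ r := mul_le_of_le_one_right hr0.le (by linarith)
  -- The constant `7/20` serves both single-child conditions: doubled, it is still below `1`, and `t
  -- - t ^ 2 = t (1 - t)`.
  have hX : (η + ϑ) * (21 / 20 * (1 - t ^ 2)) + (1 - r) * (δ + 2 * Δ) ≤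
      7 / 20 * (t * (1 - t)) := by
    have e1 : (η + ϑ) * (21 / 20 * (1 - t ^ 2)) ≤ 2 / 15 * t * (21 / 20 * (2 * (1 - t))) :=
      mul_le_mul (by linarith) (by linarith) (by linarith) (by linarith)
    have e2 := mul_le_mul_of_nonneg_left hW hv.le
    have e3 : (1 - r) * (7 / 25 * (t * (r * (1 - 2 * r))) * (1 - t ^ 2)) =
        7 / 25 * r * (r * (1 - 2 * r)) * (1 - t ^ 2) := by
      linear_combination (7 / 25 * (r * (1 - 2 * r)) * (1 - t ^ 2)) * htm
    have e4 : 7 / 25 * r * (r * (1 - 2 * r)) * (1 - t ^ 2) ≤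
        7 / 25 * t * (1 / 8) * (2 * (1 - t)) := by
      refine mul_le_mul (mul_le_mul (by linarith) hru hru0.le (by linarith)) hQ2 hQ0.le ?_
      positivity
    linarith [mul_pos ht0 (sub_pos.2 ht1)]
  have htt : 0 < t * (1 - t) := mul_pos ht0 (by linarith)
  refine ⟨hr0, hr1, htm, hη0, hϑ0, hδ0, hΔ0, by linarith, hb0, hδ, hΔ, ?_, ?_, hb,
    ?_, ?_⟩
  · have : 7 / 25 * (t * (r * (1 - 2 * r))) * (1 - t ^ 2) ≤ 1 / 20 * (1 - t ^ 2) := by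
      refine mul_le_mul_of_nonneg_right ?_ hQ0.le
      have := mul_le_mul ht1.le hru hru0.le zero_le_one
      linarith
    linarith
  · have h1 : 2 * t * (1 - r + η + ϑ) = 2 * r + 2 * t * (η + ϑ) := by linear_combination 2 * htm
    have h2 : 2 * t * (η + ϑ) ≤ 2 * 1 * (2 / 15 * (r * (1 - 2 * r))) :=
      mul_le_mul (by linarith) hS (by linarith) (by norm_num)
    have h4 : r * (1 - 2 * r) ≤ 1 * (1 - 2 * r) :=
      mul_le_mul_of_nonneg_right (by linarith) (by linarith)
    rw [h1]
    linarith
  · have : t * (1 - t) ≤ t * 1 := mul_le_mul_of_nonneg_left (by linarith) ht0.le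
    linarith
  · have : t - t ^ 2 = t * (1 - t) := by ring
    linarith

/-- This is `hbonus` after cancellation of common factors; here the constant `25` of `γ_TwoCC` is
used. -/
theorem bonus_aux {r t m : ℝ} (hr0 : 0 < r) (hr1 : r < 1 / 2) (htm : t * (1 - r) = r)
    (hm : m = max (5 * r - 1) 0) : 84 / 5 * (t + m) ≤ 25 * r * (3 + 2 * r) := by
  have hu : 0 < 1 - 2 * r := by linarith
  refine le_of_mul_le_mul_right ?_ (by linarith : 0 < 1 - r)
  have : 84 / 5 * (t + m) * (1 - r) = 84 / 5 * (r + m * (1 - r)) := by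
    linear_combination 84 / 5 * htm
  rw [this]
  rcases max_cases (5 * r - 1) 0 with ⟨h, _⟩ | ⟨h, _⟩
  · rw [hm, h]
    nlinarith [mul_pos hr0 hr0, mul_pos (mul_pos hr0 hr0) hu, sq_nonneg (2 * r - 1),
      mul_nonneg hr0.le (sq_nonneg (2 * r - 1))]
  · rw [hm, h]
    nlinarith [mul_pos hr0 hr0, mul_pos (mul_pos hr0 hr0) hu, mul_pos hr0 hu]

/-- The witnesses `δ`, `Δ` turn `hδ` and `hΔ` into equalities. Everything else is then governed by
one quantity `A`, since `η / u + 2 ϑ = 8 ε r u A`. -/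
theorem lossParams {r ε : ℝ} (hr0 : 0 < r) (hr1 : r < 1 / 2) (hε0 : 0 ≤ ε) (hε1 : ε ≤ 1 / 10) :
    ∃ δ Δ, LossParams r (r / (1 - r)) (21 / 20) (2 * (r * (4 / (3 + 2 * r) * idWeight ε r)))
      (r * (4 / (3 + 2 * r) * rootWeight ε r)) δ Δ (1 / 2 + r) (ε * gammaTwoCC r) := by
  have hv : 0 < 1 - r := by linarith
  have hu : 0 < 1 - 2 * r := by linarith
  have h3 : 0 < 3 + 2 * r := by linarith
  obtain ⟨t, ht⟩ : ∃ t, t = r / (1 - r) := ⟨_, rfl⟩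
  have htm : t * (1 - r) = r := by rw [ht]; field_simp
  have ht0 : 0 < t := by rw [ht]; exact div_pos hr0 hv
  have ht1 : t < 1 := by rw [ht, div_lt_one hv]; linarith
  have htr : t ≤ 2 * r := by rw [ht, div_le_iff₀ hv]; nlinarith
  have hQ0 : 0 < 1 - t ^ 2 := by nlinarith
  obtain ⟨m, hm⟩ : ∃ m, m = max (5 * r - 1) 0 := ⟨_, rfl⟩
  have hm0 : 0 ≤ m := hm ▸ le_max_right _ _
  have hmu : m * (1 - 2 * r) ≤ 1 / 4 := by
    rcases max_cases (5 * r - 1) 0 with ⟨h, _⟩ | ⟨h, _⟩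
    · rw [hm, h]; nlinarith [sq_nonneg (20 * r - 7)]
    · rw [hm, h]; norm_num
  have htu : t * (1 - 2 * r) ≤ 1 / 4 := by
    have := mul_le_mul_of_nonneg_right htr hu.le
    nlinarith [sq_nonneg (4 * r - 1)]
  have hbon := bonus_aux hr0 hr1 htm hm
  have hη0 := idWeight_nonneg hε0 hr0.le hr1.le
  have hϑ0 := rootWeight_nonneg (r := r) hε0
  have hg0 : 0 ≤ gammaTwoCC r := by
    rw [gammaTwoCC, if_pos hr1.le]
    positivity
  have hηeq : 2 * (r * (4 / (3 + 2 * r) * idWeight ε r)) =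
      8 * ε * r * (1 - 2 * r) ^ 3 * t / (3 + 2 * r) := by
    rw [idWeight, ht]; field_simp; ring
  have hϑeq : r * (4 / (3 + 2 * r) * rootWeight ε r) =
      4 * ε * r * (1 - 2 * r) ^ 2 * m / (3 + 2 * r) := by
    rw [rootWeight, ← hm]; field_simp
  have hg : gammaTwoCC r = 25 * r ^ 3 * (1 - 2 * r) ^ 2 := if_pos hr1.le
  rw [← ht]
  obtain ⟨η, hη⟩ : ∃ η, η = 2 * (r * (4 / (3 + 2 * r) * idWeight ε r)) := ⟨_, rfl⟩
  obtain ⟨ϑ, hϑ⟩ : ∃ ϑ, ϑ = r * (4 / (3 + 2 * r) * rootWeight ε r) := ⟨_, rfl⟩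
  have hη0 : 0 ≤ η := by rw [hη]; positivity
  have hϑ0 : 0 ≤ ϑ := by rw [hϑ]; positivity
  rw [← hη, ← hϑ]
  rw [← hη] at hηeq
  rw [← hϑ] at hϑeq
  clear hη hϑ ht hm
  obtain ⟨u, hudef⟩ : ∃ u, u = 1 - 2 * r := ⟨_, rfl⟩
  rw [← hudef] at hu hmu htu hηeq hϑeq hg
  -- Both `t u` and `m u` are at most `1/4`, so `A ≤ 1/6` and `ε A ≤ 1/60`; this yields `8/60 =
  -- 2/15` and `(84/5)/60 = 7/25`.
  obtain ⟨A, hA⟩ : ∃ A, A = (t + m) * u / (3 + 2 * r) := ⟨_, rfl⟩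
  have hA0 : 0 ≤ A := by rw [hA]; positivity
  have hA6 : A ≤ 1 / 6 := by
    rw [hA, div_le_iff₀ h3]
    linarith
  have hru0 : 0 < r * u := mul_pos hr0 hu
  have hSeq : η / u + 2 * ϑ = 8 * ε * (r * u) * A := by
    rw [hηeq, hϑeq, hA]; field_simp; ring
  have hεA : ε * A ≤ 1 / 60 := (mul_le_mul hε1 hA6 hA0 (by norm_num)).trans (by norm_num)
  have hS0 : 8 * ε * (r * u) * A ≤ 2 / 15 * (r * u) := by
    linarith [mul_le_mul_of_nonneg_left hεA hru0.le]
  have hηu : η ≤ η / u := by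
    rw [le_div_iff₀ hu]
    exact mul_le_of_le_one_right hη0 (by linarith)
  have hWeq : 2 * t * η * (21 / 20 * (1 - t ^ 2)) / u + 2 * (2 * t * ϑ * (21 / 20 * (1 - t ^ 2))) =
      84 / 5 * (t * (r * u)) * (ε * A) * (1 - t ^ 2) := by
    have : 2 * t * η * (21 / 20 * (1 - t ^ 2)) / u + 2 * (2 * t * ϑ * (21 / 20 * (1 - t ^ 2))) =
        2 * t * (21 / 20 * (1 - t ^ 2)) * (η / u + 2 * ϑ) := by ring
    rw [this, hSeq]; ring
  have htru : 0 < t * (r * u) := mul_pos ht0 hru0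
  refine ⟨2 * t * η * (21 / 20 * (1 - t ^ 2)) / u, 2 * t * ϑ * (21 / 20 * (1 - t ^ 2)),
    lossParams_of hr0 hr1 htm hη0 hϑ0 (mul_nonneg hε0 hg0) (by rw [← hudef]; linarith)
    (by positivity) (by positivity) ?_ le_rfl ?_ ?_⟩
  · rw [← hudef, mul_div_cancel₀ _ hu.ne']
  · rw [hWeq, ← hudef]
    refine mul_le_mul_of_nonneg_right ?_ hQ0.le
    linarith [mul_le_mul_of_nonneg_left hεA htru.le]
  · have h1 : (1 - r) * (84 / 5 * (t * (r * u)) * (ε * A) * (1 - t ^ 2)) =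
        ε * (84 / 5 * r * (r * u) * A) * (1 - t ^ 2) := by
      linear_combination (84 / 5 * (r * u) * (ε * A) * (1 - t ^ 2)) * htm
    rw [hWeq, h1, hg]
    refine mul_le_mul_of_nonneg_right (mul_le_mul_of_nonneg_left ?_ hε0) hQ0.le
    have h4 : 84 / 5 * ((t + m) / (3 + 2 * r)) ≤ 25 * r := by
      rw [← mul_div_assoc, div_le_iff₀ h3]
      exact hbon
    have h5 : 84 / 5 * r * (r * u) * A = 84 / 5 * ((t + m) / (3 + 2 * r)) * (r ^ 2 * u ^ 2) := by
      rw [hA]; ring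
    rw [h5]
    refine (mul_le_mul_of_nonneg_right h4 (by positivity)).trans (le_of_eq (by ring))

/-! ### Counting edges -/

section

variable {V : Type} [Fintype V] [DecidableEq V] {F : Finset (Clause V)} {canon : V → Clause V}
  {sel : List V → Clause V} {h : ℕ} {Thr : ℝ} {G : SimpleGraph V}

open Classical in
/-- The neighbours of `v`. -/
noncomputable def nbrs (G : SimpleGraph V) (v : V) : Finset V := Finset.univ.filter (G.Adj v)

omit [DecidableEq V] in
theorem mem_nbrs {v w : V} : w ∈ nbrs G v ↔ G.Adj v w := by simp [nbrs]

theorem IsLowGraph.card_nbrs_le (hG : IsLowGraph F canon sel h Thr G) (v : V) :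
    (nbrs G v).card ≤ 2 := by
  have : (nbrs G v : Set V) = G.neighborSet v := by
    ext w
    simp [mem_nbrs]
  rw [← Set.ncard_coe_finset, this]
  exact hG.degree_le v

omit [Fintype V] in
theorem IsLowGraph.notMem_twoCC (hG : IsLowGraph F canon sel h Thr G) {a b : V} (hab : G.Adj a b) :
    a ∉ TwoCC F := (hG.le_free hab).2.1

theorem IsLowGraph.card_filter_mem_le (hG : IsLowGraph F canon sel h Thr G)
    (c : G.ConnectedComponent) (v : V) : ((compEdges G c).filter (v ∈ ·)).card ≤ 2 := by
  refine le_trans ?_ (hG.card_nbrs_le v)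
  refine (Finset.card_le_card fun e he => ?_).trans (Finset.card_image_le (f := fun w => s(v, w)))
  obtain ⟨he, hv⟩ := Finset.mem_filter.1 he
  obtain ⟨w, rfl⟩ := Sym2.mem_iff_exists.1 hv
  exact Finset.mem_image.2 ⟨w, mem_nbrs.2 (mem_compEdges.1 he).1, rfl⟩

/-- Double counting: an edge has two endpoints in its component and a vertex lies on at most two
edges, so there are no more edges than vertices. -/
theorem IsLowGraph.card_compEdges_le (hG : IsLowGraph F canon sel h Thr G)
    (c : G.ConnectedComponent) : (compEdges G c).card ≤ 23 := by
  classical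
  have hcard : (Finset.univ.filter fun v => G.connectedComponentMk v = c).card ≤ 23 := by
    have : ((Finset.univ.filter fun v => G.connectedComponentMk v = c : Finset V) : Set V) =
        c.supp := by
      ext v
      simp
    rw [← Set.ncard_coe_finset, this]
    exact hG.component_le c
  have := Finset.card_mul_le_card_mul (s := compEdges G c)
    (t := Finset.univ.filter fun v => G.connectedComponentMk v = c) (fun e v => v ∈ e) (m := 2)
    (n := 2) (fun e he => ?_) fun v _ => hG.card_filter_mem_le c v
  · omega
  · have hd := not_isDiag_of_mem_compEdges he
    have hc := (mem_compEdges.1 he).2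
    induction e with
    | _ a b =>
      have hab : a ≠ b := fun h => hd (by simpa using h)
      rw [← Finset.card_pair hab]
      refine Finset.card_le_card fun w hw => ?_
      have hw' : w ∈ s(a, b) := by simpa using hw
      exact (Finset.mem_bipartiteAbove _).2 ⟨by simpa using hc w hw', hw'⟩

/-- At most 23 edges carry `idWeight`, and at most two carry `rootWeight`. The bound `(1 - 2 r) / 4`
is what leads to the factor `4 / (3 + 2 r)` in the domination. -/
theorem IsLowGraph.sum_edgeWeight_le (hG : IsLowGraph F canon sel h Thr G) {ε r : ℝ} (hr0 : 0 < r)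
    (hr1 : r < 1 / 2) (hε0 : 0 ≤ ε) (hε1 : ε ≤ 1 / 10) (x : V) (c : G.ConnectedComponent) :
    ∑ e ∈ keptEdges G x r c, edgeWeight ε x r e ≤ (1 - 2 * r) / 4 := by
  classical
  have h0 := idWeight_nonneg hε0 hr0.le hr1.le
  have h0' := rootWeight_nonneg (r := r) hε0
  have h1 : ∑ e ∈ keptEdges G x r c, edgeWeight ε x r e ≤
      ∑ e ∈ compEdges G c, (idWeight ε r + if x ∈ e then rootWeight ε r else 0) := by
    refine (Finset.sum_le_sum_of_subset_of_nonneg (Finset.filter_subset _ _)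
      fun e _ _ => edgeWeight_nonneg hε0 hr0.le hr1.le x e).trans (Finset.sum_le_sum fun e _ => ?_)
    unfold edgeWeight
    split_ifs <;> linarith
  have h2 : ((compEdges G c).card : ℝ) ≤ 23 := by exact_mod_cast hG.card_compEdges_le c
  have h3 : (((compEdges G c).filter (x ∈ ·)).card : ℝ) ≤ 2 := by
    exact_mod_cast hG.card_filter_mem_le c x
  rw [Finset.sum_add_distrib, ← Finset.sum_filter, Finset.sum_const, Finset.sum_const,
    nsmul_eq_mul, nsmul_eq_mul] at h1
  have h4 : 23 * idWeight ε r + 2 * rootWeight ε r ≤ (1 - 2 * r) / 4 := by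
    have hv : 0 < 1 - r := by linarith
    have hu : 0 < 1 - 2 * r := by linarith
    have e1 : idWeight ε r ≤ 1 / 10 * (r * (1 - 2 * r) ^ 3 / (1 - r)) := by
      rw [idWeight, mul_assoc, mul_div_assoc]
      exact mul_le_mul_of_nonneg_right hε1 (by positivity)
    have e2 : rootWeight ε r ≤ 1 / 10 * ((1 - 2 * r) ^ 2 * max (5 * r - 1) 0) := by
      rw [rootWeight, mul_assoc]
      exact mul_le_mul_of_nonneg_right hε1 (by positivity)
    have e3 : 23 / 10 * (r * (1 - 2 * r) ^ 2) + 1 / 5 * ((1 - 2 * r) * max (5 * r - 1) 0) * (1 - r)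
        ≤ 1 / 4 * (1 - r) := by
      rcases max_cases (5 * r - 1) 0 with ⟨h, h'⟩ | ⟨h, h'⟩
      · rw [h]
        nlinarith [mul_pos hr0 hu, mul_nonneg hr0.le (sq_nonneg (4 * r - 1)),
          mul_nonneg hu.le (sq_nonneg (4 * r - 1)), sq_nonneg (4 * r - 1)]
      · rw [h]
        nlinarith [mul_pos hr0 hu, mul_nonneg hr0.le (sq_nonneg (6 * r - 1)),
          mul_nonneg hu.le (sq_nonneg (6 * r - 1)), sq_nonneg (6 * r - 1)]
    have e4 : r * (1 - 2 * r) ^ 3 / (1 - r) * (1 - r) = r * (1 - 2 * r) ^ 3 := by field_simp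
    refine le_of_mul_le_mul_right ?_ hv
    have e5 := mul_le_mul_of_nonneg_left e3 hu.le
    nlinarith [mul_le_mul_of_nonneg_right e1 hv.le, mul_le_mul_of_nonneg_right e2 hv.le]
  nlinarith [mul_le_mul_of_nonneg_right h2 h0, mul_le_mul_of_nonneg_right h3 h0']

end

end PPSZ

namespace PPSZ

/-! ### The lower bound for the conditional cut probability -/

open Classical in
/-- The probability that `w` is identified with a vertex of the path `p`. -/
noncomputable def edgeLoss {V : Type} [DecidableEq V] (G : SimpleGraph V) (ε : ℝ) (x : V) (r : ℝ) (w : V)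
    (p : List V) : ℝ :=
  (p.map fun a => if G.Adj w a then
    4 / (3 + 2 * r) * (if a = x then rootWeight ε r else idWeight ε r) else 0).sum

open Classical in
/-- The probability that the edge `e` survives. -/
noncomputable def survival {V : Type} (ε : ℝ) (x : V) (r : ℝ) (e₀ e : Sym2 V) : ℝ :=
  1 - (if e = e₀ then 1 else 4 / (3 + 2 * r)) * edgeWeight ε x r e

section

variable {V : Type} {ε r : ℝ} {x : V}

theorem edgeLoss_nonneg [DecidableEq V] {G : SimpleGraph V} (hr0 : 0 < r) (hr1 : r < 1 / 2) (hε0 : 0 ≤ ε) (w : V)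
    (p : List V) : 0 ≤ edgeLoss G ε x r w p := by
  refine List.sum_nonneg fun a ha => ?_
  obtain ⟨a, -, rfl⟩ := List.mem_map.1 ha
  have := idWeight_nonneg hε0 hr0.le hr1.le
  have := rootWeight_nonneg (r := r) hε0
  split_ifs <;> positivity

theorem idWeight_le (hr0 : 0 < r) (hr1 : r < 1 / 2) (hε1 : ε ≤ 1 / 10) :
    idWeight ε r ≤ 1 / 10 := by
  rw [idWeight, div_le_iff₀ (by linarith)]
  have h1 : (1 - 2 * r) ^ 3 ≤ 1 := pow_le_one₀ (by linarith) (by linarith)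
  have h2 : r * (1 - 2 * r) ^ 3 ≤ 1 - r := by nlinarith
  have h3 : 0 ≤ r * (1 - 2 * r) ^ 3 := mul_nonneg hr0.le (pow_nonneg (by linarith) 3)
  nlinarith

theorem rootWeight_le (hr0 : 0 < r) (hr1 : r < 1 / 2) (hε1 : ε ≤ 1 / 10) :
    rootWeight ε r ≤ 1 / 10 := by
  have h1 : 0 ≤ max (5 * r - 1) 0 := le_max_right _ _
  have h2 : (1 - 2 * r) ^ 2 * max (5 * r - 1) 0 ≤ 1 := by
    rcases max_cases (5 * r - 1) 0 with ⟨h, h'⟩ | ⟨h, _⟩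
    · rw [h]
      have : (1 - 2 * r) ^ 2 ≤ 9 / 25 := by nlinarith
      nlinarith
    · rw [h]; norm_num
  have h3 : 0 ≤ (1 - 2 * r) ^ 2 * max (5 * r - 1) 0 := by positivity
  rw [rootWeight, mul_assoc]
  nlinarith

theorem edgeWeight_le (hr0 : 0 < r) (hr1 : r < 1 / 2) (hε1 : ε ≤ 1 / 10) (e : Sym2 V) :
    edgeWeight ε x r e ≤ 1 / 10 := by
  unfold edgeWeight
  split_ifs
  · exact rootWeight_le hr0 hr1 hε1
  · exact idWeight_le hr0 hr1 hε1

theorem one_le_four_div (hr0 : 0 < r) (hr1 : r < 1 / 2) :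
    1 ≤ 4 / (3 + 2 * r) ∧ 4 / (3 + 2 * r) ≤ 2 := by
  constructor
  · rw [le_div_iff₀ (by linarith)]; linarith
  · rw [div_le_iff₀ (by linarith)]; linarith

theorem survival_mem_Icc (hr0 : 0 < r) (hr1 : r < 1 / 2) (hε0 : 0 ≤ ε) (hε1 : ε ≤ 1 / 10)
    (e₀ e : Sym2 V) : survival ε x r e₀ e ∈ Set.Icc (0 : ℝ) 1 := by
  obtain ⟨c1, c2⟩ := one_le_four_div hr0 hr1
  have h0 := edgeWeight_nonneg hε0 hr0.le hr1.le x e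
  have h1 := edgeWeight_le (x := x) hr0 hr1 hε1 e
  unfold survival
  split_ifs
  · exact ⟨by linarith, by linarith⟩
  · constructor <;> nlinarith

theorem one_sub_survival_le (hr0 : 0 < r) (hr1 : r < 1 / 2) (hε0 : 0 ≤ ε)
    (e₀ e : Sym2 V) : 1 - survival ε x r e₀ e ≤ 4 / (3 + 2 * r) * edgeWeight ε x r e := by
  obtain ⟨c1, c2⟩ := one_le_four_div hr0 hr1
  have h0 := edgeWeight_nonneg hε0 hr0.le hr1.le x e
  unfold survival
  split_ifs
  · nlinarith
  · linarith

end

section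

variable {V : Type} [Fintype V] [DecidableEq V] {F : Finset (Clause V)} {canon : V → Clause V}
  {sel : List V → Clause V} {h : ℕ} {Thr : ℝ} {G : SimpleGraph V} {ε r : ℝ} {x y z : V}

omit [Fintype V] in
theorem placedBefore_mem_Icc (hr0 : 0 < r) (hr1 : r < 1 / 2) (hε0 : 0 ≤ ε) (hε1 : ε ≤ 1 / 10)
    (v : V) : placedBefore F ε x r v ∈ Set.Icc (0 : ℝ) 1 := by
  have h1 : 0 ≤ gammaTwoCC r ∧ gammaTwoCC r ≤ 1 := by
    rw [gammaTwoCC, if_pos hr1.le]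
    have hu : 0 < 1 - 2 * r := by linarith
    have h8 : r * (1 - 2 * r) ≤ 1 / 8 := by nlinarith [sq_nonneg (4 * r - 1)]
    have h0 : 0 ≤ r * (1 - 2 * r) := by positivity
    refine ⟨by positivity, ?_⟩
    have : (r * (1 - 2 * r)) ^ 2 ≤ (1 / 8) ^ 2 := pow_le_pow_left₀ h0 h8 2
    nlinarith [sq_nonneg (r * (1 - 2 * r))]
  unfold placedBefore
  split_ifs
  · simp
  · constructor <;> nlinarith [h1.1, h1.2]
  · constructor <;> linarith

/-- All edges that may be identified. -/
noncomputable def keptList (G : SimpleGraph V) (x : V) (r : ℝ) (e₀ : Sym2 V) : List (Sym2 V) :=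
  open Classical in
  allEdges e₀ (keptEdges G x r) (Finset.univ : Finset G.ConnectedComponent).toList

theorem mem_keptList {e₀ e : Sym2 V} :
    e ∈ keptList G x r e₀ ↔ e ∈ G.edgeSet ∧ (x ∈ e → 1 / 5 < r) := by
  classical
  simp only [keptList, mem_allEdges, mem_keptEdges, mem_compEdges, Finset.mem_toList,
    Finset.mem_univ, true_and]
  constructor
  · rintro ⟨c, ⟨h1, -⟩, h2⟩
    exact ⟨h1, h2⟩
  · rintro ⟨h1, h2⟩
    induction e with
    | _ a b =>
      refine ⟨G.connectedComponentMk a, ⟨h1, fun v hv => ?_⟩, h2⟩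
      rcases Sym2.mem_iff.1 hv with rfl | rfl
      · rfl
      · exact (SimpleGraph.ConnectedComponent.eq.2 (SimpleGraph.Adj.reachable h1)).symm

theorem sum_missProb_le (hr0 : 0 < r) (hr1 : r < 1 / 2) (hε0 : 0 ≤ ε) (e₀ : Sym2 V) {w : V}
    (hw : w ≠ x) (p : List V) :
    (p.map fun a => missProb (survival ε x r e₀) (keptList G x r e₀) s(w, a)).sum ≤
      edgeLoss G ε x r w p := by
  classical
  refine List.sum_le_sum fun a _ => ?_
  have h0 := idWeight_nonneg hε0 hr0.le hr1.le
  have h0' := rootWeight_nonneg (r := r) hε0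
  unfold missProb
  split_ifs with h1 h2 h3 h3
  · have := one_sub_survival_le (x := x) hr0 hr1 hε0 e₀ s(w, a)
    rwa [edgeWeight, if_pos (by rw [h3]; exact Sym2.mem_mk_right _ _)] at this
  · have := one_sub_survival_le (x := x) hr0 hr1 hε0 e₀ s(w, a)
    rwa [edgeWeight, if_neg (by
      rw [Sym2.mem_iff]
      rintro (h | h)
      · exact hw h.symm
      · exact h3 h.symm)] at this
  · exact absurd (mem_keptList.1 h1).1 h2
  · positivity
  · positivity
  · exact le_rfl

/-- A repetition-free path meets at most two neighbours of `w`; if one of them is the root, its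
weight is added. -/
theorem IsLowGraph.edgeLoss_le (hG : IsLowGraph F canon sel h Thr G) (hr0 : 0 < r)
    (hr1 : r < 1 / 2) (hε0 : 0 ≤ ε) (w : V) {p : List V} (hp : p.Nodup) :
    edgeLoss G ε x r w p ≤ 2 * (4 / (3 + 2 * r) * idWeight ε r) +
      if w ∈ nbrs G x then 4 / (3 + 2 * r) * rootWeight ε r else 0 := by
  classical
  have h0 : 0 ≤ 4 / (3 + 2 * r) * idWeight ε r :=
    mul_nonneg (by positivity) (idWeight_nonneg hε0 hr0.le hr1.le)
  have h0' : 0 ≤ 4 / (3 + 2 * r) * rootWeight ε r :=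
    mul_nonneg (by positivity) (rootWeight_nonneg hε0)
  set I := 4 / (3 + 2 * r) * idWeight ε r
  set J := 4 / (3 + 2 * r) * rootWeight ε r
  rw [edgeLoss, ← List.sum_toFinset _ hp, ← Finset.sum_filter]
  have hsub : p.toFinset.filter (G.Adj w) ⊆ nbrs G w := fun a ha =>
    mem_nbrs.2 (Finset.mem_filter.1 ha).2
  have h1 : ∀ a ∈ p.toFinset.filter (G.Adj w),
      4 / (3 + 2 * r) * (if a = x then rootWeight ε r else idWeight ε r) ≤
      I + if x = a then J else 0 := fun a _ => by
    rcases eq_or_ne a x with h | h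
    · subst h
      simp only [if_true]
      linarith
    · simp only [h, h.symm, if_false]
      linarith
  have h2 : ((nbrs G w).card : ℝ) ≤ 2 := by exact_mod_cast hG.card_nbrs_le w
  have h3 : ∑ a ∈ p.toFinset.filter (G.Adj w), (I + if x = a then J else 0) ≤
      ∑ a ∈ nbrs G w, (I + if x = a then J else 0) :=
    Finset.sum_le_sum_of_subset_of_nonneg hsub fun a _ _ => by split_ifs <;> linarith
  have h4 : x ∈ nbrs G w ↔ w ∈ nbrs G x := by rw [mem_nbrs, mem_nbrs, G.adj_comm]
  rw [Finset.sum_add_distrib (s := nbrs G w), Finset.sum_const, nsmul_eq_mul,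
    Finset.sum_ite_eq] at h3
  simp only [h4] at h3
  have h5 := mul_le_mul_of_nonneg_right h2 h0
  refine (Finset.sum_le_sum h1).trans (h3.trans ?_)
  split_ifs <;> linarith

omit [Fintype V] in
theorem edgeLoss_of_mem_twoCC (hG : IsLowGraph F canon sel h Thr G) {w : V} (hw : w ∈ TwoCC F)
    (p : List V) : edgeLoss G ε x r w p = 0 := by
  refine List.sum_eq_zero fun a ha => ?_
  obtain ⟨a, -, rfl⟩ := List.mem_map.1 ha
  rw [if_neg fun h => hG.notMem_twoCC h hw]

theorem isDeletion_delProb (hsel : IsClauseLabelling F canon sel)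
    (hG : IsLowGraph F canon sel h Thr G) (hr0 : 0 < r) (hr1 : r < 1 / 2) (hε0 : 0 ≤ ε)
    (hε1 : ε ≤ 1 / 10) (e₀ : Sym2 V) :
    IsDeletion F canon sel
      (delProb (placedBefore F ε x r) (survival ε x r e₀) (keptList G x r e₀))
      (edgeLoss G ε x r) r (2 * (r * (4 / (3 + 2 * r) * idWeight ε r)))
      (r * (4 / (3 + 2 * r) * rootWeight ε r)) (ε * gammaTwoCC r) (nbrs G x)
      fun p => x ∈ p ∧ p.Nodup ∧ IsTreePath sel p := by
  have hp := fun v => placedBefore_mem_Icc (F := F) (x := x) hr0 hr1 hε0 hε1 v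
  have hq := fun e => survival_mem_Icc (x := x) hr0 hr1 hε0 hε1 e₀ e
  have hwx : ∀ p : List V, x ∈ p → ∀ w ∈ children sel p, w ≠ x := fun p hxp w hw h =>
    hsel.notMem_of_mem_children p w hw (h ▸ hxp)
  have key : ∀ p : List V, (x ∈ p ∧ p.Nodup ∧ IsTreePath sel p) → ∀ w ∈ children sel p,
      w ∉ TwoCC F → r * (1 - edgeLoss G ε x r w p) ≤
        delProb (placedBefore F ε x r) (survival ε x r e₀) (keptList G x r e₀) w p := by
    intro p hpp w hw hw2
    have hne := hwx p hpp.1 w hw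
    have h1 := le_delProb hp hq (keptList G x r e₀) w p
    rw [show placedBefore F ε x r w = r by simp [placedBefore, hne, hw2]] at h1
    refine le_trans (mul_le_mul_of_nonneg_left ?_ hr0.le) h1
    have := sum_missProb_le (G := G) hr0 hr1 hε0 e₀ hne p
    linarith
  have key2 : ∀ p : List V, (x ∈ p ∧ p.Nodup ∧ IsTreePath sel p) → ∀ w ∈ children sel p,
      w ∈ TwoCC F → r + ε * gammaTwoCC r ≤
        delProb (placedBefore F ε x r) (survival ε x r e₀) (keptList G x r e₀) w p := by
    intro p hpp w hw hw2
    have hne := hwx p hpp.1 w hw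
    have h1 := le_delProb hp hq (keptList G x r e₀) w p
    have h2 := sum_missProb_le (G := G) hr0 hr1 hε0 e₀ hne p
    rw [edgeLoss_of_mem_twoCC hG hw2] at h2
    have e1 : placedBefore F ε x r w = r + ε * gammaTwoCC r := by simp [placedBefore, hne, hw2]
    rw [e1] at h1
    have h3 : 0 ≤ r + ε * gammaTwoCC r := e1 ▸ (hp w).1
    refine le_trans ?_ h1
    nlinarith
  have hg0 : 0 ≤ ε * gammaTwoCC r := by
    rw [gammaTwoCC, if_pos hr1.le]
    positivity
  have hη : ∀ (w : V) (p : List V), p.Nodup → r * edgeLoss G ε x r w p ≤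
      2 * (r * (4 / (3 + 2 * r) * idWeight ε r)) +
        if w ∈ nbrs G x then r * (4 / (3 + 2 * r) * rootWeight ε r) else 0 := by
    intro w p hnd
    refine (mul_le_mul_of_nonneg_left (hG.edgeLoss_le hr0 hr1 hε0 w hnd) hr0.le).trans
      (le_of_eq ?_)
    split_ifs <;> ring
  have hr0' : 0 ≤ r * (4 / (3 + 2 * r) * rootWeight ε r) :=
    mul_nonneg hr0.le (mul_nonneg (by positivity) (rootWeight_nonneg hε0))
  refine ⟨delProb_mem_Icc hp hq _, hG.card_nbrs_le x,
    fun p hpp => ⟨fun h => by simp [h] at hpp, hpp.2.2⟩,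
    fun p hpp w hw => ⟨List.mem_cons_of_mem _ hpp.1, List.nodup_cons.2
      ⟨hsel.notMem_of_mem_children p w hw, hpp.2.1⟩, hpp.2.2.cons hw⟩, ?_, ?_, key2,
    edgeLoss_nonneg hr0 hr1 hε0⟩
  · intro p hpp w hw
    by_cases hw2 : w ∈ TwoCC F
    · refine le_trans ?_ (key2 p hpp w hw hw2)
      have := idWeight_nonneg hε0 hr0.le hr1.le
      have : 0 ≤ 2 * (r * (4 / (3 + 2 * r) * idWeight ε r)) := by positivity
      split_ifs <;> linarith
    · refine le_trans ?_ (key p hpp w hw hw2)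
      have := hη w p hpp.2.1
      linarith
  · intro p hpp w hw hw2
    refine ⟨key p hpp w hw hw2, (hη w p hpp.2.1).trans ?_⟩
    split_ifs <;> linarith

/-- Independent identification is dominated by the mixture, the mixture is bounded by the reweighted
mean of the cut indicator, and that by the conditional cut probability. -/
theorem ex_rootVal_le_condCutProb (hsel : IsClauseLabelling F canon sel)
    (hG : IsLowGraph F canon sel h Thr G) (hr0 : 0 < r) (hr1 : r < 1 / 2) (hε0 : 0 ≤ ε)
    (hε1 : ε ≤ 1 / 10) (hyz : G.Adj y z) (hxy : y ≠ x) (hxz : z ≠ x)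
    (hroot : children sel [x] = {y, z}) (n : ℕ) :
    ex (survival ε x r s(y, z)) (keptList G x r s(y, z))
      (rootVal (placedBefore F ε x r) (children sel) n r x y z) (fun _ => true) ≤
    condCutProb F sel G ε (n + 1) x r := by
  classical
  have hp := fun v => placedBefore_mem_Icc (F := F) (x := x) hr0 hr1 hε0 hε1 v
  have hq := fun e => survival_mem_Icc (x := x) hr0 hr1 hε0 hε1 s(y, z) e
  have hadj : ∀ a b, G.Adj a b → a ∉ TwoCC F := fun a b => hG.notMem_twoCC
  have hy : placedBefore F ε x r y = r := by simp [placedBefore, hxy, hG.notMem_twoCC hyz]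
  have hz : placedBefore F ε x r z = r := by simp [placedBefore, hxz, hG.notMem_twoCC hyz.symm]
  have hsum := hG.sum_edgeWeight_le hr0 hr1 hε0 hε1 x
  have hsum1 : ∀ c, ∑ e ∈ keptEdges G x r c, edgeWeight ε x r e ≤ 1 := fun c =>
    (hsum c).trans (by linarith)
  have hlam : ∀ c, ∀ e ∈ keptEdges G x r c, 0 ≤ edgeWeight ε x r e := fun c e _ =>
    edgeWeight_nonneg hε0 hr0.le hr1.le x e
  have hmem : ∀ c, ∀ e ∈ keptEdges G x r c, e ∈ compEdges G c := fun c e he =>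
    (mem_keptEdges.1 he).1
  have hcomp : ∀ c, ∀ e ∈ keptEdges G x r c, ∀ v ∈ e, G.connectedComponentMk v = c :=
    fun c e he => (mem_compEdges.1 (hmem c e he)).2
  have hch : ∀ q, ∀ w ∈ children sel q, w ∉ q := hsel.notMem_of_mem_children
  set l : List G.ConnectedComponent := Finset.univ.toList with hl
  have hlnd : l.Nodup := Finset.nodup_toList _
  refine le_trans ?_ (mixture_le_condCutProb hadj hp hε0 hr0 hr1 hsum1 sel (n + 1))
  have h1 := mix_le_bexp (p := placedBefore F ε x r) (x := x) (lam := edgeWeight ε x r)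
    (comp := G.connectedComponentMk) (E := keptEdges G x r) (l := l) (K := fun _ => true) (m := id)
    hr0 (by linarith) (fun c e he => not_isDiag_of_mem_compEdges (hmem c e he)) hcomp
    (fun c e he v hv hvx => placedBefore_eq hadj (hmem c e he) hv hvx) hlam hsum1
    (rootVal (placedBefore F ε x r) (children sel) n r x y z) (cutInd sel (n + 1) x)
    (fun m K hmK => rootVal_le_bexp hp hch hy hz hxy hxz hyz.ne hroot n hmK) hlnd isState_id
  have hdom : ∀ c, Dominated s(y, z) (survival ε x r s(y, z)) (edgeWeight ε x r)
      (edgeList s(y, z) (keptEdges G x r c)) := by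
    refine fun c => dominated_edgeList hq (hlam c) (by simp [survival]) fun e he hne => ?_
    rw [survival, if_neg hne]
    have h3 := hsum c
    have h4 := hlam c e he
    -- The factor in `survival` is the inverse of the guaranteed mass without identification,
    -- exactly as the domination requires.
    have h5 : 4 / (3 + 2 * r) * (1 - (1 - 2 * r) / 4) = 1 := by
      have : 3 + 2 * r ≠ 0 := by linarith
      field_simp
      ring
    have h6 : 0 ≤ 4 / (3 + 2 * r) := by positivity
    have h7 := mul_le_mul_of_nonneg_left
      (show 1 - (1 - 2 * r) / 4 ≤ 1 - ∑ e ∈ keptEdges G x r c, edgeWeight ε x r e by linarith) h6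
    have h8 := mul_le_mul_of_nonneg_left h7 h4
    rw [h5] at h8
    linarith
  have hr01 : r ∈ Set.Icc (0 : ℝ) 1 := ⟨hr0.le, by linarith⟩
  have h2 := ex_le_mix (E := keptEdges G x r) (lam := edgeWeight ε x r)
    (q := survival ε x r s(y, z)) (e₀ := s(y, z)) (l := l) (K := fun _ => true) hq hlam hsum1 hdom
    (fun c c' e he he' => by
      rw [← hcomp c e he _ (tgt_mem x e), hcomp c' e he' _ (tgt_mem x e)])
    (antitoneOff_rootVal (ch := children sel) (x := x) hp hr01 hy hz n) hlnd fun _ _ _ _ => rfl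
  refine h2.trans (h1.trans (le_of_eq ?_))
  congr 1
  funext b
  congr 1
  rw [hl, Finset.prod_map_toList]
  rfl

/-- The lower bound for the conditional cut probability. -/
theorem le_condCutProb (hF : IsThreeCNF F) (hone : OnesUnique F) (hcan : IsCanonicalChoice F canon)
    (hsel : IsClauseLabelling F canon sel)
    (hG : IsLowGraph F canon sel h Thr G) (hr0 : 0 < r) (hr1 : r < 1 / 2) (hε0 : 0 ≤ ε)
    (hε1 : ε ≤ 1 / 10) (hx : x ∉ TwoCC F) (hyz : G.Adj y z) (hxy : y ≠ x) (hxz : z ≠ x)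
    (hroot : children sel [x] = {y, z}) (hselx : sel [x] = canon x) (n : ℕ) :
    (r / (1 - r)) ^ 2 - loss F canon sel r
        (r * (r / (1 - r) * (21 / 20 * (1 - (r / (1 - r)) ^ 2)))) (edgeLoss G ε x r) (n + 1) [x] -
      (1 / 2 + r) ^ (n + 1) + ε * (PPSZ.gamma r ^ 2 * (1 - (r / (1 - r)) ^ 2) ^ 2) -
      r * (1 - r) * idWeight ε r * (edgeLoss G ε x r y [x] + edgeLoss G ε x r z [x]) ≤
    condCutProb F sel G ε (n + 1) x r := by
  classical
  have hp := fun v => placedBefore_mem_Icc (F := F) (x := x) hr0 hr1 hε0 hε1 v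
  have hq := fun e => survival_mem_Icc (x := x) hr0 hr1 hε0 hε1 s(y, z) e
  have hch : ∀ q, ∀ w ∈ children sel q, w ∉ q := hsel.notMem_of_mem_children
  have hy2 := hG.notMem_twoCC hyz
  have hz2 := hG.notMem_twoCC hyz.symm
  have hy : placedBefore F ε x r y = r := by simp [placedBefore, hxy, hy2]
  have hz : placedBefore F ε x r z = r := by simp [placedBefore, hxz, hz2]
  have hyc : y ∈ children sel [x] := by rw [hroot]; simp
  have hzc : z ∈ children sel [x] := by rw [hroot]; simp
  obtain ⟨δ, Δ, hL⟩ := lossParams hr0 hr1 hε0 hε1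
  have hD := isDeletion_delProb (x := x) hsel hG hr0 hr1 hε0 hε1 s(y, z)
  have hRx : x ∈ [x] ∧ [x].Nodup ∧ IsTreePath sel [x] := ⟨by simp, by simp, isTreePath_singleton x⟩
  have hcany : IsCanonicalNode F canon sel [y, x] :=
    isCanonicalNode_cons.2 ⟨isCanonicalNode_singleton hx, hy2, hselx⟩
  have hcanz : IsCanonicalNode F canon sel [z, x] :=
    isCanonicalNode_cons.2 ⟨isCanonicalNode_singleton hx, hz2, hselx⟩
  set q := survival ε x r s(y, z) with hqdef
  set L := keptList G x r s(y, z) with hLdef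
  have hlam0 := idWeight_nonneg hε0 hr0.le hr1.le
  have hlam1 := idWeight_le hr0 hr1 hε1
  have hmiss : missProb q L s(y, z) = idWeight ε r := by
    have hxe : x ∉ s(y, z) := by
      rw [Sym2.mem_iff]
      rintro (h | h)
      · exact hxy h.symm
      · exact hxz h.symm
    rw [missProb, if_pos (mem_keptList.2 ⟨hyz, fun h => absurd h hxe⟩), hqdef, survival,
      if_pos rfl, edgeWeight, if_neg hxe]
    ring
  have hmw : ∀ w, w ≠ x → missProb q L s(w, x) ≤ edgeLoss G ε x r w [x] := fun w hw => by
    have := sum_missProb_le (G := G) hr0 hr1 hε0 s(y, z) hw [x]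
    simpa using this
  have hel : ∀ w, edgeLoss G ε x r w [x] ≤ 1 / 5 := fun w => by
    obtain ⟨c1, c2⟩ := one_le_four_div hr0 hr1
    have h0 := rootWeight_nonneg (r := r) hε0
    have h1 := rootWeight_le hr0 hr1 hε1
    simp only [edgeLoss, List.map_cons, List.map_nil, List.sum_cons, List.sum_nil, if_true, add_zero]
    split_ifs
    · nlinarith
    · norm_num
  obtain ⟨dy1, dy2⟩ := hD.lower_of_notMem [x] hRx y hyc hy2
  obtain ⟨dz1, dz2⟩ := hD.lower_of_notMem [x] hRx z hzc hz2
  have hRy := hD.cons [x] hRx y hyc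
  have hRz := hD.cons [x] hRx z hzc
  have mc := fun w => cutProb_le_meanCut hp hq hch L n [w, x]
  have hg0 : 0 ≤ r * (r / (1 - r) * (21 / 20 * (1 - (r / (1 - r)) ^ 2))) := by
    have h1 := hL.t_pos
    have h2 := hL.t_lt
    have h3 : 0 ≤ 1 - (r / (1 - r)) ^ 2 := by nlinarith
    positivity
  have hroot' := hL.root (e := (1 / 2 + r) ^ n) (l := missProb q L s(y, z))
    (dy := delProb (placedBefore F ε x r) q L y [x])
    (dz := delProb (placedBefore F ε x r) q L z [x])
    (αy := meanCut (placedBefore F ε x r) (children sel) q L n [y, x])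
    (αz := meanCut (placedBefore F ε x r) (children sel) q L n [z, x])
    (ηy := edgeLoss G ε x r y [x]) (ηz := edgeLoss G ε x r z [x])
    (pow_nonneg (by linarith) n) (hmiss ▸ hlam0) (by linarith [hel y]) (by linarith [hel z])
    ((delProb_le hp hq L y [x]).trans_eq hy) ((delProb_le hp hq L z [x]).trans_eq hz) dy1 dz1 (hD.mem_Icc _ _).1
    (hD.mem_Icc _ _).1 (edgeLoss_nonneg hr0 hr1 hε0 _ _) (edgeLoss_nonneg hr0 hr1 hε0 _ _) dy2 dz2
    (meanCut_mem_Icc hp hq L n _) (meanCut_mem_Icc hp hq L n _)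
    (loss_nonneg hr0.le hg0 hD.η'_nonneg n [y, x]) (loss_nonneg hr0.le hg0 hD.η'_nonneg n [z, x])
    ((sub_loss_le_cutProb hL hF hone hcan hsel hD n _ hRy hcany).trans (mc y))
    ((sub_loss_le_cutProb hL hF hone hcan hsel hD n _ hRz hcanz).trans (mc z))
    ((one_sub_cutProb_le hL hF hone hsel hD n _ hRy).trans (mc y))
    ((one_sub_cutProb_le hL hF hone hsel hD n _ hRz).trans (mc z))
  have h2 := le_ex_rootVal hp hq hch ⟨hr0.le, by linarith⟩ hxy hxz hyz.ne L n
  have h3 := ex_rootVal_le_condCutProb hsel hG hr0 hr1 hε0 hε1 hyz hxy hxz hroot n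
  have h4 := h2.trans h3
  rw [hmiss] at h4 hroot'
  have hloss : loss F canon sel r (r * (r / (1 - r) * (21 / 20 * (1 - (r / (1 - r)) ^ 2))))
      (edgeLoss G ε x r) (n + 1) [x] = _ := rfl
  rw [loss, hroot, Finset.filter_true_of_mem (by
    intro w hw
    rcases Finset.mem_insert.1 hw with rfl | hw
    · exact hcany
    · rw [Finset.mem_singleton.1 hw]; exact hcanz), Finset.sum_pair hyz.ne]
  -- The source of the gain: `r (1 - r) idWeight = ε γ ^ 2`.
  have e1 : r * (1 - r) * idWeight ε r * (1 - (r / (1 - r)) ^ 2) ^ 2 =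
      ε * (PPSZ.gamma r ^ 2 * (1 - (r / (1 - r)) ^ 2) ^ 2) := by
    rw [gamma_sq hr1.le, idWeight]
    have : 1 - r ≠ 0 := by linarith
    field_simp
  rw [e1] at hroot'
  have h5 : 0 ≤ r * (1 - r) * idWeight ε r :=
    mul_nonneg (mul_nonneg hr0.le (by linarith)) hlam0
  have h6 := mul_le_mul_of_nonneg_left (add_le_add (hmw y hxy) (hmw z hxz)) h5
  rw [pow_succ (1 / 2 + r)]
  linarith

end

end PPSZ

namespace PPSZ

/-! ### The loss in terms of label densities -/

section

variable {V : Type} [DecidableEq V] {F : Finset (Clause V)} {canon : V → Clause V}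
  {sel : List V → Clause V} {G : SimpleGraph V}

open Classical in
/-- The labels of the canonical children of a node. -/
noncomputable def canonChildren (F : Finset (Clause V)) (canon : V → Clause V)
    (sel : List V → Clause V) (p : List V) : Finset V :=
  (children sel p).filter fun w => IsCanonicalNode F canon sel (w :: p)

theorem mem_canonChildren {p : List V} {w : V} :
    w ∈ canonChildren F canon sel p ↔ w ∈ children sel p ∧ IsCanonicalNode F canon sel (w :: p) := by
  simp [canonChildren]

open Classical in
/-- The canonical nodes of depth `d`. -/
noncomputable def canonNodes (F : Finset (Clause V)) (canon : V → Clause V)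
    (sel : List V → Clause V) (a : V) (d : ℕ) : Finset (List V) :=
  (nodesAt sel a d).filter (IsCanonicalNode F canon sel)

theorem sum_canonNodes_succ (f : List V → ℝ) (a : V) (d : ℕ) :
    ∑ p ∈ canonNodes F canon sel a (d + 1), f p =
      ∑ p ∈ canonNodes F canon sel a d, ∑ w ∈ canonChildren F canon sel p, f (w :: p) := by
  classical
  have h1 : canonNodes F canon sel a (d + 1) = (canonNodes F canon sel a d).biUnion fun p =>
      (canonChildren F canon sel p).image fun w => w :: p := by
    ext q
    simp only [canonNodes, nodesAt_succ, Finset.mem_filter, Finset.mem_biUnion, Finset.mem_image,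
      mem_canonChildren]
    constructor
    · rintro ⟨⟨p, hp, w, hw, rfl⟩, hc⟩
      obtain ⟨b, l, rfl⟩ := List.exists_cons_of_ne_nil (nodesAt_ne_nil hp)
      exact ⟨_, ⟨hp, (isCanonicalNode_cons.1 hc).1⟩, w, ⟨hw, hc⟩, rfl⟩
    · rintro ⟨p, ⟨hp, -⟩, w, ⟨hw, hc⟩, rfl⟩
      exact ⟨⟨p, hp, w, hw, rfl⟩, hc⟩
  rw [h1, Finset.sum_biUnion]
  · refine Finset.sum_congr rfl fun p _ => Finset.sum_image fun w _ w' _ h => ?_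
    exact (List.cons.inj h).1
  · intro p _ p' _ hne
    refine Finset.disjoint_left.2 fun q hq hq' => hne ?_
    obtain ⟨w, -, rfl⟩ := Finset.mem_image.1 hq
    obtain ⟨w', -, h⟩ := Finset.mem_image.1 hq'
    exact (List.cons.inj h).2.symm

open Classical in
/-- The number of the canonical proper descendants of a node that are labelled by a neighbour of
`a`, weighted by powers of `r`. -/
noncomputable def nbrSum (F : Finset (Clause V)) (canon : V → Clause V) (sel : List V → Clause V)
    (G : SimpleGraph V) (a : V) (r : ℝ) : ℕ → List V → ℝ
  | 0, _ => 0
  | n + 1, p => ∑ w ∈ canonChildren F canon sel p,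
      ((if G.Adj w a then 1 else 0) + r * nbrSum F canon sel G a r n (w :: p))

theorem nbrSum_nonneg {r : ℝ} (hr : 0 ≤ r) (a : V) (n : ℕ) (p : List V) :
    0 ≤ nbrSum F canon sel G a r n p := by
  induction n generalizing p with
  | zero => exact le_rfl
  | succ n ih =>
    refine Finset.sum_nonneg fun w _ => add_nonneg ?_ (mul_nonneg hr (ih _))
    split_ifs
    · exact zero_le_one
    · exact le_rfl

theorem nbrSum_le_succ {r : ℝ} (hr : 0 ≤ r) (a : V) (n : ℕ) (p : List V) :
    nbrSum F canon sel G a r n p ≤ nbrSum F canon sel G a r (n + 1) p := by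
  induction n generalizing p with
  | zero => exact nbrSum_nonneg hr a 1 p
  | succ n ih =>
    rw [nbrSum, nbrSum]
    exact Finset.sum_le_sum fun w _ => add_le_add le_rfl (mul_le_mul_of_nonneg_left (ih _) hr)

theorem monotone_nbrSum {r : ℝ} (hr : 0 ≤ r) (a : V) (p : List V) :
    Monotone fun n => nbrSum F canon sel G a r n p :=
  monotone_nat_of_le_succ fun n => nbrSum_le_succ hr a n p

/-- A longer path sets more variables to `0`, which can only satisfy more negative literals. If the
canonical clause of `b` is violated at the longer path, it is violated at the shorter one too, its
positive literal being `b`; so it is the label there as well and has the same children. -/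
theorem canonChildren_append_subset (hcan : IsCanonicalChoice F canon)
    (hsel : IsClauseLabelling F canon sel) (b : V) (q s : List V)
    (hc : IsCanonicalNode F canon sel (b :: q)) :
    canonChildren F canon sel (b :: (q ++ s)) ⊆ canonChildren F canon sel (b :: q) := by
  intro w hw
  rw [mem_canonChildren, isCanonicalNode_cons] at hw ⊢
  obtain ⟨hw1, -, hw2, hw3⟩ := hw
  have hviol := (hsel b (q ++ s)).2.1
  rw [hw3] at hviol
  have hs : sel (b :: q) = canon b := by
    refine (hsel b q).2.2 ?_
    rintro ⟨⟨v, t⟩, hl, hv⟩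
    cases t
    · refine hviol ⟨(v, false), hl, ?_⟩
      simp only [assignmentLabel, decide_eq_false_iff_not, not_not] at hv ⊢
      rcases List.mem_cons.1 hv with h | h
      · exact List.mem_cons.2 (Or.inl h)
      · exact List.mem_cons.2 (Or.inr (List.mem_append_left _ h))
    · have hvb : v = b := (hcan b).2.2 _ hl rfl
      simp [assignmentLabel, hvb] at hv
  refine ⟨?_, hc, hw2, hs⟩
  rw [mem_children] at hw1 ⊢
  rwa [hs, ← hw3]

theorem nbrSum_append_le (hcan : IsCanonicalChoice F canon) (hsel : IsClauseLabelling F canon sel)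
    {r : ℝ} (hr : 0 ≤ r) (a : V) (n : ℕ) (b : V) (q s : List V)
    (hc : IsCanonicalNode F canon sel (b :: q)) :
    nbrSum F canon sel G a r n (b :: (q ++ s)) ≤ nbrSum F canon sel G a r n (b :: q) := by
  induction n generalizing b q with
  | zero => exact le_rfl
  | succ n ih =>
    have hsub := canonChildren_append_subset hcan hsel b q s hc
    rw [nbrSum, nbrSum]
    refine (Finset.sum_le_sum fun w hw => ?_).trans (Finset.sum_le_sum_of_subset_of_nonneg hsub
      fun w _ _ => add_nonneg ?_ (mul_nonneg hr (nbrSum_nonneg hr a n _)))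
    · exact add_le_add le_rfl (mul_le_mul_of_nonneg_left
        (ih w (b :: q) (mem_canonChildren.1 (hsub hw)).2) hr)
    · split_ifs
      · exact zero_le_one
      · exact le_rfl

open Classical in
theorem sum_canonNodes_nbrSum (a c : V) (r : ℝ) (n d : ℕ) :
    ∑ p ∈ canonNodes F canon sel a d, nbrSum F canon sel G c r n p =
      ∑ j ∈ Finset.range n, r ^ j * ∑ p ∈ canonNodes F canon sel a (d + j + 1),
        if ∃ w, p.head? = some w ∧ G.Adj w c then 1 else 0 := by
  induction n generalizing d with
  | zero => simp [nbrSum]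
  | succ n ih =>
    have h1 := ih (d + 1)
    rw [sum_canonNodes_succ] at h1
    have h2 := sum_canonNodes_succ (F := F) (canon := canon) (sel := sel)
      (fun p => if ∃ w, p.head? = some w ∧ G.Adj w c then (1 : ℝ) else 0) a d
    rw [Finset.sum_range_succ']
    simp only [nbrSum, Finset.sum_add_distrib, pow_succ', mul_assoc, ← Finset.mul_sum, pow_zero,
      one_mul, add_zero]
    rw [h1, h2, add_comm]
    congr 1
    · simp only [show ∀ j, d + 1 + j = d + (j + 1) by intro j; ring]
    · simp

theorem canonNodes_zero {a : V} (ha : a ∉ TwoCC F) : canonNodes F canon sel a 0 = {[a]} := by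
  classical
  exact Finset.filter_true_of_mem fun p hp => by
    rw [Finset.mem_singleton.1 hp]
    exact isCanonicalNode_singleton ha

/-- The density weighs depth `d` by `r ^ (d + 1)`, while `nbrSum` uses `r ^ (d - 1)`, hence `r ^ 2`.
Depth `0` drops out because `a` is not its own neighbour. -/
theorem sum_labelDensityAt [Fintype V] {a : V} (ha : a ∉ TwoCC F) (h : ℕ) (r : ℝ) :
    ∑ b ∈ nbrs G a, labelDensityAt F canon sel h b a r =
      (1 - 2 * r) ^ 2 / (1 - r) ^ 3 * (r ^ 2 * nbrSum F canon sel G a r h [a]) := by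
  classical
  simp only [labelDensityAt]
  rw [← Finset.mul_sum]
  congr 1
  have h1 := sum_canonNodes_nbrSum (F := F) (canon := canon) (sel := sel) (G := G) a a r h 0
  rw [canonNodes_zero ha, Finset.sum_singleton] at h1
  rw [h1, Finset.sum_comm, Finset.sum_range_succ', Finset.mul_sum]
  have h0 : ∑ b ∈ nbrs G a, ∑ _p ∈ (nodesAt sel a 0).filter
      (fun p => p.head? = some b ∧ IsCanonicalNode F canon sel p), r ^ (0 + 1) = 0 := by
    refine Finset.sum_eq_zero fun b hb => Finset.sum_eq_zero fun p hp => ?_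
    obtain ⟨hp, hb', -⟩ := Finset.mem_filter.1 hp
    rw [nodesAt, Finset.mem_singleton] at hp
    subst hp
    simp only [List.head?_cons, Option.some.injEq] at hb'
    subst hb'
    exact absurd (mem_nbrs.1 hb) (G.loopless.irrefl _)
  rw [h0, add_zero]
  refine Finset.sum_congr rfl fun j _ => ?_
  rw [zero_add]
  have h2 : ∀ b, ∑ _p ∈ (nodesAt sel a (j + 1)).filter
      (fun p => p.head? = some b ∧ IsCanonicalNode F canon sel p), r ^ (j + 1 + 1) =
      ∑ p ∈ canonNodes F canon sel a (j + 1), if p.head? = some b then r ^ (j + 1 + 1) else 0 := by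
    intro b
    rw [canonNodes, ← Finset.sum_filter, Finset.filter_filter]
    refine Finset.sum_congr (Finset.filter_congr fun p _ => and_comm) fun _ _ => rfl
  simp only [h2]
  rw [Finset.sum_comm, Finset.mul_sum, Finset.mul_sum]
  refine Finset.sum_congr rfl fun p hp => ?_
  obtain ⟨b, l, rfl⟩ := List.exists_cons_of_ne_nil (nodesAt_ne_nil (Finset.mem_filter.1 hp).1)
  simp only [List.head?_cons, Option.some.injEq, Finset.sum_ite_eq, exists_eq_left', mem_nbrs,
    G.adj_comm a b]
  split_ifs
  · ring
  · ring

/-- The part of the loss that is due to the edges not containing the root. -/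
noncomputable def innerLoss (F : Finset (Clause V)) (canon : V → Clause V) (sel : List V → Clause V)
    (G : SimpleGraph V) (k r : ℝ) : ℕ → List V → ℝ
  | 0, _ => 0
  | n + 1, p => ∑ w ∈ canonChildren F canon sel p,
      r * (k * nbrSum F canon sel G w r n (w :: p) + innerLoss F canon sel G k r n (w :: p))

omit [DecidableEq V] in
theorem list_sum_map_mul_sum {W : Type} (s : Finset W) (k : V → ℝ) (f : W → V → ℝ) (p : List V) :
    (p.map fun a => k a * ∑ w ∈ s, f w a).sum = ∑ w ∈ s, (p.map fun a => k a * f w a).sum := by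
  induction p with
  | nil => simp
  | cons a p ih =>
    simp only [List.map_cons, List.sum_cons, ih, Finset.sum_add_distrib]
    rw [Finset.mul_sum]

omit [DecidableEq V] in
theorem list_sum_map_ite (P : V → Prop) [DecidablePred P] (k f : V → ℝ) (r : ℝ) (p : List V) :
    (p.map fun a => k a * ((if P a then 1 else 0) + r * f a)).sum =
      (p.map fun a => if P a then k a else 0).sum + r * (p.map fun a => k a * f a).sum := by
  induction p with
  | nil => simp
  | cons a p ih =>
    simp only [List.map_cons, List.sum_cons, ih]
    split_ifs <;> ring

/-- Interchange of summation: rather than summing over the ancestors of each node, sum over the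
canonical descendants of each ancestor. The list `p` carries the ancestors already met, and
`innerLoss` accounts for those below. -/
theorem loss_edgeLoss (hsel : IsClauseLabelling F canon sel) {ε r g : ℝ} {x : V} (n : ℕ)
    (p : List V) (hx : x ∈ p) :
    loss F canon sel r g (edgeLoss G ε x r) n p =
      g * (p.map fun a => 4 / (3 + 2 * r) * (if a = x then rootWeight ε r else idWeight ε r) *
        nbrSum F canon sel G a r n p).sum +
      innerLoss F canon sel G (g * (4 / (3 + 2 * r) * idWeight ε r)) r n p := by
  classical
  induction n generalizing p with
  | zero => simp [loss, nbrSum, innerLoss]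
  | succ n ih =>
    rw [loss, innerLoss]
    simp only [nbrSum]
    rw [list_sum_map_mul_sum, Finset.mul_sum, ← Finset.sum_add_distrib]
    refine Finset.sum_congr rfl fun w hw => ?_
    have hwx : w ≠ x := fun h =>
      hsel.notMem_of_mem_children p w (mem_canonChildren.1 hw).1 (h ▸ hx)
    rw [ih (w :: p) (List.mem_cons_of_mem _ hx), List.map_cons, List.sum_cons, if_neg hwx,
      list_sum_map_ite, edgeLoss]
    ring

end

end PPSZ

namespace PPSZ

/-! ### Integration of the loss -/

/-- The maximum is at `ρ = n / (n + 2)`, where the value times `n (n + 2)` equals `4 ρ ^ (n + 1)`;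
and `ρ ^ (n + 1) ≤ exp (-2) ≤ 11/80`. -/
theorem pow_mul_one_sub_sq_le {s m : ℝ} (hs0 : 0 ≤ s) (hs1 : s ≤ 1) {n : ℕ} (hn : 1 ≤ n)
    (hm : m = n) : s ^ n * (1 - s) ^ 2 ≤ 11 / 20 / (m * (m + 2)) := by
  have hm1 : 1 ≤ m := by rw [hm]; exact_mod_cast hn
  have hm0 : 0 < m := by linarith
  obtain ⟨ρ, hρ⟩ : ∃ ρ, ρ = m / (m + 2) := ⟨_, rfl⟩
  have hρ0 : 0 < ρ := by rw [hρ]; positivity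
  have hρ1 : 1 - ρ = 2 / (m + 2) := by rw [hρ]; field_simp; ring
  have hρ1' : 0 < 1 - ρ := by rw [hρ1]; positivity
  -- Maximality of `ρ` without calculus: the exponents from `u ≤ exp (u - 1)` add up to `0`.
  have h1 : s / ρ ≤ Real.exp (s / ρ - 1) := by linarith [Real.add_one_le_exp (s / ρ - 1)]
  have h2 : (1 - s) / (1 - ρ) ≤ Real.exp ((1 - s) / (1 - ρ) - 1) := by
    linarith [Real.add_one_le_exp ((1 - s) / (1 - ρ) - 1)]
  have h3 : (s / ρ) ^ n * ((1 - s) / (1 - ρ)) ^ 2 ≤ 1 := by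
    refine (mul_le_mul (pow_le_pow_left₀ (by positivity) h1 n)
      (pow_le_pow_left₀ (div_nonneg (by linarith) hρ1'.le) h2 2)
      (sq_nonneg _) (by positivity)).trans (le_of_eq ?_)
    rw [← Real.exp_nat_mul, ← Real.exp_nat_mul, ← Real.exp_add, Real.exp_eq_one_iff, ← hm, hρ1, hρ]
    field_simp
    push_cast
    ring
  have h4 : s ^ n * (1 - s) ^ 2 ≤ ρ ^ n * (1 - ρ) ^ 2 := by
    rwa [div_pow, div_pow, div_mul_div_comm, div_le_one (by positivity)] at h3
  have h5 : ρ ^ (n + 1) ≤ 11 / 80 := by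
    have hlog := Real.le_log_one_add_of_nonneg (x := 2 / m) (by positivity)
    have e1 : 2 * (2 / m) / (2 / m + 2) = 2 / (m + 1) := by field_simp; ring
    have e2 : Real.log ρ = - Real.log (1 + 2 / m) := by
      rw [← Real.log_inv, hρ]
      congr 1
      field_simp
    rw [e1] at hlog
    have h6 : ((n + 1 : ℕ) : ℝ) * Real.log ρ ≤ -2 := by
      push_cast
      rw [← hm, e2]
      rw [div_le_iff₀ (by positivity)] at hlog
      linarith
    have h7 : ρ ^ (n + 1) = Real.exp (((n + 1 : ℕ) : ℝ) * Real.log ρ) := by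
      rw [Real.exp_nat_mul, Real.exp_log hρ0]
    rw [h7]
    refine (Real.exp_le_exp.2 h6).trans ?_
    have h8 := Real.exp_one_gt_d9
    have h9 : Real.exp (-2) = (Real.exp 1 ^ 2)⁻¹ := by
      rw [Real.exp_neg, ← Real.exp_nat_mul]
      norm_num
    rw [h9, inv_le_comm₀ (by positivity) (by norm_num)]
    nlinarith
  rw [le_div_iff₀ (by positivity)]
  have h6 : ρ ^ n * (1 - ρ) ^ 2 * (m * (m + 2)) = 4 * ρ ^ (n + 1) := by
    have h7 : (2 / (m + 2)) ^ 2 * (m * (m + 2)) = 4 * ρ := by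
      rw [hρ]
      field_simp
      ring
    rw [hρ1, pow_succ]
    linear_combination ρ ^ n * h7
  nlinarith [mul_le_mul_of_nonneg_right h4 (show 0 ≤ m * (m + 2) by positivity)]

theorem pow_mul_le {r : ℝ} (hr0 : 0 ≤ r) (hr1 : r ≤ 1 / 2) {n : ℕ} (hn : 1 ≤ n) :
    r ^ n * (1 - 2 * r) ^ 2 ≤ 11 / 20 / ((n : ℝ) * (n + 2)) * (1 / 2) ^ n := by
  have := mul_le_mul_of_nonneg_right (pow_mul_one_sub_sq_le (s := 2 * r) (by linarith)
    (by linarith) hn rfl) (show (0 : ℝ) ≤ (1 / 2) ^ n by positivity)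
  rw [mul_pow] at this
  refine le_trans (le_of_eq ?_) this
  have e : (2 : ℝ) ^ n * (1 / 2) ^ n = 1 := by
    rw [← mul_pow]
    norm_num
  linear_combination (-(r ^ n * (1 - 2 * r) ^ 2)) * e

section

variable {V : Type} [DecidableEq V] {F : Finset (Clause V)} {canon : V → Clause V}
  {sel : List V → Clause V} {G : SimpleGraph V} {h : ℕ} {Thr ε : ℝ}

theorem labelDensityAt_nonneg (b a : V) {r : ℝ} (hr0 : 0 ≤ r) (hr1 : r ≤ 1 / 2) :
    0 ≤ labelDensityAt F canon sel h b a r :=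
  mul_nonneg (div_nonneg (sq_nonneg _) (pow_nonneg (by linarith) 3))
    (Finset.sum_nonneg fun _ _ => Finset.sum_nonneg fun _ _ => pow_nonneg hr0 _)

theorem continuousOn_labelDensityAt (b a : V) :
    ContinuousOn (labelDensityAt F canon sel h b a) (Set.Icc 0 (1 / 2)) := by
  unfold labelDensityAt
  refine ContinuousOn.mul (ContinuousOn.div (by fun_prop) (by fun_prop) fun r hr => ?_) ?_
  · exact pow_ne_zero 3 (by linarith [hr.2])
  · refine continuousOn_finsetSum _ fun d _ => continuousOn_finsetSum _ fun p _ => by fun_prop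

theorem labelDensity_nonneg (b a : V) : 0 ≤ labelDensity F canon sel h b a :=
  intervalIntegral.integral_nonneg (by norm_num) fun _ hr =>
    labelDensityAt_nonneg b a hr.1 hr.2

variable [Fintype V]

/-- The total label density of the neighbours of `w` in the tree of `w`. -/
noncomputable def nbrDensity (F : Finset (Clause V)) (canon : V → Clause V)
    (sel : List V → Clause V) (G : SimpleGraph V) (h : ℕ) (w : V) (r : ℝ) : ℝ :=
  ∑ b ∈ nbrs G w, labelDensityAt F canon sel h b w r

theorem nbrDensity_nonneg (w : V) {r : ℝ} (hr0 : 0 ≤ r) (hr1 : r ≤ 1 / 2) :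
    0 ≤ nbrDensity F canon sel G h w r :=
  Finset.sum_nonneg fun b _ => labelDensityAt_nonneg b w hr0 hr1

theorem continuousOn_nbrDensity (w : V) :
    ContinuousOn (nbrDensity F canon sel G h w) (Set.Icc 0 (1 / 2)) :=
  continuousOn_finsetSum _ fun b _ => continuousOn_labelDensityAt b w

theorem IsLowGraph.integral_nbrDensity_le (hG : IsLowGraph F canon sel h Thr G) (hThr : 0 ≤ Thr)
    (w : V) : ∫ r in (0 : ℝ)..(1 / 2), nbrDensity F canon sel G h w r ≤ 2 * Thr := by
  unfold nbrDensity
  rw [intervalIntegral.integral_finsetSum fun b _ =>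
    (continuousOn_labelDensityAt b w).intervalIntegrable_of_Icc (by norm_num)]
  refine (Finset.sum_le_sum fun b hb => hG.density_le w b (mem_nbrs.1 hb)).trans ?_
  rw [Finset.sum_const, nsmul_eq_mul]
  have : ((nbrs G w).card : ℝ) ≤ 2 := by exact_mod_cast hG.card_nbrs_le w
  exact mul_le_mul_of_nonneg_right this hThr

theorem nbrSum_le_nbrDensity (hcan : IsCanonicalChoice F canon)
    (hsel : IsClauseLabelling F canon sel) {r : ℝ} (hr0 : 0 ≤ r) (hr1 : r ≤ 1 / 2) {w : V}
    (hw : w ∉ TwoCC F) {n : ℕ} (hn : n ≤ h) (q : List V) :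
    (1 - 2 * r) ^ 2 / (1 - r) ^ 3 * (r ^ 2 * nbrSum F canon sel G w r n (w :: q)) ≤
      nbrDensity F canon sel G h w r := by
  rw [nbrDensity, sum_labelDensityAt hw]
  refine mul_le_mul_of_nonneg_left (mul_le_mul_of_nonneg_left ?_ (sq_nonneg r))
    (div_nonneg (sq_nonneg _) (pow_nonneg (by linarith) 3))
  exact (nbrSum_append_le hcan hsel hr0 w n w [] q (isCanonicalNode_singleton hw)).trans
    (monotone_nbrSum hr0 w [w] hn)

/-- A majorant of the inner loss. -/
noncomputable def innerBound (F : Finset (Clause V)) (canon : V → Clause V)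
    (sel : List V → Clause V) (G : SimpleGraph V) (h : ℕ) (ε : ℝ) : ℕ → List V → ℝ → ℝ
  | 0, _, _ => 0
  | n + 1, p, r => ∑ w ∈ canonChildren F canon sel p,
      (21 / 10 * ε * (r ^ 2 * (1 - 2 * r) ^ 2) * nbrDensity F canon sel G h w r +
        r * innerBound F canon sel G h ε n (w :: p) r)

/-- Of the four factors `1 - 2 r`, three from `idWeight` and one from `1 - t ^ 2`, two belong to the
label density and two remain for the integration. The constant doubles because `4 / ((3 + 2 r) (1 -
r)) ≤ 2`. -/
theorem innerLoss_le (hcan : IsCanonicalChoice F canon)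
    (hsel : IsClauseLabelling F canon sel) (hε : 0 ≤ ε) {r : ℝ} (hr0 : 0 < r) (hr1 : r < 1 / 2)
    {n : ℕ} (hn : n ≤ h) (p : List V) :
    innerLoss F canon sel G (r * (r / (1 - r) * (21 / 20 * (1 - (r / (1 - r)) ^ 2))) *
      (4 / (3 + 2 * r) * idWeight ε r)) r n p ≤ innerBound F canon sel G h ε n p r := by
  induction n generalizing p with
  | zero => exact le_rfl
  | succ n ih =>
    rw [innerLoss, innerBound]
    refine Finset.sum_le_sum fun w hw => ?_
    rw [mul_add]
    refine add_le_add ?_ (mul_le_mul_of_nonneg_left (ih (by omega) _) hr0.le)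
    have hw2 : w ∉ TwoCC F := (mem_canonChildren.1 hw).2.1 w List.mem_cons_self
    have h1 := nbrSum_le_nbrDensity (G := G) hcan hsel hr0.le hr1.le hw2
      (show n ≤ h by omega) p
    set N := nbrSum F canon sel G w r n (w :: p)
    set B := nbrDensity F canon sel G h w r with hB
    have hB0 : 0 ≤ B := nbrDensity_nonneg w hr0.le hr1.le
    have hv : 0 < 1 - r := by linarith
    have hv' : (1 - r) ≠ 0 := hv.ne'
    have h3 : 0 < 3 + 2 * r := by linarith
    have e1 : r * (r * (r / (1 - r) * (21 / 20 * (1 - (r / (1 - r)) ^ 2))) *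
        (4 / (3 + 2 * r) * idWeight ε r) * N) =
        21 / 20 * ε * (r ^ 2 * (1 - 2 * r) ^ 2) * (4 / ((3 + 2 * r) * (1 - r))) *
        ((1 - 2 * r) ^ 2 / (1 - r) ^ 3 * (r ^ 2 * N)) := by
      rw [idWeight]
      field_simp
      ring
    have h4 : 4 / ((3 + 2 * r) * (1 - r)) ≤ 2 := by
      rw [div_le_iff₀ (mul_pos h3 hv)]
      nlinarith
    have h5 : 0 ≤ 21 / 20 * ε * (r ^ 2 * (1 - 2 * r) ^ 2) := by positivity
    rw [e1]
    refine (mul_le_mul_of_nonneg_left h1 (by positivity)).trans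
      (mul_le_mul_of_nonneg_right ?_ hB0)
    have := mul_le_mul_of_nonneg_left h4 h5
    linarith

theorem continuousOn_innerBound (n : ℕ) (p : List V) :
    ContinuousOn (innerBound F canon sel G h ε n p) (Set.Icc 0 (1 / 2)) := by
  induction n generalizing p with
  | zero => exact continuousOn_const
  | succ n ih =>
    simp only [innerBound]
    exact continuousOn_finsetSum _ fun w _ => ContinuousOn.add
      (ContinuousOn.mul (by fun_prop) (continuousOn_nbrDensity w))
      (continuousOn_id.mul (ih _))

theorem IsLowGraph.integral_pow_mul_nbrDensity_le (hG : IsLowGraph F canon sel h Thr G)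
    (hThr : 0 ≤ Thr) (w : V) (j : ℕ) :
    ∫ r in (0 : ℝ)..(1 / 2), r ^ (j + 2) * (1 - 2 * r) ^ 2 * nbrDensity F canon sel G h w r ≤
      11 / 10 * Thr * (1 / 2) ^ (j + 2) / (((j : ℝ) + 2) * (j + 4)) := by
  have h1 : ∫ r in (0 : ℝ)..(1 / 2), r ^ (j + 2) * (1 - 2 * r) ^ 2 * nbrDensity F canon sel G h w r ≤
      ∫ r in (0 : ℝ)..(1 / 2), 11 / 20 / (((j + 2 : ℕ) : ℝ) * ((j + 2 : ℕ) + 2)) * (1 / 2) ^ (j + 2) *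
        nbrDensity F canon sel G h w r := by
    refine intervalIntegral.integral_mono_on (by norm_num) ?_ ?_ fun r hr => ?_
    · exact (ContinuousOn.mul (by fun_prop)
        (continuousOn_nbrDensity w)).intervalIntegrable_of_Icc (by norm_num)
    · exact ((continuousOn_nbrDensity w).intervalIntegrable_of_Icc (by norm_num)).const_mul _
    · exact mul_le_mul_of_nonneg_right (pow_mul_le hr.1 hr.2 (by omega))
        (nbrDensity_nonneg w hr.1 hr.2)
  refine h1.trans ?_
  rw [intervalIntegral.integral_const_mul]
  refine (mul_le_mul_of_nonneg_left (hG.integral_nbrDensity_le hThr w)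
    (by positivity)).trans (le_of_eq ?_)
  push_cast
  have h2 : (j : ℝ) + 2 ≠ 0 := by positivity
  have h4 : (j : ℝ) + 4 ≠ 0 := by positivity
  rw [show (j : ℝ) + 2 + 2 = j + 4 by ring]
  field_simp
  ring

/-- At most two children per level balance the factor `1/2` gained from `r ^ j`. As `1 / ((j + 2) (j
+ 4))` is half of `1 / (j + 2) - 1 / (j + 4)`, the series telescopes to a bound independent of the
height. -/
theorem IsLowGraph.integral_innerBound_le (hF : IsThreeCNF F) (hone : OnesUnique F)
    (hsel : IsClauseLabelling F canon sel) (hG : IsLowGraph F canon sel h Thr G) (hThr : 0 ≤ Thr)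
    (hε : 0 ≤ ε) (n j : ℕ) (a : V) (q : List V) :
    ∫ r in (0 : ℝ)..(1 / 2), r ^ j * innerBound F canon sel G h ε n (a :: q) r ≤
      231 / 400 * ε * Thr * (1 / 2) ^ j * (1 / ((j : ℝ) + 2) + 1 / (j + 3)) := by
  induction n generalizing j a q with
  | zero =>
    simp only [innerBound, mul_zero, intervalIntegral.integral_zero]
    positivity
  | succ n ih =>
    have e1 : ∀ r : ℝ, r ^ j * innerBound F canon sel G h ε (n + 1) (a :: q) r =
        ∑ w ∈ canonChildren F canon sel (a :: q),
          (21 / 10 * ε * (r ^ (j + 2) * (1 - 2 * r) ^ 2 * nbrDensity F canon sel G h w r) +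
            r ^ (j + 1) * innerBound F canon sel G h ε n (w :: a :: q) r) := by
      intro r
      rw [innerBound, Finset.mul_sum]
      refine Finset.sum_congr rfl fun w _ => ?_
      ring
    have i1 : ∀ w, IntervalIntegrable (fun r : ℝ => 21 / 10 * ε *
        (r ^ (j + 2) * (1 - 2 * r) ^ 2 * nbrDensity F canon sel G h w r)) volume 0 (1 / 2) :=
      fun w => ((ContinuousOn.mul (by fun_prop)
        (continuousOn_nbrDensity w)).intervalIntegrable_of_Icc (by norm_num)).const_mul _
    have i2 : ∀ w, IntervalIntegrable (fun r : ℝ => r ^ (j + 1) *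
        innerBound F canon sel G h ε n (w :: a :: q) r) volume 0 (1 / 2) :=
      fun w => (ContinuousOn.mul (by fun_prop)
        (continuousOn_innerBound n _)).intervalIntegrable_of_Icc (by norm_num)
    simp only [e1]
    rw [intervalIntegral.integral_finsetSum fun w _ => (i1 w).add (i2 w)]
    set b : ℝ := 231 / 800 * ε * Thr * (1 / 2) ^ j * (1 / ((j : ℝ) + 2) + 1 / (j + 3)) with hb
    have hb0 : 0 ≤ b := by positivity
    have h1 : ∀ w ∈ canonChildren F canon sel (a :: q), ∫ r in (0 : ℝ)..(1 / 2),
        (21 / 10 * ε * (r ^ (j + 2) * (1 - 2 * r) ^ 2 * nbrDensity F canon sel G h w r) +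
          r ^ (j + 1) * innerBound F canon sel G h ε n (w :: a :: q) r) ≤ b := by
      intro w _
      rw [intervalIntegral.integral_add (i1 w) (i2 w), intervalIntegral.integral_const_mul]
      have h2 := mul_le_mul_of_nonneg_left (hG.integral_pow_mul_nbrDensity_le hThr w j)
        (show 0 ≤ 21 / 10 * ε by positivity)
      refine (add_le_add h2 (ih (j + 1) w (a :: q))).trans (le_of_eq ?_)
      rw [hb]
      push_cast
      rw [show (j : ℝ) + 1 + 2 = j + 3 by ring, show (j : ℝ) + 1 + 3 = j + 4 by ring]
      have h2 : (j : ℝ) + 2 ≠ 0 := by positivity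
      have h3 : (j : ℝ) + 3 ≠ 0 := by positivity
      have h4 : (j : ℝ) + 4 ≠ 0 := by positivity
      field_simp
      ring
    refine (Finset.sum_le_sum h1).trans ?_
    rw [Finset.sum_const, nsmul_eq_mul]
    have h2 : ((canonChildren F canon sel (a :: q)).card : ℝ) ≤ 2 := by
      exact_mod_cast (Finset.card_le_card fun w hw => (mem_canonChildren.1 hw).1).trans
        (hsel.card_children_le hF hone a q)
    refine (mul_le_mul_of_nonneg_right h2 hb0).trans (le_of_eq ?_)
    rw [hb]
    ring

/-- A majorant of the total loss. -/
noncomputable def lossBound (F : Finset (Clause V)) (canon : V → Clause V)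
    (sel : List V → Clause V) (G : SimpleGraph V) (h : ℕ) (ε : ℝ) (x : V) (r : ℝ) : ℝ :=
  innerBound F canon sel G h ε h [x] r + 107 / 400 * ε * nbrDensity F canon sel G h x r

theorem continuousOn_lossBound (x : V) :
    ContinuousOn (lossBound F canon sel G h ε x) (Set.Icc 0 (1 / 2)) :=
  (continuousOn_innerBound h [x]).add (continuousOn_const.mul (continuousOn_nbrDensity x))

theorem IsLowGraph.integral_lossBound_le (hF : IsThreeCNF F) (hone : OnesUnique F)
    (hsel : IsClauseLabelling F canon sel) (hG : IsLowGraph F canon sel h Thr G) (hThr : 0 ≤ Thr)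
    (hε : 0 ≤ ε) (x : V) :
    ∫ r in (0 : ℝ)..(1 / 2), lossBound F canon sel G h ε x r ≤ 1.0302 * ε * Thr := by
  unfold lossBound
  rw [intervalIntegral.integral_add
    ((continuousOn_innerBound h [x]).intervalIntegrable_of_Icc (by norm_num))
    (((continuousOn_nbrDensity x).intervalIntegrable_of_Icc (by norm_num)).const_mul _),
    intervalIntegral.integral_const_mul]
  have h1 := hG.integral_innerBound_le hF hone hsel hThr hε h 0 x []
  have h2 := mul_le_mul_of_nonneg_left (hG.integral_nbrDensity_le hThr x)
    (show 0 ≤ 107 / 400 * ε by positivity)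
  simp only [pow_zero, one_mul, CharP.cast_eq_zero] at h1
  have h3 : 0 ≤ ε * Thr := mul_nonneg hε hThr
  -- At `j = 0` the total is `231/400 * 5/6 + 2 * 107/400 = 1.01625`.
  norm_num at h1 h2 ⊢
  linarith

/-- An edge at the root is charged in the recursion and in the correction for `y`, `z`; both charges
are covered at once. For `r ≥ 1/5` the factor is at most `(21/20 + 1/10 * (3/5) ^ 2 * (4/5) ^ 3) / 4
< 107/400`; below, the weight is `0`. -/
theorem rootWeight_aux {r ε : ℝ} (hr0 : 0 < r) (hr1 : r < 1 / 2) (hε0 : 0 ≤ ε)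
    (hε1 : ε ≤ 1 / 10) :
    4 / (3 + 2 * r) * rootWeight ε r *
      (r * (r / (1 - r) * (21 / 20 * (1 - (r / (1 - r)) ^ 2))) + r * (1 - r) * idWeight ε r) ≤
    107 / 400 * ε * ((1 - 2 * r) ^ 2 / (1 - r) ^ 3 * r ^ 2) := by
  have hv : 0 < 1 - r := by linarith
  have h3 : 0 < 3 + 2 * r := by linarith
  have hu : 0 < 1 - 2 * r := by linarith
  obtain ⟨m, hm⟩ : ∃ m, m = max (5 * r - 1) 0 := ⟨_, rfl⟩
  have hm0 : 0 ≤ m := hm ▸ le_max_right _ _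
  have hc : 4 / (3 + 2 * r) * ((1 - 2 * r) * m) ≤ 1 / 4 := by
    rw [div_mul_eq_mul_div, div_le_iff₀ h3]
    rcases max_cases (5 * r - 1) 0 with ⟨h, _⟩ | ⟨h, _⟩
    · rw [hm, h]; nlinarith [sq_nonneg (32 * r - 11)]
    · rw [hm, h]; nlinarith
  have e1 : 4 / (3 + 2 * r) * rootWeight ε r *
      (r * (r / (1 - r) * (21 / 20 * (1 - (r / (1 - r)) ^ 2))) + r * (1 - r) * idWeight ε r) =
      4 / (3 + 2 * r) * ((1 - 2 * r) * m) * (21 / 20 + ε * ((1 - 2 * r) ^ 2 * (1 - r) ^ 3)) *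
        (ε * ((1 - 2 * r) ^ 2 / (1 - r) ^ 3 * r ^ 2)) := by
    rw [rootWeight, idWeight, ← hm]
    field_simp
    ring
  rw [e1, mul_assoc (107 / 400 : ℝ)]
  refine mul_le_mul_of_nonneg_right ?_ (by positivity)
  rcases max_cases (5 * r - 1) 0 with ⟨h, h5⟩ | ⟨h, _⟩
  · have h6 : (1 - 2 * r) ^ 2 ≤ (3 / 5) ^ 2 := pow_le_pow_left₀ hu.le (by linarith) 2
    have h7 : (1 - r) ^ 3 ≤ (4 / 5) ^ 3 := pow_le_pow_left₀ hv.le (by linarith) 3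
    have h8 := mul_le_mul h6 h7 (by positivity) (by positivity)
    have h9 := mul_le_mul hε1 h8 (by positivity) (by norm_num)
    refine (mul_le_mul hc (add_le_add le_rfl h9) (by positivity) (by norm_num)).trans ?_
    norm_num
  · rw [hm, h]
    norm_num

theorem loss_le_lossBound (hcan : IsCanonicalChoice F canon)
    (hsel : IsClauseLabelling F canon sel) {r : ℝ} (hr0 : 0 < r) (hr1 : r < 1 / 2) (hε0 : 0 ≤ ε)
    (hε1 : ε ≤ 1 / 10) {x y z : V} (hx : x ∉ TwoCC F) (hy : y ∉ TwoCC F) (hz : z ∉ TwoCC F)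
    (hyz : y ≠ z) (hroot : children sel [x] = {y, z}) (hselx : sel [x] = canon x) (n : ℕ) :
    loss F canon sel r (r * (r / (1 - r) * (21 / 20 * (1 - (r / (1 - r)) ^ 2)))) (edgeLoss G ε x r)
        (n + 1) [x] +
      r * (1 - r) * idWeight ε r * (edgeLoss G ε x r y [x] + edgeLoss G ε x r z [x]) ≤
    lossBound F canon sel G (n + 1) ε x r := by
  classical
  have h1 := innerLoss_le (G := G) hcan hsel hε0 hr0 hr1 (le_refl (n + 1)) [x]
  have h2 := nbrSum_le_nbrDensity (G := G) hcan hsel hr0.le hr1.le hx (le_refl (n + 1)) []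
  have hc1 : canonChildren F canon sel [x] = {y, z} := by
    rw [← hroot]
    refine Finset.filter_true_of_mem fun w hw => isCanonicalNode_cons.2
      ⟨isCanonicalNode_singleton hx, ?_, hselx⟩
    rw [hroot, Finset.mem_insert, Finset.mem_singleton] at hw
    rcases hw with rfl | rfl
    · exact hy
    · exact hz
  -- Any neighbour of `x` among `y`, `z` is already counted at depth one, so the correction charges
  -- fit into the root's term.
  have h3 : (if G.Adj y x then (1 : ℝ) else 0) + (if G.Adj z x then 1 else 0) ≤
      nbrSum F canon sel G x r (n + 1) [x] := by
    rw [nbrSum, hc1, Finset.sum_pair hyz]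
    have := mul_nonneg hr0.le (nbrSum_nonneg (F := F) (canon := canon) (sel := sel) (G := G)
      hr0.le x n [y, x])
    have := mul_nonneg hr0.le (nbrSum_nonneg (F := F) (canon := canon) (sel := sel) (G := G)
      hr0.le x n [z, x])
    linarith
  rw [loss_edgeLoss hsel (n + 1) [x] (by simp)]
  have e1 : ∀ w, edgeLoss G ε x r w [x] =
      4 / (3 + 2 * r) * rootWeight ε r * (if G.Adj w x then (1 : ℝ) else 0) := by
    intro w
    simp only [edgeLoss, List.map_cons, List.map_nil, List.sum_cons, List.sum_nil, if_true, add_zero]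
    split_ifs <;> ring
  rw [e1, e1]
  simp only [List.map_cons, List.map_nil, List.sum_cons, List.sum_nil, if_true, add_zero]
  have h4 := rootWeight_aux hr0 hr1 hε0 hε1
  set N := nbrSum F canon sel G x r (n + 1) [x] with hN
  have hN0 : 0 ≤ N := nbrSum_nonneg hr0.le x _ _
  have h5 : 0 ≤ r * (1 - r) * idWeight ε r * (4 / (3 + 2 * r) * rootWeight ε r) := by
    have := idWeight_nonneg hε0 hr0.le hr1.le
    have := rootWeight_nonneg (r := r) hε0
    have : 0 < 1 - r := by linarith
    positivity
  have h6 := mul_le_mul_of_nonneg_left h3 h5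
  have h7 := mul_le_mul_of_nonneg_right h4 hN0
  have h8 := mul_le_mul_of_nonneg_left h2 (show 0 ≤ 107 / 400 * ε by positivity)
  rw [lossBound]
  linarith

end

end PPSZ

namespace PPSZ

/-! ### The integrals over the position of the root variable -/

theorem gamma_sq_mul_eq {r : ℝ} (hr : r ≤ 1 / 2) :
    PPSZ.gamma r ^ 2 * (1 - (r / (1 - r)) ^ 2) ^ 2 =
      r ^ 2 * (1 - 2 * r) ^ 5 / (1 - r) ^ 4 := by
  have h : 1 - r ≠ 0 := by linarith
  rw [gamma_sq hr]
  field_simp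
  ring

theorem continuousOn_div_one_sub_sq :
    ContinuousOn (fun r : ℝ => (r / (1 - r)) ^ 2) (Set.Icc 0 (1 / 2)) :=
  (continuousOn_id.div (by fun_prop) fun r hr => by
    have := hr.2
    linarith).pow 2

theorem continuousOn_gamma_sq_mul :
    ContinuousOn (fun r : ℝ => PPSZ.gamma r ^ 2 * (1 - (r / (1 - r)) ^ 2) ^ 2)
      (Set.Icc 0 (1 / 2)) :=
  ContinuousOn.mul (fun r _ => ((hasDerivAt_gamma r).continuousAt.pow 2).continuousWithinAt)
    ((continuousOn_const.sub continuousOn_div_one_sub_sq).pow 2)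

theorem Q_eq_of_le_half {r : ℝ} (hr : r ≤ 1 / 2) : Q r = (r / (1 - r)) ^ 2 := by
  rcases hr.lt_or_eq with h | rfl
  · rw [Q, if_pos h]
  · norm_num [Q]

theorem integral_gamma_sq_mul_Q :
    ∫ r in (0 : ℝ)..(1 / 2), PPSZ.gamma r ^ 2 * (1 - Q r) ^ 2 =
      ∫ r in (0 : ℝ)..(1 / 2), PPSZ.gamma r ^ 2 * (1 - (r / (1 - r)) ^ 2) ^ 2 := by
  refine intervalIntegral.integral_congr fun r hr => ?_
  rw [Set.uIcc_of_le (by norm_num)] at hr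
  simp only [Q_eq_of_le_half hr.2]

/-- The antiderivative is the partial fraction expansion of `r ^ 2 (1 - 2 r) ^ 5 / (1 - r) ^ 4` in
powers of `1 - r`. -/
theorem integral_gamma_sq_mul :
    ∫ r in (0 : ℝ)..(1 / 2), PPSZ.gamma r ^ 2 * (1 - (r / (1 - r)) ^ 2) ^ 2 =
      170 * Real.log 2 - 707 / 6 := by
  have hd : ∀ r ∈ Set.uIcc (0 : ℝ) (1 / 2), HasDerivAt (fun r : ℝ =>
      -(1 / 3 * ((1 - r) ^ 3)⁻¹ - 6 * ((1 - r) ^ 2)⁻¹ + 61 * (1 - r)⁻¹ + 170 * Real.log (1 - r) -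
        280 * (1 - r) + 136 * (1 - r) ^ 2 - 48 * (1 - r) ^ 3 + 8 * (1 - r) ^ 4))
      (PPSZ.gamma r ^ 2 * (1 - (r / (1 - r)) ^ 2) ^ 2) r := by
    intro r hr
    rw [Set.uIcc_of_le (by norm_num)] at hr
    have h : 1 - r ≠ 0 := by
      have := hr.2
      linarith
    have h1 : HasDerivAt (fun r : ℝ => 1 - r) (-1) r := by
      simpa using (hasDerivAt_id r).const_sub 1
    have h2 := ((((((((h1.pow 3).inv (pow_ne_zero 3 h)).const_mul (1 / 3)).sub
      (((h1.pow 2).inv (pow_ne_zero 2 h)).const_mul 6)).add ((h1.inv h).const_mul 61)).add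
      ((h1.log h).const_mul 170)).sub (h1.const_mul 280)).add ((h1.pow 2).const_mul 136)).sub
      ((h1.pow 3).const_mul 48)
    refine ((h2.add ((h1.pow 4).const_mul 8)).neg).congr_deriv ?_
    rw [gamma_sq_mul_eq hr.2]
    simp only [Pi.pow_apply]
    field_simp
    ring
  rw [intervalIntegral.integral_eq_sub_of_hasDerivAt hd
    (continuousOn_gamma_sq_mul.intervalIntegrable_of_Icc (by norm_num))]
  have h : Real.log (1 - 1 / 2) = -Real.log 2 := by
    rw [← Real.log_inv]
    norm_num
  rw [h]
  norm_num
  ring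

theorem s3_eq : s3 = (∫ r in (0 : ℝ)..(1 / 2), (r / (1 - r)) ^ 2) + 1 / 2 := by
  have h1 : Set.EqOn Q (fun r => (r / (1 - r)) ^ 2) (Set.uIcc 0 (1 / 2)) := by
    intro r hr
    rw [Set.uIcc_of_le (by norm_num)] at hr
    exact Q_eq_of_le_half hr.2
  have h2 : Set.EqOn Q (fun _ => 1) (Set.uIcc (1 / 2) 1) := by
    intro r hr
    rw [Set.uIcc_of_le (by norm_num)] at hr
    rw [Q, if_neg (not_lt.2 hr.1)]
  have i1 : IntervalIntegrable Q volume 0 (1 / 2) :=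
    (continuousOn_div_one_sub_sq.intervalIntegrable_of_Icc (by norm_num)).congr
      (h1.symm.mono Set.uIoc_subset_uIcc)
  have i2 : IntervalIntegrable Q volume (1 / 2) 1 :=
    (intervalIntegrable_const (c := (1 : ℝ))).congr (h2.symm.mono Set.uIoc_subset_uIcc)
  rw [s3, ← intervalIntegral.integral_add_adjacent_intervals i1 i2,
    intervalIntegral.integral_congr h1, intervalIntegral.integral_congr h2]
  norm_num

theorem s3_le_one : s3 ≤ 1 := by
  have h : ∫ r in (0 : ℝ)..(1 / 2), (r / (1 - r)) ^ 2 ≤ ∫ r in (0 : ℝ)..(1 / 2), (1 : ℝ) := by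
    refine intervalIntegral.integral_mono_on (by norm_num)
      (continuousOn_div_one_sub_sq.intervalIntegrable_of_Icc (by norm_num))
      intervalIntegrable_const fun r hr => ?_
    have h0 := hr.1
    have h1 := hr.2
    refine pow_le_one₀ (div_nonneg h0 (by linarith)) ?_
    rw [div_le_one (by linarith)]
    linarith
  rw [s3_eq]
  norm_num at h ⊢
  linarith

/-! ### Late root variables -/

section

variable {V : Type} [DecidableEq V] {F : Finset (Clause V)} {canon : V → Clause V}
  {sel : List V → Clause V} {G : SimpleGraph V} {h : ℕ} {Thr ε r : ℝ} {x y z : V}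

/-- First moment bound: each node has at most two children, each kept with probability at most `1 -
r`. -/
theorem one_sub_pow_le_cutProb {ch : List V → Finset V} {D : V → List V → ℝ}
    (hcard : ∀ a q, (ch (a :: q)).card ≤ 2) (hD : ∀ w p, D w p ∈ Set.Icc (0 : ℝ) 1)
    (hr : r ≤ 1) (hDr : ∀ q, x ∈ q → ∀ w ∈ ch q, r ≤ D w q) (n : ℕ) (a : V) (q : List V)
    (hx : x ∈ a :: q) : 1 - (2 * (1 - r)) ^ n ≤ cutProb ch D n (a :: q) := by
  induction n generalizing a q with
  | zero => simp [cutProb]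
  | succ n ih =>
    have h0 : 0 ≤ (1 - r) * (2 * (1 - r)) ^ n := by
      have : 0 ≤ 1 - r := by linarith
      positivity
    have h1 : ∀ w ∈ ch (a :: q), (1 - D w (a :: q)) * (1 - cutProb ch D n (w :: a :: q)) ≤
        (1 - r) * (2 * (1 - r)) ^ n := fun w hw => by
      have h2 := ih w (a :: q) (List.mem_cons_of_mem _ hx)
      have h3 := hDr _ hx w hw
      have h4 := cutProb_mem_Icc (ch := ch) hD n (w :: a :: q)
      exact mul_le_mul (by linarith) (by linarith) (by linarith [h4.2]) (by linarith)
    have h2 : ∀ s : Finset V, s ⊆ ch (a :: q) →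
        1 - ∑ w ∈ s, (1 - D w (a :: q)) * (1 - cutProb ch D n (w :: a :: q)) ≤
          ∏ w ∈ s, (1 - (1 - D w (a :: q)) * (1 - cutProb ch D n (w :: a :: q))) := by
      intro s _
      induction s using Finset.induction_on with
      | empty => simp
      | insert w s hw ihs =>
        rw [Finset.sum_insert hw, Finset.prod_insert hw]
        have h5 := one_sub_mul_mem_Icc (hD w (a :: q)) (cutProb_mem_Icc (ch := ch) hD n (w :: a :: q))
        have h6 : ∏ w ∈ s, (1 - (1 - D w (a :: q)) * (1 - cutProb ch D n (w :: a :: q))) ≤ 1 :=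
          Finset.prod_le_one (fun w _ => (one_sub_mul_mem_Icc (hD w (a :: q))
            (cutProb_mem_Icc (ch := ch) hD n (w :: a :: q))).1) fun w _ =>
            (one_sub_mul_mem_Icc (hD w (a :: q))
            (cutProb_mem_Icc (ch := ch) hD n (w :: a :: q))).2
        have h7 := ihs (by grind)
        nlinarith [h5.1, h5.2]
    refine le_trans ?_ (h2 _ subset_rfl)
    have h3 := Finset.sum_le_sum h1
    rw [Finset.sum_const, nsmul_eq_mul] at h3
    have h4 : ((ch (a :: q)).card : ℝ) ≤ 2 := by exact_mod_cast hcard a q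
    have h5 := mul_le_mul_of_nonneg_right h4 h0
    rw [pow_succ]
    linarith

variable [Fintype V]

/-- Beyond `1/2` all of `γ`, `φ` and `γ_TwoCC` vanish at `r`, so the bits are independent with the
uniform probabilities. -/
theorem one_sub_pow_le_condCutProb (hF : IsThreeCNF F) (hone : OnesUnique F)
    (hsel : IsClauseLabelling F canon sel) (hr0 : 1 / 2 < r) (hr1 : r ≤ 1) (ε : ℝ) (x : V) (n : ℕ) :
    1 - (2 * (1 - r)) ^ n ≤ condCutProb F sel G ε n x r := by
  classical
  have hp : ∀ v, placedBefore F ε x r v = if v = x then 0 else r := by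
    intro v
    have : gammaTwoCC r = 0 := if_neg (not_le.2 hr0)
    simp [placedBefore, this]
  have hp01 : ∀ v, placedBefore F ε x r v ∈ Set.Icc (0 : ℝ) 1 := by
    intro v
    rw [hp]
    split_ifs
    · simp
    · exact ⟨by linarith, hr1⟩
  have hm : ∀ b v, meanPhi x r b v = 0 := by
    intro b v
    simp [meanPhi, phi_of_half_le hr0.le, gamma_of_half_le hr0.le]
  have hc : condCutProb F sel G ε n x r = bexp (placedBefore F ε x r) (cutInd sel n x) := by
    unfold condCutProb
    congr 1
    funext b
    rw [Finset.prod_eq_one, mul_one]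
    intro c _
    rw [Finset.sum_eq_zero, mul_zero, add_zero]
    intro e _
    induction e with | _ u v => simp [hm]
  have hch : ∀ q, ∀ w ∈ children sel q, w ∉ q := hsel.notMem_of_mem_children
  have key := cutProb_le_bexp_cutInd (K := fun _ => true) (m := id) (x := x) hp01 hch
    (fun w q hw _ _ => ⟨fun a ha e => hw ((show a = w from e) ▸ ha), rfl⟩) n
  rw [hc]
  refine le_trans ?_ key
  refine one_sub_pow_le_cutProb (x := x) (hsel.card_children_le hF hone) (keepProb_mem_Icc hp01 _)
    hr1 (fun q hq w hw => ?_) n x [] (by simp)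
  have hwx : w ≠ x := fun e => hch q w hw (e ▸ hq)
  simp [keepProb, hp, hwx]

theorem sub_lossBound_le_condCutProb (hF : IsThreeCNF F) (hone : OnesUnique F)
    (hcan : IsCanonicalChoice F canon) (hsel : IsClauseLabelling F canon sel)
    (hG : IsLowGraph F canon sel h Thr G) (hr0 : 0 < r) (hr1 : r < 1 / 2) (hε0 : 0 ≤ ε)
    (hε1 : ε ≤ 1 / 10) (hx : x ∉ TwoCC F) (hyz : G.Adj y z) (hxy : y ≠ x) (hxz : z ≠ x)
    (hroot : children sel [x] = {y, z}) (hselx : sel [x] = canon x) (n : ℕ) :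
    (r / (1 - r)) ^ 2 - lossBound F canon sel G (n + 1) ε x r - (1 / 2 + r) ^ (n + 1) +
      ε * (PPSZ.gamma r ^ 2 * (1 - (r / (1 - r)) ^ 2) ^ 2) ≤ condCutProb F sel G ε (n + 1) x r := by
  have h1 := le_condCutProb hF hone hcan hsel hG hr0 hr1 hε0 hε1 hx hyz hxy hxz hroot hselx n
  have h2 := loss_le_lossBound (G := G) hcan hsel hr0 hr1 hε0 hε1 hx (hG.notMem_twoCC hyz)
    (hG.notMem_twoCC hyz.symm) hyz.ne hroot hselx n
  linarith

omit [Fintype V] in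
theorem IsClauseLabelling.root_eq (hF : IsThreeCNF F) (hcan : IsCanonicalChoice F canon)
    (hsel : IsClauseLabelling F canon sel)
    (hc : canon x = {(x, true), (y, false), (z, false)}) :
    y ≠ x ∧ z ≠ x ∧ sel [x] = canon x ∧ children sel [x] = {y, z} := by
  have hp := (hF _ (hcan x).1).2 x
  rw [hc] at hp
  have hy : y ≠ x := by
    rintro rfl
    exact hp (by simp)
  have hz : z ≠ x := by
    rintro rfl
    exact hp (by simp)
  have hs : sel [x] = canon x := by
    refine (hsel x []).2.2 ?_
    rw [hc]
    rintro ⟨l, hl, hl'⟩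
    simp only [Finset.mem_insert, Finset.mem_singleton] at hl
    rcases hl with rfl | rfl | rfl <;> simp_all [assignmentLabel]
  refine ⟨hy, hz, hs, ?_⟩
  ext w
  rw [mem_children, hs, hc]
  simp

/-- The bound for trees of positive height. -/
theorem le_measureReal_cutEvent (hF : IsThreeCNF F) (hone : OnesUnique F)
    (hcan : IsCanonicalChoice F canon) (hsel : IsClauseLabelling F canon sel) {n : ℕ}
    (hG : IsLowGraph F canon sel (n + 1) Thr G) (hε0 : 0 ≤ ε) (hε1 : ε ≤ 1 / 10)
    (hx : x ∉ TwoCC F) (hc : canon x = {(x, true), (y, false), (z, false)}) (hyz : G.Adj y z) :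
    s3 - 2 / ((n + 1 : ℕ) + 1) - 1.0302 * ε * Thr +
        ε * ∫ r in (0 : ℝ)..(1 / 2), PPSZ.gamma r ^ 2 * (1 - (r / (1 - r)) ^ 2) ^ 2 ≤
      (placementDist F G ε).real (cutEvent sel (n + 1) x) := by
  obtain ⟨hxy, hxz, hselx, hroot⟩ := hsel.root_eq hF hcan hc
  -- The edge `{y, z}` bounds `Thr` from below by a nonnegative density.
  have hThr : 0 ≤ Thr := (labelDensity_nonneg z y).trans (hG.density_le y z hyz)
  have hloss := IsLowGraph.integral_lossBound_le hF hone hsel hG hThr hε0 x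
  obtain ⟨hint, hle⟩ := integral_condCutProb_le (fun _ _ => hG.notMem_twoCC) ε sel (n + 1) hx
  refine le_trans ?_ hle
  have i0 : IntervalIntegrable (condCutProb F sel G ε (n + 1) x) volume 0 1 := by
    rw [intervalIntegrable_iff_integrableOn_Icc_of_le zero_le_one]
    exact hint
  have i1 : IntervalIntegrable (condCutProb F sel G ε (n + 1) x) volume 0 (1 / 2) :=
    i0.mono_set (by
      rw [Set.uIcc_of_le (by norm_num), Set.uIcc_of_le (by norm_num)]
      exact Set.Icc_subset_Icc_right (by norm_num))
  have i2 : IntervalIntegrable (condCutProb F sel G ε (n + 1) x) volume (1 / 2) 1 :=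
    i0.mono_set (by
      rw [Set.uIcc_of_le (by norm_num), Set.uIcc_of_le (by norm_num)]
      exact Set.Icc_subset_Icc_left (by norm_num))
  rw [integral_Icc_eq_integral_Ioc, ← intervalIntegral.integral_of_le zero_le_one,
    ← intervalIntegral.integral_add_adjacent_intervals i1 i2, s3_eq]
  have half : (0 : ℝ) ≤ 1 / 2 := by norm_num
  have j1 := continuousOn_div_one_sub_sq.intervalIntegrable_of_Icc (μ := volume) half
  have j2 := (continuousOn_lossBound (F := F) (canon := canon) (sel := sel) (G := G) (h := n + 1)
    (ε := ε) x).intervalIntegrable_of_Icc (μ := volume) half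
  have j3 : IntervalIntegrable (fun r : ℝ => (1 / 2 + r) ^ (n + 1)) volume 0 (1 / 2) :=
    Continuous.intervalIntegrable (by fun_prop) _ _
  have j4 := (continuousOn_gamma_sq_mul.intervalIntegrable_of_Icc (μ := volume) half).const_mul ε
  have k1 := intervalIntegral.integral_mono_on_of_le_Ioo half (((j1.sub j2).sub j3).add j4) i1
    fun r hr => sub_lossBound_le_condCutProb hF hone hcan hsel hG hr.1 hr.2 hε0 hε1 hx hyz hxy hxz
      hroot hselx n
  rw [intervalIntegral.integral_add ((j1.sub j2).sub j3) j4,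
    intervalIntegral.integral_sub (j1.sub j2) j3, intervalIntegral.integral_sub j1 j2,
    intervalIntegral.integral_const_mul] at k1
  have j5 : IntervalIntegrable (fun r : ℝ => 1 - (2 * (1 - r)) ^ (n + 1)) volume (1 / 2) 1 :=
    Continuous.intervalIntegrable (by fun_prop) _ _
  have k2 := intervalIntegral.integral_mono_on_of_le_Ioo (by norm_num) j5 i2
    fun r hr => one_sub_pow_le_condCutProb hF hone hsel hr.1 hr.2.le ε x (n + 1)
  have hn : (0 : ℝ) < (n : ℝ) + 2 := by positivity
  -- With height `n + 1`, the early part contributes an error of at most `1 / (n + 2)` and the late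
  -- part half of that; `2 / (n + 2)` covers both.
  have e1 : ∫ r in (0 : ℝ)..(1 / 2), (1 / 2 + r) ^ (n + 1) ≤ 1 / ((n : ℝ) + 2) := by
    rw [intervalIntegral.integral_comp_add_left (fun r : ℝ => r ^ (n + 1)), integral_pow]
    push_cast
    rw [show (n : ℝ) + 1 + 1 = n + 2 by ring]
    refine div_le_div_of_nonneg_right ?_ hn.le
    norm_num
  have e2 : ∫ r in (1 / 2 : ℝ)..1, (1 - (2 * (1 - r)) ^ (n + 1)) =
      1 / 2 - 1 / 2 * (1 / ((n : ℝ) + 2)) := by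
    rw [intervalIntegral.integral_sub intervalIntegrable_const
      (Continuous.intervalIntegrable (by fun_prop) _ _),
      intervalIntegral.integral_comp_sub_left (fun r : ℝ => (2 * r) ^ (n + 1)),
      intervalIntegral.integral_comp_mul_left (fun r : ℝ => r ^ (n + 1)) two_ne_zero, integral_pow]
    push_cast
    rw [show (n : ℝ) + 1 + 1 = n + 2 by ring]
    norm_num
  rw [e2] at k2
  have e3 : (2 : ℝ) / ((n + 1 : ℕ) + 1) = 2 * (1 / ((n : ℝ) + 2)) := by
    push_cast
    rw [show (n : ℝ) + 1 + 1 = n + 2 by ring]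
    ring
  rw [e3]
  have h5 : 0 < 1 / ((n : ℝ) + 2) := by positivity
  linarith

end

end PPSZ

theorem mainTheorem3 :
    (∃ err : ℕ → ℝ, Tendsto err atTop (𝓝 0) ∧
      ∀ (V : Type) [Fintype V] [DecidableEq V] (F : Finset (Clause V)) (canon : V → Clause V)
        (sel : List V → Clause V) (h : ℕ) (Thr ε : ℝ) (Hlow : SimpleGraph V) (x y z : V),
        IsThreeCNF F → OnesUnique F → IsCanonicalChoice F canon →
        IsClauseLabelling F canon sel → IsLowGraph F canon sel h Thr Hlow →
        0 ≤ ε → ε ≤ 1 / 10 →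
        x ∉ TwoCC F → canon x = {(x, true), (y, false), (z, false)} → Hlow.Adj y z →
        s3 - err h - 1.0302 * ε * Thr
            + ε * ∫ r in (0 : ℝ)..(1 / 2), PPSZ.gamma r ^ 2 * (1 - Q r) ^ 2
          ≤ (placementDist F Hlow ε).real (cutEvent sel h x)) ∧
    (∫ r in (0 : ℝ)..(1 / 2), PPSZ.gamma r ^ 2 * (1 - Q r) ^ 2) = 170 * Real.log 2 - 707 / 6 ∧
    (0.00168728 : ℝ) ≤ 170 * Real.log 2 - 707 / 6 := by
  have h1 := Real.log_two_gt_d9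
  have h2 := Real.log_two_lt_d9
  rw [integral_gamma_sq_mul_Q]
  refine ⟨⟨fun h => 2 / ((h : ℝ) + 1), ?_, ?_⟩, integral_gamma_sq_mul, by linarith⟩
  · exact tendsto_const_nhds.div_atTop
      (tendsto_atTop_add_const_right _ _ tendsto_natCast_atTop_atTop)
  · intro V _ _ F canon sel h Thr ε G x y z hF hone hcan hsel hG hε0 hε1 hx hc hyz
    cases h with
    | succ n => exact le_measureReal_cutEvent hF hone hcan hsel hG hε0 hε1 hx hc hyz
    | zero =>
      have hThr : 0 ≤ Thr := (labelDensity_nonneg z y).trans (hG.density_le y z hyz)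
      -- At height `0` the error term is `2`, which exceeds `s3 ≤ 1` plus the gain, at most `1/10`.
      refine le_trans ?_ measureReal_nonneg
      rw [integral_gamma_sq_mul]
      have h3 := s3_le_one
      have h4 := mul_nonneg hε0 hThr
      have h5 : ε * (170 * Real.log 2 - 707 / 6) ≤ 1 / 10 * 1 :=
        mul_le_mul hε1 (by linarith) (by linarith) (by norm_num)
      norm_num at h5 ⊢
      linarith
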